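/- **Terms.** Terms are built from variables, names and function symbols (arity after the slash). Public symbols: constants $\mathtt{p_s},\mathtt{p_d},\mathtt{true},\mathtt{false},\bot$, the channel $\mathtt{os}$, the message tags $\mathtt{reset\_req}$, $\mathtt{reset\_resp}$, $\mathtt{extend\_req}$, $\mathtt{extend\_resp}$, $\mathtt{ext\_channel}$, $\mathtt{tag\_unseal}$, $\mathtt{tag\_plain}$, $\mathtt{drt\_req}$, $\mathtt{drt\_resp}$; $\mathtt h/1,\mathtt{senc}/2,\mathtt{sdec}/2,\mathtt{seal}/2,\mathtt{prog}/1$; the readers $\mathtt{pcr},\mathtt{int},\mathtt{cache},\mathtt{stm},\mathtt{smi},\mathtt{init},\mathtt{pp},\mathtt{lock}$ (all $/1$); the writers $\mathtt{reset}/3,\mathtt{extend}/3,\mathtt{set\_int}/3,\mathtt{cache}/2,\mathtt{flush\_stm}/1,\mathtt{flush\_smi}/1,\mathtt{set\_init}/3,\mathtt{set\_pp}/3,\mathtt{set\_lock}/3$; $n$-tuples $(T_1,\dots,T_n)$ and their projections. Private symbols: $\mathtt{unseal}/2,\mathtt{get\_entry}/1,\mathtt{state}/4,\mathtt{tpm}/1,\mathtt{cpu}/2,\mathtt{smram}/2,\mathtt{drt}/3,\mathtt{set\_pcr}/3,\mathtt{is\_small}/1,\mathtt{is\_big}/1,\mathtt{tpm\_ch}/1$,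 and the constants $\mathtt{tpm\_acc},\mathtt{cpu\_acc},\mathtt{cpu\_tpm}$ and infinitely many program entry points, among them $\mathtt{Tinit},\mathtt{Tstm},\mathtt{Tpp}$. Put $\mathtt{chain}(T_0)=T_0$ and $\mathtt{chain}(T_0,\dots,T_n)=\mathtt h((\mathtt{chain}(T_0,\dots,T_{n-1}),T_n))$; $\mathtt{length}(T)$ is the greatest $n$ with $T=\mathtt{chain}(T_0,\dots,T_n)$ for some $T_i$. **Theory.** Fix $b\in\mathbb N$. All notions are modulo the convergent rewrite system $\mathcal E^b_{\mathtt{drt}}$ with the following rules. $\mathtt{sdec}(\mathtt{senc}(x,k),k)\to x$; $\mathtt{unseal}(\mathtt{seal}(x,p),p)\to x$; $\mathtt{get\_entry}(\mathtt{prog}(x))\to x$; the $i$-th projection of $(x_1,\dots,x_n)$ rewrites to $x_i$. On $s=\mathtt{state}(\mathtt{tpm}(p),\mathtt{cpu}(i,c),\mathtt{smram}(m,a),\mathtt{drt}(d,e,l))$: $\mathtt{pcr}(s)\to p$, $\mathtt{int}(s)\to i$, $\mathtt{cache}(s)\to c$, $\mathtt{stm}(s)\to m$, $\mathtt{smi}(s)\to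 a$, $\mathtt{init}(s)\to d$, $\mathtt{pp}(s)\to e$, $\mathtt{lock}(s)\to l$. The rules below rewrite to $s$ with the indicated change (every rule, for reading or writing, requires of $s$ only the structure it mentions): $\mathtt{reset}(s,\mathtt{tpm\_acc},v)$ for $v\in\{\mathtt{p_s},\mathtt{p_d}\}$: $p:=v$; $\mathtt{extend}(s,\mathtt{tpm\_acc},v)$: $p:=\mathtt h((p,v))$; $\mathtt{set\_pcr}(s,\mathtt{tpm\_acc},v)$: $p:=v$; $\mathtt{set\_int}(s,k,v)$: $i:=v$, if $k=\mathtt{cpu\_acc}$, or if $e=\mathtt{prog}(k)$ and $l=\mathtt{true}$; $\mathtt{cache}(s,v)$: $c:=v$; $\mathtt{flush\_stm}(s)$: $m:=c$, if $l=\mathtt{false}$; $\mathtt{flush\_smi}(s)$: $a:=c$; $\mathtt{set\_init}(s,\mathtt{cpu\_acc},v)$: $d:=v$; $\mathtt{set\_pp}(s,k,v)$: $e:=v$, if $k=\mathtt{cpu\_acc}$, or $d=\mathtt{prog}(k)$, or $k=(z_1,z_2)$, $i=\mathtt{true}$, $m=\mathtt{prog}(z_1)$, $a=\mathtt{prog}(z_2)$;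 $\mathtt{set\_lock}(s,k,v)$: $l:=v$, if $k=\mathtt{cpu\_acc}$, or $e=\mathtt{prog}(k)$, or $k=(z_1,z_2)$, $i=\mathtt{true}$, $m=\mathtt{prog}(z_1)$, $a=\mathtt{prog}(z_2)$. Finally $\mathtt{is\_small}(\mathtt{chain}(v_0,\dots,v_j))\to\mathtt{true}$ for $0\le j<b$, $v_0\in\{\mathtt{p_s},\mathtt{p_d}\}$, and $\mathtt{is\_big}(\mathtt{chain}(v_0,\dots,v_{b+1}))\to\mathtt{true}$. The destructors are the root symbols of the left-hand sides. $T{\downarrow}$ is the normal form, $U=_{\mathcal E}V$ means $U{\downarrow}=V{\downarrow}$, and $S\vdash T$ is the least relation such that $S\vdash T$ if $T=_{\mathcal E}T'$ for some $T'\in S$, or if $T=_{\mathcal E}f(T_1,\dots,T_n)$ with $f$ public and $S\vdash T_i$ for all $i$. **Processes.** $P::=0\mid P|Q\mid {!P}\mid \nu n;P\mid \mathsf{in}(U,A);P\mid\mathsf{out}(U,T);P\mid \mathsf{if}\ U=V\ \mathsf{then}\ P\ \mathsf{else}\ Q\mid \mathsf{let}\ x=T\ \mathsf{in}\ P$, where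 an input pattern $A$ is a variable (which it binds), a term $=M$ to be matched, or a tuple of patterns. A missing $\mathsf{else}$ branch is $0$; tags in patterns are matched. Configurations are triples $(\mathcal N,\mathcal M,\mathcal P)$ of the names in use, the terms known to the attacker and the multiset of running processes; a step unfolds $0$, $|$ or $!$ in the usual way, or replaces $\nu n;P$ by $P$ with $n$ replaced by a fresh copy $n'\notin\mathcal N$ of $n$, which is added to $\mathcal N$; $\mathsf{out}(U,T);P$ and $\mathsf{in}(U',A);Q$, where $U=_{\mathcal E}U'$ and $T=_{\mathcal E}A\sigma$, by $P$ and $Q\sigma{\downarrow}$, adding $T$ to $\mathcal M$ iff $\mathcal M\vdash U$; a conditional by the branch selected by whether $U=_{\mathcal E}V$; $\mathsf{let}\ x=T\ \mathsf{in}\ P$ by $P[x\mapsto T{\downarrow}]$, provided $T{\downarrow}$ contains no destructor. An attacker against $P$ is a closed process $Q$ without private symbols, whose free and restricted names are distinct from the names restricted in $P$. $\mathtt{Att}(P)$ is the set of terms $T$ such that, for some attacker $Q$, a configuration with $\mathcal M\vdash T$ is reachable from $(\mathcal N_0,\emptyset,\{P|Q\})$, where $\mathcal N_0$ is the set of free names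 of $P|Q$. **The platform.** $\mathtt{DRT}=\mathtt{TPM}\,|\,\mathtt{EXEC}$ with $\mathtt{TPM}={!\mathtt{TPM_{RESET}}}\,|\,{!\mathtt{TPM_{EXTEND}}}\,|\,{!\mathtt{TPM_{UNSEAL}}}$; $\mathtt{TPM_{RESET}}=\mathsf{let}\ (ch,rv)=(\mathtt{cpu\_tpm},\mathtt{p_d})\ \mathsf{in}\ {!\mathtt{PCR_{RESET}}}\,|\,\mathsf{let}\ (ch,rv)=(\mathtt{os},\mathtt{p_s})\ \mathsf{in}\ {!\mathtt{PCR_{RESET}}}$; $\mathtt{PCR_{RESET}}=\mathsf{in}(ch,(\mathtt{reset\_req},nonce,st));\mathsf{let}\ st'=\mathtt{reset}(st,\mathtt{tpm\_acc},rv)\ \mathsf{in}\ \mathsf{out}(ch,(\mathtt{reset\_resp},nonce,st'))$; $\mathtt{TPM_{EXTEND}}=\mathsf{let}\ ch=\mathtt{cpu\_tpm}\ \mathsf{in}\ {!\mathtt{PCR_{EXTEND}}}\,|\,\mathsf{let}\ ch=\mathtt{os}\ \mathsf{in}\ {!\mathtt{PCR_{EXTEND}}}\,|\,{!(\mathsf{in}(\mathtt{cpu\_tpm},(\mathtt{ext\_channel},ch));{!\mathtt{PCR_{EXTEND}}})}$;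 $\mathtt{PCR_{EXTEND}}=\mathsf{in}(ch,(\mathtt{extend\_req},nonce,st,v));\mathsf{let}\ st'=\mathtt{extend}(st,\mathtt{tpm\_acc},v)\ \mathsf{in}\ \mathsf{out}(ch,(\mathtt{extend\_resp},nonce,st'))$; $\mathtt{TPM_{UNSEAL}}=\mathsf{in}(\mathtt{os},st);\mathsf{if}\ \mathtt{lock}(st)=\mathtt{true}\ \mathsf{then}\ \mathsf{let}\ ch=\mathtt{tpm\_ch}(\mathtt{pp}(st))\ \mathsf{in}\ \mathtt{UNSEAL}\ \mathsf{else}\ \mathsf{let}\ ch=\mathtt{os}\ \mathsf{in}\ \mathtt{UNSEAL}$; $\mathtt{UNSEAL}=\mathsf{in}(ch,(\mathtt{tag\_unseal},blob));\mathsf{let}\ v=\mathtt{unseal}(blob,\mathtt{pcr}(st))\ \mathsf{in}\ \mathsf{out}(ch,(\mathtt{tag\_plain},v))$; $\mathtt{EXEC}=\mathtt{CPU}\,|\,{!\mathtt{INIT}}\,|\,\mathtt{SETUP}\,|\,\mathtt{DATA}\,|\,{!\mathtt{PP}}$; $\mathtt{CPU}={!\,}\mathsf{in}(\mathtt{os},(\mathtt{drt\_req},x,y,st));\mathsf{if}\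 \mathtt{lock}(st)=\mathtt{false}\ \mathsf{then}\ \mathsf{let}\ s_0'=\mathtt{set\_int}(st,\mathtt{cpu\_acc},\mathtt{false})\ \mathsf{in}\ \mathsf{let}\ s_0=\mathtt{set\_lock}(s_0',\mathtt{cpu\_acc},\mathtt{true})\ \mathsf{in}\ \mathsf{let}\ w=(\mathtt h(x),\mathtt h(\mathtt{stm}(st)))\ \mathsf{in}\ \nu n;\mathsf{out}(\mathtt{cpu\_tpm},(\mathtt{reset\_req},n,s_0));\mathsf{in}(\mathtt{cpu\_tpm},(\mathtt{reset\_resp},{=}n,s_1));\mathsf{out}(\mathtt{cpu\_tpm},(\mathtt{extend\_req},n,s_1,w));\mathsf{in}(\mathtt{cpu\_tpm},(\mathtt{extend\_resp},{=}n,s_2));\mathsf{let}\ s_3=\mathtt{set\_init}(s_2,\mathtt{cpu\_acc},x)\ \mathsf{in}\ \mathsf{let}\ e=\mathtt{get\_entry}(x)\ \mathsf{in}\ \mathsf{out}(e,(n,s_3,\mathtt{tpm\_ch}(x),y));\mathsf{out}(\mathtt{cpu\_tpm},(\mathtt{ext\_channel},\mathtt{tpm\_ch}(x)));\mathsf{in}(e,(\mathtt{drt\_resp},{=}n,s_4));\mathsf{let}\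 f=\mathtt{get\_entry}(\mathtt{pp}(s_4))\ \mathsf{in}\ \mathsf{out}(f,(s_4,\mathtt{tpm\_ch}(\mathtt{prog}(f))));\mathsf{out}(\mathtt{cpu\_tpm},(\mathtt{ext\_channel},\mathtt{tpm\_ch}(\mathtt{prog}(f))))$; $\mathtt{INIT}=\mathsf{out}(\mathtt{os},\mathtt{prog}(\mathtt{Tinit}));\mathsf{out}(\mathtt{os},\mathtt{prog}(\mathtt{Tstm}));\mathsf{in}(\mathtt{Tinit},(x,st,c,y));\mathsf{let}\ w=\mathtt h(y)\ \mathsf{in}\ \nu n_1;\mathsf{out}(c,(\mathtt{extend\_req},n_1,st,w));\mathsf{in}(c,(\mathtt{extend\_resp},{=}n_1,s));\mathsf{let}\ s'=\mathtt{set\_pp}(s,\mathtt{Tinit},y)\ \mathsf{in}\ \mathsf{out}(\mathtt{Tinit},(\mathtt{drt\_resp},x,s'));\mathsf{out}(\mathtt{os},s')$; $\mathtt{PP}=\mathsf{out}(\mathtt{os},\mathtt{prog}(\mathtt{Tpp}));\mathsf{in}(\mathtt{Tpp},(s_0,c));\mathsf{let}\ s=\mathtt{set\_int}(s_0,\mathtt{Tpp},\mathtt{true})\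 \mathsf{in}\ \mathsf{out}(\mathtt{os},s);\mathsf{in}(\mathtt{os},x);\mathsf{in}(\mathtt{os},y);\mathsf{out}(c,(\mathtt{tag\_unseal},x));\mathsf{in}(c,(\mathtt{tag\_plain},k));\mathsf{let}\ m=\mathtt{sdec}(y,k)\ \mathsf{in}\ \mathsf{out}(\mathtt{os},m);\nu r;\mathsf{out}(c,(\mathtt{extend\_req},r,s,\bot));\mathsf{in}(c,(\mathtt{extend\_resp},{=}r,s'));\mathsf{let}\ s''=\mathtt{set\_lock}(s',\mathtt{Tpp},\mathtt{false})\ \mathsf{in}\ \mathsf{out}(\mathtt{os},s'')$; $\mathtt{DATA}=\nu k;\nu m;\mathsf{out}(\mathtt{os},\mathtt{senc}(m,k));\mathsf{let}\ z=\mathtt{seal}(k,\mathtt{chain}(\mathtt{p_d},(\mathtt h(\mathtt{prog}(\mathtt{Tinit})),\mathtt h(\mathtt{prog}(\mathtt{Tstm}))),\mathtt h(\mathtt{prog}(\mathtt{Tpp}))))\ \mathsf{in}\ \mathsf{out}(\mathtt{os},z)$; $\mathtt{SETUP}=\mathsf{in}(\mathtt{os},x);\mathsf{in}(\mathtt{os},y);\mathsf{out}(\mathtt{os},\mathtt{state}(\mathtt{tpm}(\mathtt{p_s}),\mathtt{cpu}(\mathtt{true},\bot),\mathtt{smram}(x,y),\mathtt{drt}(\bot,\bot,\mathtt{false})));\mathsf{in}(\mathtt{os},u);\mathsf{in}(\mathtt{os},v);\mathsf{in}(\mathtt{os},st);\mathsf{out}(\mathtt{os},(\mathtt{drt\_req},u,v,st))$.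 $\mathtt{DRT}^b$ is obtained from $\mathtt{DRT}$ by replacing $\mathtt{PCR_{EXTEND}}$ with $\mathsf{in}(ch,(\mathtt{extend\_req},nonce,st,v));\mathsf{let}\ p=\mathtt{pcr}(st)\ \mathsf{in}\ \mathsf{if}\ \mathtt{is\_small}(p)=\mathtt{true}\ \mathsf{then}\ \mathsf{let}\ st'=\mathtt{extend}(st,\mathtt{tpm\_acc},v)\ \mathsf{in}\ \mathsf{out}(ch,(\mathtt{extend\_resp},nonce,st'))\ \mathsf{else}\ \mathtt{BIG}$, where $\mathtt{BIG}=\mathsf{out}(\mathtt{os},(p,v));\mathsf{in}(\mathtt{os},p');\mathsf{if}\ \mathtt{is\_big}(p')=\mathtt{true}\ \mathsf{then}\ \mathsf{let}\ st'=\mathtt{set\_pcr}(st,\mathtt{tpm\_acc},p')\ \mathsf{in}\ \mathsf{out}(ch,(\mathtt{extend\_resp},nonce,st'))$. **Statement.** A state term is a term with root symbol $\mathtt{state}$. Let $\mathcal M^b$ be the set of (terms equal modulo $\mathcal E^b_{\mathtt{drt}}$ to) state terms $st'$ that $\mathtt{BIG}$ returns to the attacker, i.e. on a channel $ch$ with $\mathcal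 M\vdash ch$, in some execution of $\mathtt{DRT}^b$ in parallel with an attacker. Let $b\ge 2$. Then $$\mathtt{Att}(\mathtt{DRT})\subseteq\mathtt{Att}(\mathtt{DRT}^b)\subseteq\mathtt{Att}(\mathtt{DRT})\cup\mathcal M^b\cup\mathcal M^f,$$ where every $T\in\mathcal M^b$ has as normal form a state term $T{\downarrow}$ with $\mathtt{length}(\mathtt{pcr}(T{\downarrow}){\downarrow})>b$, and $\mathcal M^f$ is a set of terms such that for each $T\in\mathcal M^f$ the normal form $T{\downarrow}$ contains a state term $T'$ with $\mathtt{length}(\mathtt{pcr}(T'){\downarrow})>b$. -/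

import Mathlib

namespace TrustedPlatform

/-! ### Terms -/

/-- Function symbols. `entry i` is an infinite family of private constants, the private entry points
of programs; `tup n` is the `n`-tuple constructor and `proj n i` the corresponding projection.
`getCache` reads the cache, `cache` writes it. -/
inductive Sym where
  -- cryptographic primitives and constants
  | ps | pd | tt | ff | bot | h | senc | sdec | sealD | unsealD
  -- programs
  | prog | entry (i : ℕ) | getEntry
  -- platform state
  | state | tpm | cpu | smram | drt
  -- read access
  | pcr | int | getCache | stm | smi | init | pp | lock
  -- write access
  | tpmAcc | cpuAcc | reset | extend | setPcr | setInt | cache | flushStm | flushSmi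
  | setInit | setPp | setLock
  -- tests used by the bounded module
  | isSmall | isBig
  -- channels
  | os | cpuTpm | tpmCh
  -- message tags
  | resetReq | resetResp | extendReq | extendResp | extChannel | unsealTag | plainTag
  | drtReq | drtResp
  -- sequences
  | tup (n : ℕ) | proj (n : ℕ) (i : Fin n)

namespace Sym

def arity : Sym → ℕ
  | h | prog | getEntry | tpm | pcr | int | getCache | stm | smi | init | pp | lock => 1
  | flushStm | flushSmi | isSmall | isBig | tpmCh => 1
  | senc | sdec | sealD | unsealD | cpu | smram | cache => 2
  | drt | reset | extend | setPcr | setInt | setInit | setPp | setLock => 3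
  | state => 4
  | tup n => n
  | proj _ _ => 1
  | _ => 0

/-- The private symbols; all others are public. -/
def IsPrivate : Sym → Prop
  | unsealD | entry _ | getEntry => True
  | state | tpm | cpu | smram | drt => True
  | tpmAcc | cpuAcc | setPcr | isSmall | isBig => True
  | cpuTpm | tpmCh => True
  | _ => False

/-- Destructors: the symbols at the root of the left-hand side of some rewrite rule. -/
def IsDestructor : Sym → Prop
  | sdec | unsealD | getEntry => True
  | pcr | int | getCache | stm | smi | init | pp | lock => True
  | reset | extend | setPcr | setInt | cache | flushStm | flushSmi => True
  | setInit | setPp | setLock => True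
  | isSmall | isBig => True
  | proj _ _ => True
  | _ => False

end Sym

/-- Identifiers: used for variables, and for the names restricted by `new`.
`aux n` are further identifiers, which occur in no process of the platform. -/
inductive Ident where
  | ch | rv | nonce | pfState | newSt | val | pcrVal | newPcr | blob | plain
  | init | pp | s0a | s0 | measure | s1 | s2 | s3 | einit | newState | epp
  | pfSt | tpmc | extSt | nonce1 | pfState0 | xBlob | xCipher | xk | mess | rand | exts | ends
  | kpp | hipp | sealedKey | xstm | xsmi
  | aux (n : ℕ)
  deriving DecidableEq

/-- A name: the `idx`-th copy of the identifier `base`. -/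
structure Name where
  base : Ident
  idx : ℕ

inductive Term where
  | var (x : Ident)
  | name (n : Name)
  | app (f : Sym) (args : Fin f.arity → Term)

namespace Term

def subst (σ : Ident → Term) : Term → Term
  | var x => σ x
  | name n => name n
  | app f args => app f fun i => (args i).subst σ

/-- `S.IsSubterm T`: the term `S` occurs in `T`. -/
inductive IsSubterm (S : Term) : Term → Prop
  | refl : IsSubterm S S
  | arg (f : Sym) (args : Fin f.arity → Term) (i : Fin f.arity) :
      IsSubterm S (args i) → IsSubterm S (app f args)

def syms : Term → Set Sym
  | var _ => ∅
  | name _ => ∅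
  | app f args => {f} ∪ ⋃ i, (args i).syms

def names : Term → Set Name
  | var _ => ∅
  | name n => {n}
  | app _ args => ⋃ i, (args i).names

def vars : Term → Set Ident
  | var x => {x}
  | name _ => ∅
  | app _ args => ⋃ i, (args i).vars

def DestructorFree (T : Term) : Prop := ∀ f ∈ T.syms, ¬ f.IsDestructor

/-- State terms: terms with root symbol `state`. -/
def IsState (T : Term) : Prop := ∃ args, T = app .state args

end Term

/-! ### Notation for terms -/

abbrev ps : Term := .app .ps ![]
abbrev pd : Term := .app .pd ![]
abbrev tt : Term := .app .tt ![]
abbrev ff : Term := .app .ff ![]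
abbrev bot : Term := .app .bot ![]
abbrev h (x : Term) : Term := .app .h ![x]
abbrev senc (x k : Term) : Term := .app .senc ![x, k]
abbrev sdec (x k : Term) : Term := .app .sdec ![x, k]
abbrev sealD (x p : Term) : Term := .app .sealD ![x, p]
abbrev unsealD (x p : Term) : Term := .app .unsealD ![x, p]
abbrev prog (x : Term) : Term := .app .prog ![x]
abbrev getEntry (x : Term) : Term := .app .getEntry ![x]
abbrev state (t c m d : Term) : Term := .app .state ![t, c, m, d]
abbrev tpm (p : Term) : Term := .app .tpm ![p]
abbrev cpu (i c : Term) : Term := .app .cpu ![i, c]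
abbrev smram (s i : Term) : Term := .app .smram ![s, i]
abbrev drt (i p l : Term) : Term := .app .drt ![i, p, l]
abbrev pcr (s : Term) : Term := .app .pcr ![s]
abbrev int (s : Term) : Term := .app .int ![s]
abbrev getCache (s : Term) : Term := .app .getCache ![s]
abbrev stm (s : Term) : Term := .app .stm ![s]
abbrev smi (s : Term) : Term := .app .smi ![s]
abbrev init (s : Term) : Term := .app .init ![s]
abbrev pp (s : Term) : Term := .app .pp ![s]
abbrev lock (s : Term) : Term := .app .lock ![s]
abbrev tpmAcc : Term := .app .tpmAcc ![]
abbrev cpuAcc : Term := .app .cpuAcc ![]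
abbrev reset (s a v : Term) : Term := .app .reset ![s, a, v]
abbrev extend (s a v : Term) : Term := .app .extend ![s, a, v]
abbrev setPcr (s a v : Term) : Term := .app .setPcr ![s, a, v]
abbrev setInt (s a v : Term) : Term := .app .setInt ![s, a, v]
abbrev cache (s v : Term) : Term := .app .cache ![s, v]
abbrev flushStm (s : Term) : Term := .app .flushStm ![s]
abbrev flushSmi (s : Term) : Term := .app .flushSmi ![s]
abbrev setInit (s a v : Term) : Term := .app .setInit ![s, a, v]
abbrev setPp (s a v : Term) : Term := .app .setPp ![s, a, v]
abbrev setLock (s a v : Term) : Term := .app .setLock ![s, a, v]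
abbrev isSmall (p : Term) : Term := .app .isSmall ![p]
abbrev isBig (p : Term) : Term := .app .isBig ![p]
abbrev os : Term := .app .os ![]
abbrev cpuTpm : Term := .app .cpuTpm ![]
abbrev tpmCh (x : Term) : Term := .app .tpmCh ![x]
abbrev resetReq : Term := .app .resetReq ![]
abbrev resetResp : Term := .app .resetResp ![]
abbrev extendReq : Term := .app .extendReq ![]
abbrev extendResp : Term := .app .extendResp ![]
abbrev extChannel : Term := .app .extChannel ![]
abbrev unsealTag : Term := .app .unsealTag ![]
abbrev plainTag : Term := .app .plainTag ![]
abbrev drtReq : Term := .app .drtReq ![]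
abbrev drtResp : Term := .app .drtResp ![]
/-- The sequence `(T₁, …, Tₙ)`. -/
abbrev tup {n : ℕ} (args : Fin n → Term) : Term := .app (.tup n) args
abbrev proj {n : ℕ} (i : Fin n) (x : Term) : Term := .app (.proj n i) ![x]

/-- Private entry points of the trusted `INIT`, `STM` and `PP` programs. -/
abbrev Tinit : Term := .app (.entry 0) ![]
abbrev Tstm : Term := .app (.entry 1) ![]
abbrev Tpp : Term := .app (.entry 2) ![]

/-- `chain T₀ [T₁, …, Tₙ] = h((… h((T₀, T₁)) …, Tₙ))`. -/
def chain (T₀ : Term) (l : List Term) : Term := l.foldl (fun p v => h (tup ![p, v])) T₀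

/-- The number of extensions of a register value: the greatest `n` such that
`T = chain(T₀, …, Tₙ)` for some `T₀, …, Tₙ`. -/
noncomputable def length (T : Term) : ℕ :=
  sSup {n | ∃ (T₀ : Term) (l : List Term), l.length = n ∧ T = chain T₀ l}

/-! ### The equational theory -/

/-- All instances of the rewrite rules, for the bound `b`. -/
inductive Rule (b : ℕ) : Term → Term → Prop
  | sdec (x k : Term) : Rule b (sdec (senc x k) k) x
  | unsealD (x p : Term) : Rule b (unsealD (sealD x p) p) x
  | proj {n : ℕ} (args : Fin n → Term) (i : Fin n) : Rule b (proj i (tup args)) (args i)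
  | getEntry (x : Term) : Rule b (getEntry (prog x)) x
  -- read access
  | pcr (y x₁ x₂ x₃ : Term) : Rule b (pcr (state (tpm y) x₁ x₂ x₃)) y
  | int (x₁ y₁ y₂ x₂ x₃ : Term) : Rule b (int (state x₁ (cpu y₁ y₂) x₂ x₃)) y₁
  | getCache (x₁ y₁ y₂ x₂ x₃ : Term) : Rule b (getCache (state x₁ (cpu y₁ y₂) x₂ x₃)) y₂
  | stm (x₁ x₂ y₁ y₂ x₃ : Term) : Rule b (stm (state x₁ x₂ (smram y₁ y₂) x₃)) y₁
  | smi (x₁ x₂ y₁ y₂ x₃ : Term) : Rule b (smi (state x₁ x₂ (smram y₁ y₂) x₃)) y₂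
  | init (x₁ x₂ x₃ y₁ y₂ y₃ : Term) : Rule b (init (state x₁ x₂ x₃ (drt y₁ y₂ y₃))) y₁
  | pp (x₁ x₂ x₃ y₁ y₂ y₃ : Term) : Rule b (pp (state x₁ x₂ x₃ (drt y₁ y₂ y₃))) y₂
  | lock (x₁ x₂ x₃ y₁ y₂ y₃ : Term) : Rule b (lock (state x₁ x₂ x₃ (drt y₁ y₂ y₃))) y₃
  -- write access: the register
  | resetPs (y x₁ x₂ x₃ : Term) :
      Rule b (reset (state (tpm y) x₁ x₂ x₃) tpmAcc ps) (state (tpm ps) x₁ x₂ x₃)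
  | resetPd (y x₁ x₂ x₃ : Term) :
      Rule b (reset (state (tpm y) x₁ x₂ x₃) tpmAcc pd) (state (tpm pd) x₁ x₂ x₃)
  | extend (y x₁ x₂ x₃ v : Term) :
      Rule b (extend (state (tpm y) x₁ x₂ x₃) tpmAcc v) (state (tpm (h (tup ![y, v]))) x₁ x₂ x₃)
  | setPcr (y x₁ x₂ x₃ v : Term) :
      Rule b (setPcr (state (tpm y) x₁ x₂ x₃) tpmAcc v) (state (tpm v) x₁ x₂ x₃)
  -- write access: interrupts
  | setIntCpu (x₁ y₁ y₂ x₂ x₃ v : Term) :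
      Rule b (setInt (state x₁ (cpu y₁ y₂) x₂ x₃) cpuAcc v) (state x₁ (cpu v y₂) x₂ x₃)
  | setIntPp (x₁ y z x₂ z₁ z₂ v : Term) :
      Rule b (setInt (state x₁ (cpu y z) x₂ (drt z₁ (prog z₂) tt)) z₂ v)
        (state x₁ (cpu v z) x₂ (drt z₁ (prog z₂) tt))
  -- write access: the cache, and what is copied from it
  | cache (x₁ y₁ y₂ x₂ x₃ v : Term) :
      Rule b (cache (state x₁ (cpu y₁ y₂) x₂ x₃) v) (state x₁ (cpu y₁ v) x₂ x₃)
  | flushStm (x₁ y₁ v z₁ z₂ w₁ w₂ : Term) :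
      Rule b (flushStm (state x₁ (cpu y₁ v) (smram z₁ z₂) (drt w₁ w₂ ff)))
        (state x₁ (cpu y₁ v) (smram v z₂) (drt w₁ w₂ ff))
  | flushSmi (x₁ y₁ v z₁ z₂ x₂ : Term) :
      Rule b (flushSmi (state x₁ (cpu y₁ v) (smram z₁ z₂) x₂))
        (state x₁ (cpu y₁ v) (smram z₁ v) x₂)
  -- write access: the loaded programs
  | setInit (x₁ x₂ x₃ y₁ y₂ y₃ v : Term) :
      Rule b (setInit (state x₁ x₂ x₃ (drt y₁ y₂ y₃)) cpuAcc v) (state x₁ x₂ x₃ (drt v y₂ y₃))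
  | setPpCpu (x₁ x₂ x₃ y₁ y₂ y₃ v : Term) :
      Rule b (setPp (state x₁ x₂ x₃ (drt y₁ y₂ y₃)) cpuAcc v) (state x₁ x₂ x₃ (drt y₁ v y₃))
  | setPpInit (x₁ x₂ x₃ y₁ y₂ y₃ v : Term) :
      Rule b (setPp (state x₁ x₂ x₃ (drt (prog y₁) y₂ y₃)) y₁ v)
        (state x₁ x₂ x₃ (drt (prog y₁) v y₃))
  | setPpSmi (x z z₁ z₂ y₁ y₂ y₃ v : Term) :
      Rule b
        (setPp (state x (cpu tt z) (smram (prog z₁) (prog z₂)) (drt y₁ y₂ y₃)) (tup ![z₁, z₂]) v)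
        (state x (cpu tt z) (smram (prog z₁) (prog z₂)) (drt y₁ v y₃))
  -- write access: the lock
  | setLockCpu (x₁ x₂ x₃ y₁ y₂ y₃ v : Term) :
      Rule b (setLock (state x₁ x₂ x₃ (drt y₁ y₂ y₃)) cpuAcc v) (state x₁ x₂ x₃ (drt y₁ y₂ v))
  | setLockPp (x₁ x₂ x₃ y₁ y₂ y₃ v : Term) :
      Rule b (setLock (state x₁ x₂ x₃ (drt y₁ (prog y₂) y₃)) y₂ v)
        (state x₁ x₂ x₃ (drt y₁ (prog y₂) v))
  | setLockSmi (x z z₁ z₂ y₁ y₂ y₃ v : Term) :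
      Rule b
        (setLock (state x (cpu tt z) (smram (prog z₁) (prog z₂)) (drt y₁ y₂ y₃)) (tup ![z₁, z₂]) v)
        (state x (cpu tt z) (smram (prog z₁) (prog z₂)) (drt y₁ y₂ v))
  -- tests of the bounded module
  | isSmall (v₀ : Term) (l : List Term) :
      v₀ = ps ∨ v₀ = pd → l.length < b → Rule b (isSmall (chain v₀ l)) tt
  | isBig (v₀ : Term) (l : List Term) :
      l.length = b + 1 → Rule b (isBig (chain v₀ l)) tt

/-- One rewrite step, in any context. -/
inductive Rewrites (b : ℕ) : Term → Term → Prop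
  | root {U V : Term} : Rule b U V → Rewrites b U V
  | arg (f : Sym) (args : Fin f.arity → Term) (i : Fin f.arity) {V : Term} :
      Rewrites b (args i) V → Rewrites b (.app f args) (.app f (Function.update args i V))

def Irreducible (b : ℕ) (T : Term) : Prop := ∀ V, ¬ Rewrites b T V

/-- `V` is a normal form of `T`. -/
def NormalForm (b : ℕ) (T V : Term) : Prop :=
  Relation.ReflTransGen (Rewrites b) T V ∧ Irreducible b V

/-- Equality modulo the theory: a common normal form. -/
def EqE (b : ℕ) (U V : Term) : Prop := ∃ W, NormalForm b U W ∧ NormalForm b V W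

/-- Deducibility of a term from a set of terms, with public function symbols. -/
inductive Deduce (b : ℕ) (S : Set Term) : Term → Prop
  | known {T' T : Term} : T' ∈ S → EqE b T' T → Deduce b S T
  | apply (f : Sym) (args : Fin f.arity → Term) {T : Term} : ¬ f.IsPrivate →
      (∀ i, Deduce b S (args i)) → EqE b (.app f args) T → Deduce b S T

/-! ### Processes -/

/-- Input patterns: a variable to be bound, a term to be matched (the variables of which refer to
the enclosing scope), or a sequence of patterns. -/
inductive Pat where
  | var (x : Ident)
  | eq (T : Term)
  | tup (n : ℕ) (ps : Fin n → Pat)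

namespace Pat

/-- The variables bound by a pattern. -/
def binders : Pat → Finset Ident
  | var x => {x}
  | eq _ => ∅
  | tup _ ps => Finset.univ.biUnion fun i => (ps i).binders

/-- The term obtained by instantiating the variables bound by the pattern. -/
def inst (σ : Ident → Term) : Pat → Term
  | var x => σ x
  | eq T => T
  | tup n ps => .app (.tup n) fun i => (ps i).inst σ

/-- Substitution for the variables that the pattern does not bind. -/
def subst (σ : Ident → Term) : Pat → Pat
  | var x => var x
  | eq T => eq (T.subst σ)
  | tup n ps => tup n fun i => (ps i).subst σ

/-- The terms to be matched that occur in the pattern. -/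
def terms : Pat → Set Term
  | var _ => ∅
  | eq T => {T}
  | tup _ ps => ⋃ i, (ps i).terms

end Pat

/-- Processes. In `new n P`, the restricted name is written `var n` in `P`; running the restriction
replaces it by a fresh copy of `n`. -/
inductive Proc where
  | nil
  | par (P Q : Proc)
  | repl (P : Proc)
  | new (n : Ident) (P : Proc)
  | inp (U : Term) (A : Pat) (P : Proc)
  | out (U T : Term) (P : Proc)
  | ite (U V : Term) (P Q : Proc)
  | letIn (x : Ident) (T : Term) (P : Proc)

namespace Proc

/-- Substitution (of terms without variables) for the free variables of a process. -/
def subst (σ : Ident → Term) : Proc → Proc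
  | nil => nil
  | par P Q => par (P.subst σ) (Q.subst σ)
  | repl P => repl (P.subst σ)
  | new n P => new n (P.subst (Function.update σ n (.var n)))
  | inp U A P =>
      inp (U.subst σ) (A.subst σ) (P.subst fun x => if x ∈ A.binders then .var x else σ x)
  | out U T P => out (U.subst σ) (T.subst σ) (P.subst σ)
  | ite U V P Q => ite (U.subst σ) (V.subst σ) (P.subst σ) (Q.subst σ)
  | letIn x T P => letIn x (T.subst σ) (P.subst (Function.update σ x (.var x)))

/-- The terms written in a process. -/
def terms : Proc → Set Term
  | nil => ∅
  | par P Q => P.terms ∪ Q.terms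
  | repl P => P.terms
  | new _ P => P.terms
  | inp U A P => {U} ∪ A.terms ∪ P.terms
  | out U T P => {U, T} ∪ P.terms
  | ite U V P Q => {U, V} ∪ P.terms ∪ Q.terms
  | letIn _ T P => {T} ∪ P.terms

/-- The function symbols of a process (tuple patterns, which use public symbols only, are left
out). -/
def syms (P : Proc) : Set Sym := ⋃ T ∈ P.terms, T.syms

/-- The names occurring in a process; restricted names are not among them. -/
def names (P : Proc) : Set Name := ⋃ T ∈ P.terms, T.names

/-- The restricted (bound) names of a process. -/
def restricted : Proc → Set Ident
  | nil => ∅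
  | par P Q => P.restricted ∪ Q.restricted
  | repl P => P.restricted
  | new n P => {n} ∪ P.restricted
  | inp _ _ P => P.restricted
  | out _ _ P => P.restricted
  | ite _ _ P Q => P.restricted ∪ Q.restricted
  | letIn _ _ P => P.restricted

/-- The free variables of a process. -/
def freeVars : Proc → Set Ident
  | nil => ∅
  | par P Q => P.freeVars ∪ Q.freeVars
  | repl P => P.freeVars
  | new n P => P.freeVars \ {n}
  | inp U A P => U.vars ∪ (⋃ T ∈ A.terms, T.vars) ∪ (P.freeVars \ A.binders)
  | out U T P => U.vars ∪ T.vars ∪ P.freeVars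
  | ite U V P Q => U.vars ∪ V.vars ∪ P.freeVars ∪ Q.freeVars
  | letIn x T P => T.vars ∪ (P.freeVars \ {x})

end Proc

/-! ### Operational semantics -/

/-- A configuration: the names in use, the terms made available to the attacker, and the processes
running in parallel. -/
structure Config where
  names : Set Name
  known : Set Term
  procs : Multiset Proc

/-- The execution steps. -/
inductive Step (b : ℕ) : Config → Config → Prop
  | nil (N : Set Name) (M : Set Term) (R : Multiset Proc) :
      Step b ⟨N, M, .nil ::ₘ R⟩ ⟨N, M, R⟩
  | bang (N : Set Name) (M : Set Term) (R : Multiset Proc) (P : Proc) :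
      Step b ⟨N, M, .repl P ::ₘ R⟩ ⟨N, M, P ::ₘ .repl P ::ₘ R⟩
  | par (N : Set Name) (M : Set Term) (R : Multiset Proc) (P Q : Proc) :
      Step b ⟨N, M, .par P Q ::ₘ R⟩ ⟨N, M, P ::ₘ Q ::ₘ R⟩
  | new (N : Set Name) (M : Set Term) (R : Multiset Proc) (n : Ident) (P : Proc) (i : ℕ) :
      ⟨n, i⟩ ∉ N →
      Step b ⟨N, M, .new n P ::ₘ R⟩
        ⟨insert ⟨n, i⟩ N, M, P.subst (Function.update Term.var n (.name ⟨n, i⟩)) ::ₘ R⟩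
  /- Communication on a channel `U` equal modulo the theory to `U'`; the message matches the
  pattern modulo the theory, and the bound variables are instantiated by terms in normal form. The
  message is added to the known terms exactly when the channel is deducible. -/
  | comm (N : Set Name) (M M' : Set Term) (R : Multiset Proc) (U T U' : Term) (A : Pat) (P Q : Proc)
      (σ : Ident → Term) :
      EqE b U U' → EqE b T (A.inst σ) → (∀ x ∈ A.binders, Irreducible b (σ x)) →
      (Deduce b M U → M' = insert T M) → (¬ Deduce b M U → M' = M) →
      Step b ⟨N, M, .out U T P ::ₘ .inp U' A Q ::ₘ R⟩
        ⟨N, M', P ::ₘ Q.subst (fun x => if x ∈ A.binders then σ x else .var x) ::ₘ R⟩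
  | iteTrue (N : Set Name) (M : Set Term) (R : Multiset Proc) (U V : Term) (P Q : Proc) :
      EqE b U V → Step b ⟨N, M, .ite U V P Q ::ₘ R⟩ ⟨N, M, P ::ₘ R⟩
  | iteFalse (N : Set Name) (M : Set Term) (R : Multiset Proc) (U V : Term) (P Q : Proc) :
      ¬ EqE b U V → Step b ⟨N, M, .ite U V P Q ::ₘ R⟩ ⟨N, M, Q ::ₘ R⟩
  | letIn (N : Set Name) (M : Set Term) (R : Multiset Proc) (x : Ident) (T V : Term) (P : Proc) :
      NormalForm b T V → V.DestructorFree →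
      Step b ⟨N, M, .letIn x T P ::ₘ R⟩ ⟨N, M, P.subst (Function.update Term.var x V) ::ₘ R⟩

/-- `Q` is an attacker against `P`: a closed process over public symbols, the names of which (free
or restricted) are different from the names restricted in `P`. -/
structure IsAttacker (P Q : Proc) : Prop where
  closed : Q.freeVars = ∅
  publicSig : ∀ f ∈ Q.syms, ¬ f.IsPrivate
  names_fresh : ∀ n ∈ Q.names, n.base ∉ P.restricted
  restricted_fresh : ∀ n ∈ Q.restricted, n ∉ P.restricted

/-- The initial configuration of `P | Q`. -/
def initConfig (P Q : Proc) : Config := ⟨(Proc.par P Q).names, ∅, {.par P Q}⟩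

/-- The configurations that `P | Q` can reach. -/
def Reaches (b : ℕ) (P Q : Proc) (c : Config) : Prop :=
  Relation.ReflTransGen (Step b) (initConfig P Q) c

/-- The terms that can be obtained by an attacker interacting with `P`. -/
def Att (b : ℕ) (P : Proc) : Set Term :=
  {T | ∃ Q, IsAttacker P Q ∧ ∃ c, Reaches b P Q c ∧ Deduce b c.known T}

/-! ### The processes of the platform -/

section Platform

open Proc

/-- A variable as a term. -/
abbrev vr (x : Ident) : Term := .var x

/-- Input of a pattern that is a sequence. -/
abbrev inTup {n : ℕ} (U : Term) (A : Fin n → Pat) (P : Proc) : Proc := .inp U (.tup n A) P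

/-- Input of an arbitrary message. -/
abbrev inVar (U : Term) (x : Ident) (P : Proc) : Proc := .inp U (.var x) P

def pcrReset : Proc :=
  inTup (vr .ch) ![.eq resetReq, .var .nonce, .var .pfState] <|
  letIn .newSt (reset (vr .pfState) tpmAcc (vr .rv)) <|
  out (vr .ch) (tup ![resetResp, vr .nonce, vr .newSt]) nil

def tpmReset : Proc :=
  par
    (letIn .ch cpuTpm <| letIn .rv pd <| repl pcrReset)
    (letIn .ch os <| letIn .rv ps <| repl pcrReset)

def pcrExtend : Proc :=
  inTup (vr .ch) ![.eq extendReq, .var .nonce, .var .pfState, .var .val] <|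
  letIn .newSt (extend (vr .pfState) tpmAcc (vr .val)) <|
  out (vr .ch) (tup ![extendResp, vr .nonce, vr .newSt]) nil

/-- The extend functionality, around a given process for a single extension. -/
def tpmExtend (ext : Proc) : Proc :=
  par (letIn .ch cpuTpm <| repl ext) <|
  par (letIn .ch os <| repl ext) <|
  repl (inTup cpuTpm ![.eq extChannel, .var .ch] <| repl ext)

def unsealProc : Proc :=
  inTup (vr .ch) ![.eq unsealTag, .var .blob] <|
  letIn .plain (unsealD (vr .blob) (pcr (vr .pfState))) <|
  out (vr .ch) (tup ![plainTag, vr .plain]) nil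

def tpmUnseal : Proc :=
  inVar os .pfState <|
  ite (lock (vr .pfState)) tt
    (letIn .ch (tpmCh (pp (vr .pfState))) unsealProc)
    (letIn .ch os unsealProc)

/-- The trusted platform module, with a given process for a single extension. -/
def TPM (ext : Proc) : Proc := par (repl tpmReset) <| par (repl (tpmExtend ext)) (repl tpmUnseal)

def CPU : Proc := repl <|
  -- receive a request
  inTup os ![.eq drtReq, .var .init, .var .pp, .var .pfState] <|
  ite (lock (vr .pfState)) ff (
    letIn .s0a (setInt (vr .pfState) cpuAcc ff) <|
    letIn .s0 (setLock (vr .s0a) cpuAcc tt) <|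
    -- measure the programs
    letIn .measure (tup ![h (vr .init), h (stm (vr .pfState))]) <|
    -- reset and extend the register
    new .nonce <|
    out cpuTpm (tup ![resetReq, vr .nonce, vr .s0]) <|
    inTup cpuTpm ![.eq resetResp, .eq (vr .nonce), .var .s1] <|
    out cpuTpm (tup ![extendReq, vr .nonce, vr .s1, vr .measure]) <|
    inTup cpuTpm ![.eq extendResp, .eq (vr .nonce), .var .s2] <|
    -- load the INIT program and grant it access to the module
    letIn .s3 (setInit (vr .s2) cpuAcc (vr .init)) <|
    letIn .einit (getEntry (vr .init)) <|
    out (vr .einit) (tup ![vr .nonce, vr .s3, tpmCh (vr .init), vr .pp]) <|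
    out cpuTpm (tup ![extChannel, tpmCh (vr .init)]) <|
    -- establish access to the module for the protected program
    inTup (vr .einit) ![.eq drtResp, .eq (vr .nonce), .var .newState] <|
    letIn .epp (getEntry (pp (vr .newState))) <|
    out (vr .epp) (tup ![vr .newState, tpmCh (prog (vr .epp))]) <|
    out cpuTpm (tup ![extChannel, tpmCh (prog (vr .epp))]) nil)
  nil

def INIT : Proc :=
  out os (prog Tinit) <| out os (prog Tstm) <|
  inTup Tinit ![.var .nonce, .var .pfSt, .var .tpmc, .var .pp] <|
  letIn .measure (h (vr .pp)) <|
  new .nonce1 <|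
  out (vr .tpmc) (tup ![extendReq, vr .nonce1, vr .pfSt, vr .measure]) <|
  inTup (vr .tpmc) ![.eq extendResp, .eq (vr .nonce1), .var .extSt] <|
  letIn .newSt (setPp (vr .extSt) Tinit (vr .pp)) <|
  out Tinit (tup ![drtResp, vr .nonce, vr .newSt]) <|
  out os (vr .newSt) nil

def PP : Proc :=
  out os (prog Tpp) <|
  inTup Tpp ![.var .pfState0, .var .tpmc] <|
  letIn .pfSt (setInt (vr .pfState0) Tpp tt) <|
  out os (vr .pfSt) <|
  inVar os .xBlob <| inVar os .xCipher <|
  out (vr .tpmc) (tup ![unsealTag, vr .xBlob]) <|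
  inTup (vr .tpmc) ![.eq plainTag, .var .xk] <|
  letIn .mess (sdec (vr .xCipher) (vr .xk)) <|
  out os (vr .mess) <|
  new .rand <|
  out (vr .tpmc) (tup ![extendReq, vr .rand, vr .pfSt, bot]) <|
  inTup (vr .tpmc) ![.eq extendResp, .eq (vr .rand), .var .exts] <|
  letIn .ends (setLock (vr .exts) Tpp ff) <|
  out os (vr .ends) nil

/-- The register value recording the trusted programs. -/
def hchain : Term :=
  h (tup ![h (tup ![pd, tup ![h (prog Tinit), h (prog Tstm)]]), h (prog Tpp)])

def DATA : Proc :=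
  new .kpp <| new .hipp <|
  out os (senc (vr .hipp) (vr .kpp)) <|
  letIn .sealedKey (sealD (vr .kpp) hchain) <|
  out os (vr .sealedKey) nil

def SETUP : Proc :=
  inVar os .xstm <| inVar os .xsmi <|
  out os (state (tpm ps) (cpu tt bot) (smram (vr .xstm) (vr .xsmi)) (drt bot bot ff)) <|
  inVar os .init <| inVar os .pp <| inVar os .pfState <|
  out os (tup ![drtReq, vr .init, vr .pp, vr .pfState]) nil

def EXEC : Proc := par CPU <| par (repl INIT) <| par SETUP <| par DATA (repl PP)

def DRT : Proc := par (TPM pcrExtend) EXEC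

def pcrExtendSmall : Proc :=
  letIn .newSt (extend (vr .pfState) tpmAcc (vr .val)) <|
  out (vr .ch) (tup ![extendResp, vr .nonce, vr .newSt]) nil

/-- The last part of `pcrExtendBig`: computing and returning the new state. -/
def bigReply : Proc :=
  letIn .newSt (setPcr (vr .pfState) tpmAcc (vr .newPcr)) <|
  out (vr .ch) (tup ![extendResp, vr .nonce, vr .newSt]) nil

def pcrExtendBig : Proc :=
  out os (tup ![vr .pcrVal, vr .val]) <|
  inVar os .newPcr <|
  ite (isBig (vr .newPcr)) tt bigReply nil

def pcrExtendBounded : Proc :=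
  inTup (vr .ch) ![.eq extendReq, .var .nonce, .var .pfState, .var .val] <|
  letIn .pcrVal (pcr (vr .pfState)) <|
  ite (isSmall (vr .pcrVal)) tt pcrExtendSmall pcrExtendBig

/-- The platform with bounded extension. The bound enters only through the rewrite rules of
`isSmall` and `isBig`. -/
def DRTb : Proc := par (TPM pcrExtendBounded) EXEC

end Platform

/-! ### States with a big register value -/

/-- A state term the register value of which has length greater than `b`. -/
def IsBigState (b : ℕ) (S : Term) : Prop :=
  S.IsState ∧ ∃ p, NormalForm b (pcr S) p ∧ b < length p

/-- The state terms, modulo the theory, that `pcrExtendBig` returns to the attacker, i.e. on a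
channel that the attacker can deduce, in some execution of the bounded platform. -/
def Mb (b : ℕ) : Set Term :=
  {T | ∃ Q, IsAttacker DRTb Q ∧ ∃ (N : Set Name) (M : Set Term) (R : Multiset Proc)
    (ρ : Ident → Term) (S : Term),
    Reaches b DRTb Q ⟨N, M, bigReply.subst ρ ::ₘ R⟩ ∧
    NormalForm b (setPcr (ρ .pfState) tpmAcc (ρ .newPcr)) S ∧ S.DestructorFree ∧
    Deduce b M (ρ .ch) ∧ EqE b T S}

/-- The normal form of `T` contains a state term with a register value of length greater
than `b`. -/
def ContainsBigState (b : ℕ) (T : Term) : Prop :=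
  ∃ V, NormalForm b T V ∧ ∃ S, S.IsSubterm V ∧ IsBigState b S

end TrustedPlatform

-- Both inclusions are instances of one comparison of two platforms that differ only in the process
-- extending a register, `mem_att_of_trans_eq`. Its core is the translation `trans`, which
-- overwrites by `ps`, in every state occurring in a term, each register value satisfying a
-- predicate `Big`. A term obtained from one platform can be obtained from the other as soon as the
-- translation fixes its normal form. For `DRT` into `DRTb` nothing is big and `trans` is the
-- identity on normal forms. For `DRTb` into `DRT` the big values are those with at least `b + 1`
-- extensions; a term whose normal form contains no state with such a register is fixed, and all
-- other terms are put into the set called `Mf` in the main theorem.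
--
-- The translation is harmless because anybody who holds a state can have its register reset to `ps`
-- on the channel `os`: a state with a big register is imitated by the same state with register
-- `ps`. Extending a big value gives a big value, so big registers never become useful again without
-- a reset. The one register value that unlocks the sealed key is `hchain`; it has two extensions
-- and is not big, since `b ≥ 2`. The same bound makes `pd` and `h((pd, w))`, the values that the
-- CPU and the trusted `INIT` program extend on hidden channels, small, so the bounded module never
-- publishes what is sent there. Conversely the bounded module imitates an honest extension of a
-- long register: the attacker answers the published pair by its hash.
--
-- The two halves of the comparison meet in `Obtainable`, a list of closure properties of a set `K`
-- of terms. The upper bound is a semantic type system: `Known` describes what the attacker of the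
-- first platform may know, its clause for states asking that the translated state lie in `K`;
-- `Secret` describes the messages on hidden channels; `ok_platform` and `ok_of_public` type the
-- platform and the attacker, and `Typing.OkConfig.step` is subject reduction. The lower bound takes
-- for `K` the terms that an environment can extract from the second platform at any time
-- (`Yields`); `obtainable_yields` proves the closure properties, and `Can.exists_strategy` turns
-- such a run into an attacker process. Fresh names are matched by index: the key and the message
-- are generated at most once, and the finitely many nonces of the given execution are collected by
-- the environment in advance.
--
-- That states in `Mb` are big comes from the same typing, which demands a long value from every
-- `setPcr` that is evaluated.

attribute [reducible] TrustedPlatform.Sym.arity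

namespace TrustedPlatform

set_option linter.unusedSimpArgs false

/-! ### Finite argument vectors -/

/-- With `comp_vecEmpty`, this moves a map on all arguments of a symbol into an explicit vector;
`nf`, `subst` and `trans` are computed on concrete terms in this way. -/
theorem comp_vecCons {α β : Type} {n : ℕ} (φ : α → β) (a : α) (v : Fin n → α) :
    (fun i : Fin n.succ => φ (Matrix.vecCons a v i)) =
      Matrix.vecCons (φ a) (fun i => φ (v i)) := by
  funext i
  refine Fin.cases ?_ (fun j => ?_) i <;> rfl

theorem comp_vecEmpty {α β : Type} (φ : α → β) (v : Fin 0 → α) :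
    (fun i : Fin 0 => φ (v i)) = ![] := by
  funext i
  exact i.elim0

theorem forall_vecCons {α : Type} {n : ℕ} (p : α → Prop) (a : α) (v : Fin n → α) :
    (∀ i : Fin n.succ, p (Matrix.vecCons a v i)) ↔ p a ∧ ∀ i, p (v i) :=
  Fin.forall_fin_succ

/-! ### Chains -/

theorem chain_cons (T₀ v : Term) (l : List Term) :
    chain T₀ (v :: l) = chain (h (tup ![T₀, v])) l := rfl

theorem chain_append_singleton (T₀ v : Term) (l : List Term) :
    chain T₀ (l ++ [v]) = h (tup ![chain T₀ l, v]) := by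
  simp [chain]

/-- Used for `nf` and for `trans`, which both commute with hashing a pair. -/
theorem map_chain {φ : Term → Term} (hφ : ∀ x y, φ (h (tup ![x, y])) = h (tup ![φ x, φ y]))
    (T₀ : Term) (l : List Term) : φ (chain T₀ l) = chain (φ T₀) (l.map φ) := by
  induction l generalizing T₀ with
  | nil => rfl
  | cons v l ih => rw [chain_cons, ih, hφ, List.map_cons, chain_cons]

/-! ### Rewriting -/

theorem Rule.isDestructor {b : ℕ} {U V : Term} (hr : Rule b U V) :
    ∃ f args, U = .app f args ∧ f.IsDestructor := by
  cases hr <;> exact ⟨_, _, rfl, trivial⟩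

/-- Rules overlap only where one writer accepts several keys, and then their right-hand sides agree.
-/
theorem Rule.det {b : ℕ} {U V : Term} (hr : Rule b U V) :
    ∀ {U' V' : Term}, Rule b U' V' → U = U' → V = V' := by
  intro U' V' hr' e
  cases hr <;> cases hr' <;>
    first
    | rfl
    | (injection e with e₁ e₂; exact Sym.noConfusion e₁)
    | (simp [Term.app.injEq] at e; done)
    | (simp [Term.app.injEq] at e; simp [e]; done)
    | (simp [Term.app.injEq] at e ⊢; grind)
    | skip
  -- Only projections are left: the types of the index and of the arguments depend on the size of
  -- the tuple, which has to be identified first.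
  rename_i n args i n' args' i'
  injection e with e₁ e₂
  injection e₁ with e₁ e₃
  subst e₁
  simp [Term.app.injEq] at e₂ e₃
  rw [e₂, e₃]

theorem irreducible_app {b : ℕ} {f : Sym} {args : Fin f.arity → Term} :
    Irreducible b (.app f args) ↔
      (∀ i, Irreducible b (args i)) ∧ (f.IsDestructor → ∀ V, ¬ Rule b (.app f args) V) := by
  constructor
  · intro hi
    exact ⟨fun i V hV => hi _ (.arg f args i hV), fun _ V hV => hi _ (.root hV)⟩
  · rintro ⟨h₁, h₂⟩ V hV
    generalize hU : Term.app f args = U at hV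
    cases hV with
    | root hr =>
      subst hU
      obtain ⟨g, args', e, hg⟩ := hr.isDestructor
      injection e with e₁
      exact h₂ (e₁ ▸ hg) _ hr
    | arg g args' i hr =>
      injection hU with e₁ e₂
      subst e₁
      cases e₂
      exact h₁ i _ hr

theorem irreducible_name {b : ℕ} (n : Name) : Irreducible b (.name n) := by
  intro V hV
  generalize hU : Term.name n = U at hV
  cases hV with
  | root hr => obtain ⟨_, _, e, _⟩ := hr.isDestructor; simp [← hU] at e
  | arg => cases hU

theorem irreducible_var {b : ℕ} (x : Ident) : Irreducible b (.var x) := by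
  intro V hV
  generalize hU : Term.var x = U at hV
  cases hV with
  | root hr => obtain ⟨_, _, e, _⟩ := hr.isDestructor; simp [← hU] at e
  | arg => cases hU

/-- Contracting a redex with irreducible arguments yields an irreducible term. -/
theorem Rule.irreducible {b : ℕ} {f : Sym} {args : Fin f.arity → Term} {V : Term}
    (hr : Rule b (.app f args) V) (ha : ∀ i, Irreducible b (args i)) : Irreducible b V := by
  generalize hU : Term.app f args = U at hr
  cases hr <;> cases hU
  case proj n args i =>
    have := ha 0
    simp [irreducible_app, Sym.IsDestructor] at this
    exact this i
  all_goals
    simp [forall_vecCons, irreducible_app, Sym.IsDestructor] at ha ⊢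
    try tauto

/-! ### Normal forms -/

open Classical in
/-- Contract a redex at the root, if there is one. -/
noncomputable def contract (b : ℕ) (T : Term) : Term :=
  if hr : ∃ V, Rule b T V then hr.choose else T

theorem Rule.contract_eq {b : ℕ} {U V : Term} (hr : Rule b U V) : contract b U = V := by
  have he : ∃ V, Rule b U V := ⟨V, hr⟩
  rw [contract, dif_pos he]
  exact he.choose_spec.det hr rfl

theorem contract_of_not_rule {b : ℕ} {U : Term} (hr : ∀ V, ¬ Rule b U V) :
    contract b U = U := by
  rw [contract, dif_neg (by simpa using hr)]

/-- The normal form, computed innermost first. -/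
noncomputable def nf (b : ℕ) : Term → Term
  | .var x => .var x
  | .name n => .name n
  | .app f args => contract b (.app f fun i => nf b (args i))

theorem nf_app_constructor {b : ℕ} {f : Sym} (hf : ¬ f.IsDestructor)
    (args : Fin f.arity → Term) :
    nf b (.app f args) = .app f fun i => nf b (args i) := by
  rw [nf, contract_of_not_rule]
  intro V hV
  obtain ⟨g, args', e, hg⟩ := hV.isDestructor
  injection e with e₁
  exact hf (e₁ ▸ hg)

theorem irreducible_nf (b : ℕ) (T : Term) : Irreducible b (nf b T) := by
  induction T with
  | var x => exact irreducible_var x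
  | name n => exact irreducible_name n
  | app f args ih =>
    rw [nf]
    by_cases hr : ∃ V, Rule b (.app f fun i => nf b (args i)) V
    · obtain ⟨V, hV⟩ := hr
      rw [hV.contract_eq]
      exact hV.irreducible ih
    · rw [contract_of_not_rule (by simpa using hr), irreducible_app]
      exact ⟨ih, fun _ => by simpa using hr⟩

theorem reflTransGen_app {b : ℕ} {f : Sym} {args args' : Fin f.arity → Term}
    (ha : ∀ i, Relation.ReflTransGen (Rewrites b) (args i) (args' i)) :
    Relation.ReflTransGen (Rewrites b) (.app f args) (.app f args') := by
  classical
  have one : ∀ (args : Fin f.arity → Term) (i : Fin f.arity) (V : Term),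
      Relation.ReflTransGen (Rewrites b) (args i) V →
      Relation.ReflTransGen (Rewrites b) (.app f args) (.app f (Function.update args i V)) := by
    intro args i V hV
    induction hV with
    | refl => rw [Function.update_eq_self]
    | tail _ hr ih =>
      refine ih.tail ?_
      have := Rewrites.arg f (Function.update args i _) i (by rw [Function.update_self]; exact hr)
      rwa [Function.update_idem] at this
  -- The arguments are rewritten one at a time; `s` is the set of those already done.
  have all : ∀ s : Finset (Fin f.arity),
      Relation.ReflTransGen (Rewrites b) (.app f args)
        (.app f fun i => if i ∈ s then args' i else args i) := by
    intro s
    induction s using Finset.induction_on with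
    | empty => simpa using Relation.ReflTransGen.refl
    | insert i s hi ih =>
      refine ih.trans ?_
      have := one (fun j => if j ∈ s then args' j else args j) i (args' i) (by simpa [hi] using ha i)
      convert this using 2
      funext j
      by_cases hj : j = i
      · subst hj; simp
      · simp [hj]
  simpa using all Finset.univ

theorem reflTransGen_nf (b : ℕ) (T : Term) : Relation.ReflTransGen (Rewrites b) T (nf b T) := by
  induction T with
  | var x => exact .refl
  | name n => exact .refl
  | app f args ih =>
    refine (reflTransGen_app ih).trans ?_
    rw [nf]
    by_cases hr : ∃ V, Rule b (.app f fun i => nf b (args i)) V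
    · obtain ⟨V, hV⟩ := hr
      rw [hV.contract_eq]
      exact .single (.root hV)
    · rw [contract_of_not_rule (by simpa using hr)]

theorem Irreducible.nf_eq {b : ℕ} {T : Term} (hT : Irreducible b T) : nf b T = T := by
  rcases Relation.ReflTransGen.cases_head (reflTransGen_nf b T) with e | ⟨V, hV, _⟩
  · exact e.symm
  · exact absurd hV (hT V)

theorem nf_nf (b : ℕ) (T : Term) : nf b (nf b T) = nf b T := (irreducible_nf b T).nf_eq

theorem irreducible_iff_nf_eq {b : ℕ} {T : Term} : Irreducible b T ↔ nf b T = T :=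
  ⟨Irreducible.nf_eq, fun e => e ▸ irreducible_nf b T⟩

section Constructors

variable (b : ℕ) (x y z w : Term)

@[simp] theorem nf_ps : nf b ps = ps :=
  (nf_app_constructor (by simp [Sym.IsDestructor]) _).trans (by simp only [comp_vecEmpty])

@[simp] theorem nf_pd : nf b pd = pd :=
  (nf_app_constructor (by simp [Sym.IsDestructor]) _).trans (by simp only [comp_vecEmpty])

@[simp] theorem nf_tt : nf b tt = tt :=
  (nf_app_constructor (by simp [Sym.IsDestructor]) _).trans (by simp only [comp_vecEmpty])

@[simp] theorem nf_ff : nf b ff = ff :=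
  (nf_app_constructor (by simp [Sym.IsDestructor]) _).trans (by simp only [comp_vecEmpty])

@[simp] theorem nf_bot : nf b bot = bot :=
  (nf_app_constructor (by simp [Sym.IsDestructor]) _).trans (by simp only [comp_vecEmpty])

@[simp] theorem nf_tpmAcc : nf b tpmAcc = tpmAcc :=
  (nf_app_constructor (by simp [Sym.IsDestructor]) _).trans (by simp only [comp_vecEmpty])

@[simp] theorem nf_cpuAcc : nf b cpuAcc = cpuAcc :=
  (nf_app_constructor (by simp [Sym.IsDestructor]) _).trans (by simp only [comp_vecEmpty])

@[simp] theorem nf_os : nf b os = os :=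
  (nf_app_constructor (by simp [Sym.IsDestructor]) _).trans (by simp only [comp_vecEmpty])

@[simp] theorem nf_cpuTpm : nf b cpuTpm = cpuTpm :=
  (nf_app_constructor (by simp [Sym.IsDestructor]) _).trans (by simp only [comp_vecEmpty])

@[simp] theorem nf_resetReq : nf b resetReq = resetReq :=
  (nf_app_constructor (by simp [Sym.IsDestructor]) _).trans (by simp only [comp_vecEmpty])

@[simp] theorem nf_resetResp : nf b resetResp = resetResp :=
  (nf_app_constructor (by simp [Sym.IsDestructor]) _).trans (by simp only [comp_vecEmpty])

@[simp] theorem nf_extendReq : nf b extendReq = extendReq :=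
  (nf_app_constructor (by simp [Sym.IsDestructor]) _).trans (by simp only [comp_vecEmpty])

@[simp] theorem nf_extendResp : nf b extendResp = extendResp :=
  (nf_app_constructor (by simp [Sym.IsDestructor]) _).trans (by simp only [comp_vecEmpty])

@[simp] theorem nf_extChannel : nf b extChannel = extChannel :=
  (nf_app_constructor (by simp [Sym.IsDestructor]) _).trans (by simp only [comp_vecEmpty])

@[simp] theorem nf_unsealTag : nf b unsealTag = unsealTag :=
  (nf_app_constructor (by simp [Sym.IsDestructor]) _).trans (by simp only [comp_vecEmpty])

@[simp] theorem nf_plainTag : nf b plainTag = plainTag :=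
  (nf_app_constructor (by simp [Sym.IsDestructor]) _).trans (by simp only [comp_vecEmpty])

@[simp] theorem nf_drtReq : nf b drtReq = drtReq :=
  (nf_app_constructor (by simp [Sym.IsDestructor]) _).trans (by simp only [comp_vecEmpty])

@[simp] theorem nf_drtResp : nf b drtResp = drtResp :=
  (nf_app_constructor (by simp [Sym.IsDestructor]) _).trans (by simp only [comp_vecEmpty])

@[simp] theorem nf_entry (k : ℕ) : nf b (.app (.entry k) ![]) = .app (.entry k) ![] :=
  (nf_app_constructor (by simp [Sym.IsDestructor]) _).trans (by simp only [comp_vecEmpty])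

@[simp] theorem nf_h : nf b (h x) = h (nf b x) :=
  (nf_app_constructor (by simp [Sym.IsDestructor]) _).trans (by simp only [comp_vecCons, comp_vecEmpty])

@[simp] theorem nf_prog : nf b (prog x) = prog (nf b x) :=
  (nf_app_constructor (by simp [Sym.IsDestructor]) _).trans (by simp only [comp_vecCons, comp_vecEmpty])

@[simp] theorem nf_tpm : nf b (tpm x) = tpm (nf b x) :=
  (nf_app_constructor (by simp [Sym.IsDestructor]) _).trans (by simp only [comp_vecCons, comp_vecEmpty])

@[simp] theorem nf_tpmCh : nf b (tpmCh x) = tpmCh (nf b x) :=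
  (nf_app_constructor (by simp [Sym.IsDestructor]) _).trans (by simp only [comp_vecCons, comp_vecEmpty])

@[simp] theorem nf_senc : nf b (senc x y) = senc (nf b x) (nf b y) :=
  (nf_app_constructor (by simp [Sym.IsDestructor]) _).trans (by simp only [comp_vecCons, comp_vecEmpty])

@[simp] theorem nf_sealD : nf b (sealD x y) = sealD (nf b x) (nf b y) :=
  (nf_app_constructor (by simp [Sym.IsDestructor]) _).trans (by simp only [comp_vecCons, comp_vecEmpty])

@[simp] theorem nf_cpu : nf b (cpu x y) = cpu (nf b x) (nf b y) :=
  (nf_app_constructor (by simp [Sym.IsDestructor]) _).trans (by simp only [comp_vecCons, comp_vecEmpty])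

@[simp] theorem nf_smram : nf b (smram x y) = smram (nf b x) (nf b y) :=
  (nf_app_constructor (by simp [Sym.IsDestructor]) _).trans (by simp only [comp_vecCons, comp_vecEmpty])

@[simp] theorem nf_drt : nf b (drt x y z) = drt (nf b x) (nf b y) (nf b z) :=
  (nf_app_constructor (by simp [Sym.IsDestructor]) _).trans (by simp only [comp_vecCons, comp_vecEmpty])

@[simp] theorem nf_state :
    nf b (state x y z w) = state (nf b x) (nf b y) (nf b z) (nf b w) :=
  (nf_app_constructor (by simp [Sym.IsDestructor]) _).trans (by simp only [comp_vecCons, comp_vecEmpty])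

@[simp] theorem nf_tup {n : ℕ} (args : Fin n → Term) : nf b (tup args) = tup fun i => nf b (args i) :=
  nf_app_constructor (by simp [Sym.IsDestructor]) _

@[simp] theorem nf_name (n : Name) : nf b (.name n) = .name n := by rw [nf]

theorem nf_chain (l : List Term) : nf b (chain x l) = chain (nf b x) (l.map (nf b)) :=
  map_chain (fun x y => by simp only [nf_h, nf_tup, comp_vecCons, comp_vecEmpty]) x l

end Constructors

/-- The left-hand sides consist of constructors below the root, and constructors commute with `nf`;
all occurrences of a variable are normalized alike, so non-linear patterns still match. -/
theorem Rule.map_nf {b : ℕ} {f : Sym} {args : Fin f.arity → Term} {V : Term}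
    (hr : Rule b (.app f args) V) : Rule b (.app f fun i => nf b (args i)) (nf b V) := by
  generalize hU : Term.app f args = U at hr
  cases hr <;> cases hU
  case isSmall v₀ l hv hl =>
    simp only [comp_vecCons, comp_vecEmpty, nf_tt, nf_chain]
    refine .isSmall _ _ ?_ (by simpa using hl)
    rcases hv with rfl | rfl
    · left; exact nf_ps b
    · right; exact nf_pd b
  case isBig v₀ l hl =>
    simp only [comp_vecCons, comp_vecEmpty, nf_tt, nf_chain]
    exact .isBig _ _ (by simpa using hl)
  all_goals
    simp only [comp_vecCons, comp_vecEmpty, nf_senc, nf_sealD, nf_prog, nf_state, nf_tpm, nf_cpu,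
      nf_smram, nf_drt, nf_ps, nf_pd, nf_tt, nf_ff, nf_h, nf_tpmAcc, nf_cpuAcc, nf_tup]
  case proj.refl args i => exact .proj (fun i => nf b (args i)) i
  case sdec.refl => exact .sdec _ _
  case unsealD.refl => exact .unsealD _ _
  case getEntry.refl => exact .getEntry _
  case pcr.refl => exact .pcr _ _ _ _
  case int.refl => exact .int _ _ _ _ _
  case getCache.refl => exact .getCache _ _ _ _ _
  case stm.refl => exact .stm _ _ _ _ _
  case smi.refl => exact .smi _ _ _ _ _
  case init.refl => exact .init _ _ _ _ _ _
  case pp.refl => exact .pp _ _ _ _ _ _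
  case lock.refl => exact .lock _ _ _ _ _ _
  case resetPs.refl => exact .resetPs _ _ _ _
  case resetPd.refl => exact .resetPd _ _ _ _
  case extend.refl => exact .extend _ _ _ _ _
  case setPcr.refl => exact .setPcr _ _ _ _ _
  case setIntCpu.refl => exact .setIntCpu _ _ _ _ _ _
  case setIntPp.refl => exact .setIntPp _ _ _ _ _ _ _
  case cache.refl => exact .cache _ _ _ _ _ _
  case flushStm.refl => exact .flushStm _ _ _ _ _ _ _
  case flushSmi.refl => exact .flushSmi _ _ _ _ _ _
  case setInit.refl => exact .setInit _ _ _ _ _ _ _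
  case setPpCpu.refl => exact .setPpCpu _ _ _ _ _ _ _
  case setPpInit.refl => exact .setPpInit _ _ _ _ _ _ _
  case setPpSmi.refl => exact .setPpSmi _ _ _ _ _ _ _ _
  case setLockCpu.refl => exact .setLockCpu _ _ _ _ _ _ _
  case setLockPp.refl => exact .setLockPp _ _ _ _ _ _ _
  case setLockSmi.refl => exact .setLockSmi _ _ _ _ _ _ _ _

theorem Rule.nf_eq {b : ℕ} {U V : Term} (hr : Rule b U V) : nf b U = nf b V := by
  obtain ⟨f, args, rfl, -⟩ := hr.isDestructor
  rw [nf, hr.map_nf.contract_eq]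

/-- Invariance of `nf` under rewriting yields uniqueness of normal forms without any study of
critical pairs. -/
theorem Rewrites.nf_eq {b : ℕ} {U V : Term} (hr : Rewrites b U V) : nf b U = nf b V := by
  induction hr with
  | root hr => exact hr.nf_eq
  | arg f args i _ ih =>
    rw [nf, nf]
    congr 2
    funext j
    by_cases hj : j = i
    · subst hj; simpa using ih
    · simp [hj]

theorem nf_eq_of_reflTransGen {b : ℕ} {U V : Term}
    (hr : Relation.ReflTransGen (Rewrites b) U V) : nf b U = nf b V := by
  induction hr with
  | refl => rfl
  | tail _ hr ih => exact ih.trans hr.nf_eq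

theorem normalForm_iff {b : ℕ} {T V : Term} : NormalForm b T V ↔ nf b T = V := by
  constructor
  · rintro ⟨h₁, h₂⟩
    rw [nf_eq_of_reflTransGen h₁, h₂.nf_eq]
  · rintro rfl
    exact ⟨reflTransGen_nf b T, irreducible_nf b T⟩

/-- From here on, equality modulo the theory is handled as equality of `nf`. -/
theorem eqE_iff {b : ℕ} {U V : Term} : EqE b U V ↔ nf b U = nf b V := by
  simp [EqE, normalForm_iff, eq_comm]

/-! ### Destructor-free and closed terms -/

theorem destructorFree_app {f : Sym} {args : Fin f.arity → Term} :
    (Term.app f args).DestructorFree ↔ ¬ f.IsDestructor ∧ ∀ i, (args i).DestructorFree := by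
  simp only [Term.DestructorFree, Term.syms, Set.singleton_union, Set.mem_insert_iff,
    Set.mem_iUnion, forall_eq_or_imp, forall_exists_index]
  exact and_congr_right fun _ => ⟨fun hf i g hg => hf g i hg, fun hf g i hg => hf i g hg⟩

theorem destructorFree_name (n : Name) : (Term.name n).DestructorFree := by
  simp [Term.DestructorFree, Term.syms]

theorem Term.DestructorFree.irreducible {b : ℕ} {T : Term} (hT : T.DestructorFree) :
    Irreducible b T := by
  induction T with
  | var x => exact irreducible_var x
  | name n => exact irreducible_name n
  | app f args ih =>
    rw [destructorFree_app] at hT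
    exact irreducible_app.2 ⟨fun i => ih i (hT.2 i), fun hf => absurd hf hT.1⟩

theorem Term.DestructorFree.nf_eq {b : ℕ} {T : Term} (hT : T.DestructorFree) : nf b T = T :=
  hT.irreducible.nf_eq

namespace Term

/-- A term without variables. -/
def Closed (T : Term) : Prop := T.vars = ∅

theorem closed_app {f : Sym} {args : Fin f.arity → Term} :
    (app f args).Closed ↔ ∀ i, (args i).Closed := by
  simp [Closed, vars]

theorem closed_name (n : Name) : (name n).Closed := rfl

theorem subst_congr {σ δ : Ident → Term} {T : Term} (he : ∀ x ∈ T.vars, σ x = δ x) :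
    T.subst σ = T.subst δ := by
  induction T with
  | var x => exact he x rfl
  | name n => rfl
  | app f args ih =>
    simp only [subst]
    congr 1
    funext i
    exact ih i fun x hx => he x (Set.mem_iUnion.2 ⟨i, hx⟩)

theorem subst_var (T : Term) : T.subst var = T := by
  induction T with
  | var x => rfl
  | name n => rfl
  | app f args ih => simp only [subst, ih]

theorem Closed.subst_eq {T : Term} (hT : T.Closed) (σ : Ident → Term) : T.subst σ = T :=
  (subst_congr (δ := var) (by rw [hT]; simp)).trans T.subst_var

theorem subst_subst (T : Term) (σ δ : Ident → Term) :
    (T.subst σ).subst δ = T.subst fun x => (σ x).subst δ := by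
  induction T with
  | var x => rfl
  | name n => rfl
  | app f args ih => simp only [subst, ih]

theorem closed_subst {T : Term} {σ : Ident → Term} (hT : ∀ x ∈ T.vars, (σ x).Closed) :
    (T.subst σ).Closed := by
  induction T with
  | var x => exact hT x rfl
  | name n => rfl
  | app f args ih =>
    rw [subst, closed_app]
    exact fun i => ih i fun x hx => hT x (Set.mem_iUnion.2 ⟨i, hx⟩)

end Term

theorem Rule.closed {b : ℕ} {U V : Term} (hr : Rule b U V) (hU : U.Closed) : V.Closed := by
  cases hr <;> simp only [Term.closed_app, forall_vecCons] at hU ⊢ <;> tauto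

theorem Term.Closed.nf {b : ℕ} {T : Term} (hT : T.Closed) : (nf b T).Closed := by
  induction T with
  | var x => exact hT
  | name n => exact hT
  | app f args ih =>
    rw [closed_app] at hT
    have hc : (Term.app f fun i => TrustedPlatform.nf b (args i)).Closed :=
      closed_app.2 fun i => ih i (hT i)
    rw [TrustedPlatform.nf]
    by_cases hr : ∃ V, Rule b (.app f fun i => TrustedPlatform.nf b (args i)) V
    · obtain ⟨V, hV⟩ := hr
      rw [hV.contract_eq]
      exact hV.closed hc
    · rwa [contract_of_not_rule (by simpa using hr)]

/-! ### Environments -/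

/-- Environments: substitutions by closed terms for some of the variables. -/
def IsEnv (ρ : Ident → Term) : Prop := ∀ x, (ρ x).Closed ∨ ρ x = .var x

namespace Pat

theorem binders_subst (A : Pat) (σ : Ident → Term) : (A.subst σ).binders = A.binders := by
  induction A with
  | var x => rfl
  | eq T => rfl
  | tup n ps ih => simp only [subst, binders, ih]

theorem subst_subst (A : Pat) (σ δ : Ident → Term) :
    (A.subst σ).subst δ = A.subst fun x => (σ x).subst δ := by
  induction A with
  | var x => rfl
  | eq T => simp only [subst, Term.subst_subst]
  | tup n ps ih => simp only [subst, ih]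

theorem subst_var (A : Pat) : A.subst Term.var = A := by
  induction A with
  | var x => rfl
  | eq T => simp only [subst, Term.subst_var]
  | tup n ps ih => simp only [subst, ih]

/-- In a match with irreducible values, the value of each bound variable is a subterm of the
message. -/
theorem closed_of_inst {b : ℕ} {A : Pat} {σ : Ident → Term} (hc : (nf b (A.inst σ)).Closed)
    (hσ : ∀ x ∈ A.binders, Irreducible b (σ x)) : ∀ x ∈ A.binders, (σ x).Closed := by
  induction A with
  | var x =>
    intro y hy
    simp only [binders, Finset.mem_singleton] at hy hσ
    subst hy
    rwa [inst, (hσ y rfl).nf_eq] at hc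
  | eq T => simp [binders]
  | tup n ps ih =>
    simp only [binders, Finset.mem_biUnion, Finset.mem_univ, true_and, forall_exists_index] at hσ ⊢
    intro x i hx
    rw [inst, nf_tup, Term.closed_app] at hc
    exact ih i (hc i) (fun y hy => hσ y i hy) x hx

end Pat

namespace Proc

/-- The assumption `IsEnv` rules out capture: a value is closed, or it is the variable itself. -/
theorem subst_subst (P : Proc) {σ : Ident → Term} (hσ : IsEnv σ) (δ : Ident → Term) :
    (P.subst σ).subst δ = P.subst fun x => (σ x).subst δ := by
  induction P generalizing σ δ with
  | nil => rfl
  | par P Q ihP ihQ => simp only [subst, ihP hσ, ihQ hσ]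
  | repl P ih => simp only [subst, ih hσ]
  | new n P ih =>
    simp only [subst]
    rw [ih (σ := Function.update σ n (.var n))]
    · congr 2
      funext x
      by_cases hx : x = n
      · subst hx; simp [Term.subst]
      · rcases hσ x with hc | hv
        · simp [hx, hc.subst_eq]
        · simp [hx, hv, Term.subst]
    · intro x
      by_cases hx : x = n
      · subst hx; simp
      · simpa [hx] using hσ x
  | inp U A P ih =>
    simp only [subst, Term.subst_subst, Pat.subst_subst, Pat.binders_subst]
    rw [ih (σ := fun x => if x ∈ A.binders then .var x else σ x)]
    · congr 2
      funext x
      by_cases hx : x ∈ A.binders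
      · simp [hx, Term.subst]
      · rcases hσ x with hc | hv
        · simp [hx, hc.subst_eq]
        · simp [hx, hv, Term.subst]
    · intro x
      by_cases hx : x ∈ A.binders
      · simp [hx]
      · simpa [hx] using hσ x
  | out U T P ih => simp only [subst, Term.subst_subst, ih hσ]
  | ite U V P Q ihP ihQ => simp only [subst, Term.subst_subst, ihP hσ, ihQ hσ]
  | letIn y T P ih =>
    simp only [subst, Term.subst_subst]
    rw [ih (σ := Function.update σ y (.var y))]
    · congr 2
      funext x
      by_cases hx : x = y
      · subst hx; simp [Term.subst]
      · rcases hσ x with hc | hv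
        · simp [hx, hc.subst_eq]
        · simp [hx, hv, Term.subst]
    · intro x
      by_cases hx : x = y
      · subst hx; simp
      · simpa [hx] using hσ x

theorem subst_var (P : Proc) : P.subst Term.var = P := by
  induction P with
  | nil => rfl
  | par P Q ihP ihQ => simp only [subst, ihP, ihQ]
  | repl P ih => simp only [subst, ih]
  | new n P ih => simp only [subst, Function.update_eq_self, ih]
  | inp U A P ih => simp only [subst, Term.subst_var, Pat.subst_var, ite_self, ih]
  | out U T P ih => simp only [subst, Term.subst_var, ih]
  | ite U V P Q ihP ihQ => simp only [subst, Term.subst_var, ihP, ihQ]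
  | letIn y T P ih => simp only [subst, Term.subst_var, Function.update_eq_self, ih]

/-- Instantiating one more variable of a process in an environment. -/
theorem subst_update (P : Proc) {ρ : Ident → Term} (hρ : IsEnv ρ) (x : Ident) (V : Term) :
    (P.subst (Function.update ρ x (.var x))).subst (Function.update Term.var x V) =
      P.subst (Function.update ρ x V) := by
  rw [subst_subst]
  · congr 1
    funext y
    by_cases hy : y = x
    · subst hy; simp [Term.subst]
    · rcases hρ y with hc | hv
      · simp [hy, hc.subst_eq]
      · simp [hy, hv, Term.subst]
  · intro y
    by_cases hy : y = x
    · subst hy; simp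
    · simpa [hy] using hρ y

/-- Instantiating the variables bound by a pattern. -/
theorem subst_binders (P : Proc) {ρ : Ident → Term} (hρ : IsEnv ρ) (B : Finset Ident)
    (σ : Ident → Term) :
    (P.subst fun x => if x ∈ B then .var x else ρ x).subst
        (fun x => if x ∈ B then σ x else .var x) =
      P.subst fun x => if x ∈ B then σ x else ρ x := by
  rw [subst_subst]
  · congr 1
    funext y
    by_cases hy : y ∈ B
    · simp [hy, Term.subst]
    · rcases hρ y with hc | hv
      · simp [hy, hc.subst_eq]
      · simp [hy, hv, Term.subst]
  · intro y
    by_cases hy : y ∈ B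
    · simp [hy]
    · simpa [hy] using hρ y

end Proc

/-- The environment `ρ` interprets the process `P`. -/
structure Interprets (ρ : Ident → Term) (P : Proc) : Prop where
  isEnv : IsEnv ρ
  closed : ∀ x ∈ P.freeVars, (ρ x).Closed

theorem IsEnv.update {ρ : Ident → Term} (hρ : IsEnv ρ) (x : Ident) {V : Term} (hV : V.Closed) :
    IsEnv (Function.update ρ x V) := by
  intro y
  by_cases hy : y = x
  · subst hy; simp [hV]
  · simpa [hy] using hρ y

namespace Interprets

variable {ρ : Ident → Term}

theorem parLeft {P Q : Proc} (hi : Interprets ρ (.par P Q)) : Interprets ρ P :=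
  ⟨hi.isEnv, fun x hx => hi.closed x (Or.inl hx)⟩

theorem parRight {P Q : Proc} (hi : Interprets ρ (.par P Q)) : Interprets ρ Q :=
  ⟨hi.isEnv, fun x hx => hi.closed x (Or.inr hx)⟩

theorem repl {P : Proc} (hi : Interprets ρ (.repl P)) : Interprets ρ P :=
  ⟨hi.isEnv, fun x hx => hi.closed x hx⟩

theorem new {n : Ident} {P : Proc} (hi : Interprets ρ (.new n P)) (m : Name) :
    Interprets (Function.update ρ n (.name m)) P := by
  refine ⟨hi.isEnv.update n (Term.closed_name m), fun x hx => ?_⟩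
  by_cases hn : x = n
  · subst hn; simp [Term.closed_name]
  · simpa [hn] using hi.closed x ⟨hx, hn⟩

theorem out {U T : Term} {P : Proc} (hi : Interprets ρ (.out U T P)) : Interprets ρ P :=
  ⟨hi.isEnv, fun x hx => hi.closed x (Or.inr hx)⟩

theorem out_closed {U T : Term} {P : Proc} (hi : Interprets ρ (.out U T P)) :
    (T.subst ρ).Closed :=
  Term.closed_subst fun x hx => hi.closed x (Or.inl (Or.inr hx))

theorem iteLeft {U V : Term} {P Q : Proc} (hi : Interprets ρ (.ite U V P Q)) : Interprets ρ P :=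
  ⟨hi.isEnv, fun x hx => hi.closed x (Or.inl (Or.inr hx))⟩

theorem iteRight {U V : Term} {P Q : Proc} (hi : Interprets ρ (.ite U V P Q)) : Interprets ρ Q :=
  ⟨hi.isEnv, fun x hx => hi.closed x (Or.inr hx)⟩

theorem letIn {b : ℕ} {y : Ident} {T : Term} {P : Proc} (hi : Interprets ρ (.letIn y T P)) :
    Interprets (Function.update ρ y (nf b (T.subst ρ))) P := by
  have hc : (nf b (T.subst ρ)).Closed :=
    (Term.closed_subst fun x hx => hi.closed x (Or.inl hx)).nf
  refine ⟨hi.isEnv.update y hc, fun x hx => ?_⟩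
  by_cases hn : x = y
  · subst hn; simpa using hc
  · simpa [hn] using hi.closed x (Or.inr ⟨hx, hn⟩)

theorem inp {b : ℕ} {U T : Term} {A : Pat} {P : Proc} {σ : Ident → Term}
    (hi : Interprets ρ (.inp U A P)) (hT : T.Closed)
    (he : nf b T = nf b ((A.subst ρ).inst σ)) (hσ : ∀ x ∈ A.binders, Irreducible b (σ x)) :
    Interprets (fun x => if x ∈ A.binders then σ x else ρ x) P := by
  have hc : ∀ x ∈ A.binders, (σ x).Closed := by
    rw [← A.binders_subst ρ]
    exact Pat.closed_of_inst (b := b) (he ▸ hT.nf) (by rwa [A.binders_subst ρ])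
  constructor
  · intro x
    by_cases hx : x ∈ A.binders
    · simp [hx, hc x hx]
    · simpa [hx] using hi.isEnv x
  · intro x hP
    by_cases hx : x ∈ A.binders
    · simp [hx, hc x hx]
    · simpa [hx] using hi.closed x (Or.inr ⟨hP, hx⟩)

end Interprets

/-! ### A semantic type system for processes -/

/-- Data attached to the names generated so far. -/
abbrev World := Name → Option (Term × Term × Term × Term)

/-- The ingredients of a typing: the terms that the attacker may know, the messages that may be
sent on a channel, the names that may be generated, and the terms that may be evaluated by a
`let`. -/
structure Typing where
  known : Term → Prop
  allowed : World → Term → Term → Prop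
  fresh : Name → Prop
  evaluable : Term → Prop

namespace Typing

/-- `W` is extended by `W'`. -/
def Le (W W' : World) : Prop := ∀ n d, W n = some d → W' n = some d

theorem Le.rfl {W : World} : Le W W := fun _ _ e => e

theorem Le.trans {W₁ W₂ W₃ : World} (h₁ : Le W₁ W₂) (h₂ : Le W₂ W₃) : Le W₁ W₃ :=
  fun n d e => h₂ n d (h₁ n d e)

open Classical in
theorem le_update {W : World} {n : Name} (hn : W n = none) (d) : Le W (Function.update W n d) := by
  intro m d' e
  have hm : m ≠ n := by rintro rfl; simp [hn] at e
  simpa [hm] using e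

open Classical in
/-- The process, run in the environment and the world, respects the typing for ever. -/
def Ok (Γ : Typing) (b : ℕ) : Proc → World → (Ident → Term) → Prop
  | .nil, _, _ => True
  | .par P Q, W, ρ => Γ.Ok b P W ρ ∧ Γ.Ok b Q W ρ
  | .repl P, W, ρ => Γ.Ok b P W ρ
  | .new n P, W, ρ => ∀ W' i, Le W W' → Γ.fresh ⟨n, i⟩ → W' ⟨n, i⟩ = none →
      ∃ d, Γ.Ok b P (Function.update W' ⟨n, i⟩ d) (Function.update ρ n (.name ⟨n, i⟩))
  | .inp U A P, W, ρ => ∀ W' σ, Le W W' →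
      Γ.allowed W' (nf b (U.subst ρ)) (nf b ((A.subst ρ).inst σ)) →
      (∀ x ∈ A.binders, nf b (σ x) = σ x) →
      Γ.Ok b P W' fun x => if x ∈ A.binders then σ x else ρ x
  | .out U T P, W, ρ => Γ.allowed W (nf b (U.subst ρ)) (nf b (T.subst ρ)) ∧ Γ.Ok b P W ρ
  | .ite U V P Q, W, ρ =>
      (nf b (U.subst ρ) = nf b (V.subst ρ) → Γ.Ok b P W ρ) ∧
      (nf b (U.subst ρ) ≠ nf b (V.subst ρ) → Γ.Ok b Q W ρ)
  | .letIn x T P, W, ρ => Γ.evaluable (T.subst ρ) ∧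
      ∀ V, nf b (T.subst ρ) = V → V.DestructorFree → Γ.Ok b P W (Function.update ρ x V)

/-- The properties of a typing that make it sound. -/
structure Sound (Γ : Typing) (b : ℕ) : Prop where
  deduce : ∀ M T, (∀ S ∈ M, Γ.known (nf b S)) → Deduce b M T → Γ.known (nf b T)
  leak : ∀ W U T, Γ.allowed W U T → Γ.known U → Γ.known T
  mono : ∀ W W' U T, Le W W' → Γ.allowed W U T → Γ.allowed W' U T

variable {Γ : Typing} {b : ℕ}

/-- Inputs and restrictions already quantify over all later worlds, so only outputs use monotonicity
of the allowed messages. -/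
theorem Ok.mono (hΓ : Γ.Sound b) {P : Proc} {W W' : World} {ρ : Ident → Term} (hW : Le W W')
    (hP : Γ.Ok b P W ρ) : Γ.Ok b P W' ρ := by
  induction P generalizing ρ with
  | nil => trivial
  | par P Q ihP ihQ => exact ⟨ihP hP.1, ihQ hP.2⟩
  | repl P ih => exact ih hP
  | new n P ih => exact fun W'' i h₁ h₂ h₃ => hP W'' i (hW.trans h₁) h₂ h₃
  | inp U A P ih => exact fun W'' σ h₁ h₂ h₃ => hP W'' σ (hW.trans h₁) h₂ h₃
  | out U T P ih => exact ⟨hΓ.mono _ _ _ _ hW hP.1, ih hP.2⟩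
  | ite U V P Q ihP ihQ => exact ⟨fun e => ihP (hP.1 e), fun e => ihQ (hP.2 e)⟩
  | letIn x T P ih => exact ⟨hP.1, fun V h₁ h₂ => ih (hP.2 V h₁ h₂)⟩

/-- A closed process that is well typed. -/
def OkProc (Γ : Typing) (b : ℕ) (W : World) (P : Proc) : Prop :=
  ∃ ρ P₀, P = P₀.subst ρ ∧ Interprets ρ P₀ ∧ Γ.Ok b P₀ W ρ

/-- A well-typed configuration. -/
structure OkConfig (Γ : Typing) (b : ℕ) (W : World) (c : Config) : Prop where
  known : ∀ T ∈ c.known, Γ.known (nf b T)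
  procs : ∀ P ∈ c.procs, Γ.OkProc b W P
  names : ∀ n, W n ≠ none → n ∈ c.names

theorem OkProc.mono (hΓ : Γ.Sound b) {P : Proc} {W W' : World} (hW : Le W W')
    (hP : Γ.OkProc b W P) : Γ.OkProc b W' P := by
  obtain ⟨ρ, P₀, e, hi, hok⟩ := hP
  exact ⟨ρ, P₀, e, hi, hok.mono hΓ hW⟩

open Classical in
-- Subject reduction. A running process is kept in the form `P₀.subst ρ`, so each step uses the
-- clause of `Ok` for the root of `P₀`.
theorem OkConfig.step (hΓ : Γ.Sound b) {W : World} {c c' : Config} (hc : Γ.OkConfig b W c)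
    (hs : Step b c c') (hf : ∀ n ∈ c'.names, Γ.fresh n) : ∃ W', Γ.OkConfig b W' c' := by
  obtain ⟨hknown, hprocs, hnames⟩ := hc
  cases hs with
  | nil N M R => exact ⟨W, hknown, fun P hP => hprocs P (by simp [hP]), hnames⟩
  | bang N M R P =>
    refine ⟨W, hknown, ?_, hnames⟩
    simp only [Multiset.mem_cons, forall_eq_or_imp] at hprocs ⊢
    obtain ⟨h₁, hR⟩ := hprocs
    refine ⟨?_, h₁, hR⟩
    obtain ⟨ρ, P₀, e, hi, hok⟩ := h₁
    cases P₀ <;> simp only [Proc.subst, reduceCtorEq, Proc.repl.injEq] at e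
    exact ⟨ρ, _, e, hi.repl, hok⟩
  | par N M R P Q =>
    refine ⟨W, hknown, ?_, hnames⟩
    simp only [Multiset.mem_cons, forall_eq_or_imp] at hprocs ⊢
    obtain ⟨⟨ρ, P₀, e, hi, hok⟩, hR⟩ := hprocs
    cases P₀ <;> simp only [Proc.subst, reduceCtorEq, Proc.par.injEq] at e
    exact ⟨⟨ρ, _, e.1, hi.parLeft, hok.1⟩, ⟨ρ, _, e.2, hi.parRight, hok.2⟩, hR⟩
  | new N M R n P i hni =>
    simp only [Multiset.mem_cons, forall_eq_or_imp] at hprocs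
    obtain ⟨⟨ρ, P₀, e, hi, hok⟩, hR⟩ := hprocs
    cases P₀ <;> simp only [Proc.subst, reduceCtorEq, Proc.new.injEq] at e
    obtain ⟨rfl, rfl⟩ := e
    -- Worlds carry data only for names in use, so the fresh name is still free to receive some.
    have hWn : W ⟨n, i⟩ = none := by
      by_contra hne
      exact hni (hnames _ hne)
    obtain ⟨d, hd⟩ := hok W i .rfl (hf _ (Set.mem_insert _ _)) hWn
    refine ⟨Function.update W ⟨n, i⟩ d, hknown, ?_, ?_⟩
    · simp only [Multiset.mem_cons, forall_eq_or_imp]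
      exact ⟨⟨_, _, Proc.subst_update _ hi.isEnv _ _, hi.new _, hd⟩,
        fun P hP => (hR P hP).mono hΓ (le_update hWn d)⟩
    · intro m hm
      by_cases hmn : m = ⟨n, i⟩
      · exact hmn ▸ Set.mem_insert _ _
      · rw [Function.update_of_ne hmn] at hm
        exact Set.mem_insert_of_mem _ (hnames m hm)
  | comm N M M' R U T U' A P Q σ hU hT hσ hM hM' =>
    simp only [Multiset.mem_cons, forall_eq_or_imp] at hprocs
    obtain ⟨⟨ρ, P₀, e, hi, hok⟩, ⟨δ, Q₀, e', hi', hok'⟩, hR⟩ := hprocs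
    cases P₀ <;> simp only [Proc.subst, reduceCtorEq, Proc.out.injEq] at e
    cases Q₀ <;> simp only [Proc.subst, reduceCtorEq, Proc.inp.injEq] at e'
    rename_i U₀ T₀ P₁ U₁ A₁ Q₁
    obtain ⟨rfl, rfl, rfl⟩ := e
    obtain ⟨rfl, rfl, rfl⟩ := e'
    rw [eqE_iff] at hU hT
    rw [Pat.binders_subst] at hσ ⊢
    refine ⟨W, ?_, ?_, hnames⟩
    -- The knowledge grows only if the channel is deducible, hence known; `leak` then makes the
    -- message known too.
    · by_cases hd : Deduce b M (U₀.subst ρ)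
      · rw [hM hd]
        rintro S (rfl | hS)
        · exact hΓ.leak _ _ _ hok.1 (hΓ.deduce M _ hknown hd)
        · exact hknown S hS
      · rw [hM' hd]
        exact hknown
    · simp only [Multiset.mem_cons, forall_eq_or_imp]
      refine ⟨⟨ρ, _, rfl, hi.out, hok.2⟩, ⟨_, _, Proc.subst_binders _ hi'.isEnv _ _, ?_, ?_⟩, hR⟩
      · exact hi'.inp hi.out_closed hT hσ
      · exact hok' W σ .rfl (hU ▸ hT ▸ hok.1) fun x hx => (hσ x hx).nf_eq
  | iteTrue N M R U V P Q hUV =>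
    refine ⟨W, hknown, ?_, hnames⟩
    simp only [Multiset.mem_cons, forall_eq_or_imp] at hprocs ⊢
    obtain ⟨⟨ρ, P₀, e, hi, hok⟩, hR⟩ := hprocs
    cases P₀ <;> simp only [Proc.subst, reduceCtorEq, Proc.ite.injEq] at e
    obtain ⟨rfl, rfl, rfl, rfl⟩ := e
    exact ⟨⟨ρ, _, rfl, hi.iteLeft, hok.1 (eqE_iff.1 hUV)⟩, hR⟩
  | iteFalse N M R U V P Q hUV =>
    refine ⟨W, hknown, ?_, hnames⟩
    simp only [Multiset.mem_cons, forall_eq_or_imp] at hprocs ⊢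
    obtain ⟨⟨ρ, P₀, e, hi, hok⟩, hR⟩ := hprocs
    cases P₀ <;> simp only [Proc.subst, reduceCtorEq, Proc.ite.injEq] at e
    obtain ⟨rfl, rfl, rfl, rfl⟩ := e
    exact ⟨⟨ρ, _, rfl, hi.iteRight, hok.2 fun e => hUV (eqE_iff.2 e)⟩, hR⟩
  | letIn N M R x T V P hV hdf =>
    refine ⟨W, hknown, ?_, hnames⟩
    simp only [Multiset.mem_cons, forall_eq_or_imp] at hprocs ⊢
    obtain ⟨⟨ρ, P₀, e, hi, hok⟩, hR⟩ := hprocs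
    cases P₀ <;> simp only [Proc.subst, reduceCtorEq, Proc.letIn.injEq] at e
    obtain ⟨rfl, rfl, rfl⟩ := e
    rw [normalForm_iff] at hV
    subst hV
    exact ⟨⟨_, _, Proc.subst_update _ hi.isEnv _ _, hi.letIn, hok.2 _ rfl hdf⟩, hR⟩

end Typing

theorem Step.names_subset {b : ℕ} {c c' : Config} (hs : Step b c c') : c.names ⊆ c'.names := by
  cases hs <;> first | exact Set.Subset.rfl | exact Set.subset_insert _ _

theorem Typing.OkConfig.reaches {Γ : Typing} {b : ℕ} (hΓ : Γ.Sound b) {W : World}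
    {c c' : Config} (hc : Γ.OkConfig b W c) (hr : Relation.ReflTransGen (Step b) c c')
    (hf : ∀ n ∈ c'.names, Γ.fresh n) : ∃ W', Γ.OkConfig b W' c' := by
  induction hr with
  | refl => exact ⟨W, hc⟩
  | tail _ hs ih =>
    obtain ⟨W', hc'⟩ := ih fun n hn => hf n (hs.names_subset hn)
    exact hc'.step hΓ hs hf

/-- A platform and an attacker that are both well typed remain so. -/
theorem Typing.okConfig_of_reaches {Γ : Typing} {b : ℕ} (hΓ : Γ.Sound b) {P Q : Proc}
    (hP : Γ.Ok b P (fun _ => none) .var) (hPc : P.freeVars = ∅)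
    (hQ : Γ.Ok b Q (fun _ => none) .var) (hQc : Q.freeVars = ∅) {c : Config}
    (hr : Reaches b P Q c) (hf : ∀ n ∈ c.names, Γ.fresh n) : ∃ W, Γ.OkConfig b W c := by
  refine Typing.OkConfig.reaches hΓ (W := fun _ => none) ⟨?_, ?_, ?_⟩ hr hf
  · simp [initConfig]
  · simp only [initConfig, Multiset.mem_singleton, forall_eq]
    refine ⟨.var, .par P Q, (Proc.subst_var _).symm, ⟨fun x => Or.inr rfl, ?_⟩, hP, hQ⟩
    simp [Proc.freeVars, hPc, hQc]
  · simp

/-! ### Register values and states -/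

/-- Register values obtained by extending one of the two reset values. -/
def IsChain (p : Term) : Prop := ∃ v₀ l, (v₀ = ps ∨ v₀ = pd) ∧ p = chain v₀ l

theorem IsChain.extend {p : Term} (hp : IsChain p) (v : Term) : IsChain (h (tup ![p, v])) := by
  obtain ⟨v₀, l, hv, rfl⟩ := hp
  exact ⟨v₀, l ++ [v], hv, (chain_append_singleton _ _ _).symm⟩

theorem isChain_ps : IsChain ps := ⟨ps, [], Or.inl rfl, rfl⟩

theorem isChain_pd : IsChain pd := ⟨pd, [], Or.inr rfl, rfl⟩

/-- A register value that is the result of at least `n` extensions. -/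
def HasLength (n : ℕ) (p : Term) : Prop := ∃ T₀ l, l.length = n ∧ p = chain T₀ l

theorem HasLength.extend {n : ℕ} {p : Term} (hp : HasLength n p) (v : Term) :
    HasLength n (h (tup ![p, v])) := by
  obtain ⟨T₀, l, hl, rfl⟩ := hp
  rw [← chain_append_singleton]
  cases l with
  | nil => exact ⟨_, [], hl, rfl⟩
  -- The innermost extension is absorbed into the initial value, which is arbitrary; the count `n`
  -- is unchanged.
  | cons a l => exact ⟨h (tup ![T₀, a]), l ++ [v], by simpa using hl, rfl⟩

/-- A platform state. -/
abbrev pst (p i c m a d e l : Term) : Term := state (tpm p) (cpu i c) (smram m a) (drt d e l)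

/-- The private entry points of the trusted programs. -/
abbrev entryPoint (k : ℕ) : Term := .app (.entry k) ![]

/-- The names restricted in the platform. -/
def platformNames : Set Ident := {.nonce, .nonce1, .rand, .kpp, .hipp}

/-- The closure properties of the terms that an attacker can obtain, where `k₀` and `m₀` are the
sealed key and the encrypted message. -/
structure Obtainable (b : ℕ) (K : Term → Prop) (k₀ m₀ : Name) : Prop where
  congr : ∀ {T T'}, nf b T = nf b T' → K T → K T'
  app : ∀ f args, ¬ f.IsPrivate → (∀ i, K (args i)) → K (.app f args)
  name : ∀ n : Name, n.base ∉ platformNames → K (.name n)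
  prog : ∀ k < 3, K (prog (entryPoint k))
  senc : K (senc (.name m₀) (.name k₀))
  sealD : K (sealD (.name k₀) hchain)
  start : K (pst ps tt bot bot bot bot bot ff)
  reset : ∀ {p x₁ x₂ x₃}, (state (tpm ps) x₁ x₂ x₃).DestructorFree →
    K (state (tpm p) x₁ x₂ x₃) → K (state (tpm ps) x₁ x₂ x₃)
  extend : ∀ {p x₁ x₂ x₃ v}, IsChain p → (state (tpm p) x₁ x₂ x₃).DestructorFree →
    v.DestructorFree → K (state (tpm p) x₁ x₂ x₃) → K v →
    K (state (tpm (h (tup ![p, v]))) x₁ x₂ x₃)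
  tpmCh : ∀ {e}, e.DestructorFree → K e → K (tpmCh (TrustedPlatform.prog e))
  launch : ∀ {p i c m a d e x}, (pst p ff c m a d e ff).DestructorFree → x.DestructorFree →
    K x → K (pst p i c m a d e ff) →
    K (pst (h (tup ![pd, tup ![h (TrustedPlatform.prog x), h m]])) ff c m a
      (TrustedPlatform.prog x) e tt)
  init : ∀ {p i c m a d e y}, (pst p ff c m a d e ff).DestructorFree → y.DestructorFree →
    K y → K (pst p i c m a d e ff) →
    K (pst (h (tup ![h (tup ![pd, tup ![h (TrustedPlatform.prog Tinit), h m]]), h y])) ff c m a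
      (TrustedPlatform.prog Tinit) y tt)
  ppInt : ∀ {p i c m a d}, (pst p tt c m a d (TrustedPlatform.prog Tpp) tt).DestructorFree →
    K (pst p i c m a d (TrustedPlatform.prog Tpp) tt) →
    K (pst p tt c m a d (TrustedPlatform.prog Tpp) tt)
  ppEnd : ∀ {p i c m a d}, IsChain p →
    (pst p tt c m a d (TrustedPlatform.prog Tpp) tt).DestructorFree →
    K (pst p i c m a d (TrustedPlatform.prog Tpp) tt) →
    K (pst (h (tup ![p, bot])) tt c m a d (TrustedPlatform.prog Tpp) ff)
  unsealOs : ∀ {i c m a d e l}, nf b l ≠ tt → K (pst hchain i c m a d e l) → K (.name k₀)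
  unsealCh : ∀ {i c m a d e}, e.DestructorFree → K e →
    K (pst hchain i c m a d (TrustedPlatform.prog e) tt) → K (.name k₀)
  unsealPp : ∀ {i c m a d p' i' c' m' a' d'},
    (pst p' tt c' m' a' d' (TrustedPlatform.prog Tpp) tt).DestructorFree →
    K (pst hchain i c m a d (TrustedPlatform.prog Tpp) tt) →
    K (pst p' i' c' m' a' d' (TrustedPlatform.prog Tpp) tt) → K (.name m₀)

/-! ### The translation of states with a big register value -/

section Translation

variable (b : ℕ) (Big : Term → Prop)

open Classical in
/-- Big register values are replaced by `ps`. -/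
noncomputable def fixPcr (p : Term) : Term := if Big p then ps else p

open Classical in
/-- Lock values that become `true` by the translation are replaced by `false`. -/
noncomputable def fixLock (l : Term) : Term := if nf b l = tt ∧ l ≠ tt then ff else l

noncomputable def fixTpm : Term → Term
  | .app .tpm args => tpm (fixPcr Big (args 0))
  | T => T

noncomputable def fixDrt : Term → Term
  | .app .drt args => drt (args 0) (args 1) (fixLock b (args 2))
  | T => T

noncomputable def fixState : Term → Term
  | .app .state args => state (fixTpm Big (args 0)) (args 1) (args 2) (fixDrt b (args 3))
  | T => T

/-- Replace the big register values of all states in a term. -/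
noncomputable def trans : Term → Term
  | .var x => .var x
  | .name n => .name n
  | .app f args => fixState b Big (.app f fun i => trans (args i))

variable {b Big}

theorem trans_app {f : Sym} (hf : f ≠ .state) (args : Fin f.arity → Term) :
    trans b Big (.app f args) = .app f fun i => trans b Big (args i) := by
  rw [trans]
  cases f <;> first | rfl | exact absurd rfl hf

@[simp] theorem trans_name (n : Name) : trans b Big (.name n) = .name n := by rw [trans]

@[simp] theorem trans_pst (p i c m a d e l : Term) :
    trans b Big (pst p i c m a d e l) =
      pst (fixPcr Big (trans b Big p)) (trans b Big i) (trans b Big c) (trans b Big m)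
        (trans b Big a) (trans b Big d) (trans b Big e) (fixLock b (trans b Big l)) := by
  simp only [trans, comp_vecCons, comp_vecEmpty]
  rfl

theorem fixPcr_big {p : Term} (hp : Big p) : fixPcr Big p = ps := if_pos hp

theorem fixPcr_not_big {p : Term} (hp : ¬ Big p) : fixPcr Big p = p := if_neg hp

@[simp] theorem fixLock_tt : fixLock b tt = tt := if_neg (by simp)

@[simp] theorem fixLock_ff : fixLock b ff = ff := if_neg (by simp [Term.app.injEq])

/-- The reason for `fixLock`: a stuck decryption stored in the lock may become a redex when the
translation identifies two keys, and may then evaluate to `tt`. The translated state would unseal on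
a channel other than `os`, where the original one unseals. -/
theorem nf_fixLock_ne {l : Term} (hl : l ≠ tt) : nf b (fixLock b l) ≠ tt := by
  by_cases hn : nf b l = tt
  · rw [fixLock, if_pos ⟨hn, hl⟩]
    simp [Term.app.injEq]
  · rwa [fixLock, if_neg (by tauto)]

theorem fixLock_or (l : Term) : fixLock b l = ff ∨ fixLock b l = l := by
  unfold fixLock
  split_ifs <;> simp

/-- The translation preserves root symbols, so it creates no new syntactic `tt`. -/
theorem trans_eq_tt {l : Term} (hl : trans b Big l = tt) : l = tt := by
  cases l with
  | var x => simp [trans] at hl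
  | name n => simp at hl
  | app f args =>
    by_cases hf : f = .state
    · subst hf
      simp [trans, fixState, Term.app.injEq] at hl
    · rw [trans_app hf] at hl
      injection hl with e₁ e₂
      subst e₁
      congr
      funext i
      exact i.elim0

theorem trans_h_tup (x y : Term) :
    trans b Big (h (tup ![x, y])) = h (tup ![trans b Big x, trans b Big y]) := by
  rw [trans_app (by simp)]
  simp only [comp_vecCons, comp_vecEmpty]
  rw [trans_app (by simp)]
  simp only [comp_vecCons, comp_vecEmpty]

theorem IsChain.trans {p : Term} (hp : IsChain p) : IsChain (trans b Big p) := by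
  obtain ⟨v₀, l, hv, rfl⟩ := hp
  rw [map_chain trans_h_tup]
  refine ⟨_, _, ?_, rfl⟩
  rcases hv with rfl | rfl
  · left; rw [trans_app (by simp)]; simp only [comp_vecEmpty]
  · right; rw [trans_app (by simp)]; simp only [comp_vecEmpty]

theorem HasLength.trans {n : ℕ} {p : Term} (hp : HasLength n p) :
    HasLength n (trans b Big p) := by
  obtain ⟨T₀, l, hl, rfl⟩ := hp
  rw [map_chain trans_h_tup]
  exact ⟨_, _, by simpa using hl, rfl⟩

theorem fixState_destructorFree {T : Term} (hT : T.DestructorFree) :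
    (fixState b Big T).DestructorFree := by
  have h₁ : ∀ T : Term, T.DestructorFree → (fixTpm Big T).DestructorFree := by
    intro T hT
    unfold fixTpm
    split
    · rw [destructorFree_app] at hT
      have := hT.2 0
      unfold fixPcr
      split_ifs <;> simp_all [destructorFree_app, Sym.IsDestructor]
    · exact hT
  have h₂ : ∀ T : Term, T.DestructorFree → (fixDrt b T).DestructorFree := by
    intro T hT
    unfold fixDrt
    split
    · rename_i args
      rw [destructorFree_app] at hT
      have a₀ := hT.2 0
      have a₁ := hT.2 1
      have a₂ := hT.2 2
      rcases fixLock_or (b := b) (args 2) with e | e <;>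
        simp_all [destructorFree_app, forall_vecCons, Sym.IsDestructor]
    · exact hT
  unfold fixState
  split
  · rename_i args
    rw [destructorFree_app] at hT
    have a₀ := h₁ _ (hT.2 0)
    have a₁ := hT.2 1
    have a₂ := hT.2 2
    have a₃ := h₂ _ (hT.2 3)
    simp_all [destructorFree_app, forall_vecCons, Sym.IsDestructor]
  · exact hT

theorem trans_destructorFree {T : Term} (hT : T.DestructorFree) :
    (trans b Big T).DestructorFree := by
  induction T with
  | var x => simpa [trans] using hT
  | name n => simpa using hT
  | app f args ih =>
    rw [destructorFree_app] at hT
    rw [trans]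
    exact fixState_destructorFree (destructorFree_app.2 ⟨hT.1, fun i => ih i (hT.2 i)⟩)

end Translation

section Translation

variable {b : ℕ} {Big : Term → Prop}

@[simp] theorem trans_ps : trans b Big ps = ps :=
  (trans_app (by simp) _).trans (by simp only [comp_vecEmpty])

@[simp] theorem trans_pd : trans b Big pd = pd :=
  (trans_app (by simp) _).trans (by simp only [comp_vecEmpty])

@[simp] theorem trans_tt : trans b Big tt = tt :=
  (trans_app (by simp) _).trans (by simp only [comp_vecEmpty])

@[simp] theorem trans_ff : trans b Big ff = ff :=
  (trans_app (by simp) _).trans (by simp only [comp_vecEmpty])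

@[simp] theorem trans_bot : trans b Big bot = bot :=
  (trans_app (by simp) _).trans (by simp only [comp_vecEmpty])

@[simp] theorem trans_entry (k : ℕ) : trans b Big (entryPoint k) = entryPoint k :=
  (trans_app (by simp) _).trans (by simp only [comp_vecEmpty])

@[simp] theorem trans_prog (x : Term) : trans b Big (prog x) = prog (trans b Big x) :=
  (trans_app (by simp) _).trans (by simp only [comp_vecCons, comp_vecEmpty])

@[simp] theorem trans_h (x : Term) : trans b Big (h x) = h (trans b Big x) :=
  (trans_app (by simp) _).trans (by simp only [comp_vecCons, comp_vecEmpty])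

@[simp] theorem trans_tpmCh (x : Term) : trans b Big (tpmCh x) = tpmCh (trans b Big x) :=
  (trans_app (by simp) _).trans (by simp only [comp_vecCons, comp_vecEmpty])

@[simp] theorem trans_senc (x y : Term) :
    trans b Big (senc x y) = senc (trans b Big x) (trans b Big y) :=
  (trans_app (by simp) _).trans (by simp only [comp_vecCons, comp_vecEmpty])

@[simp] theorem trans_sealD (x y : Term) :
    trans b Big (sealD x y) = sealD (trans b Big x) (trans b Big y) :=
  (trans_app (by simp) _).trans (by simp only [comp_vecCons, comp_vecEmpty])

@[simp] theorem trans_tup {n : ℕ} (args : Fin n → Term) :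
    trans b Big (tup args) = tup fun i => trans b Big (args i) :=
  trans_app (by simp) _

/-- The register value guarding the key contains no state. -/
theorem trans_hchain : trans b Big hchain = hchain := by
  simp only [hchain, trans_h, trans_tup, trans_prog, trans_entry, trans_pd, comp_vecCons,
    comp_vecEmpty]

end Translation

theorem forall_vec₁ {p : Term → Prop} {x : Term} (hx : p x) : ∀ i : Fin 1, p (![x] i) := by
  simpa [forall_vecCons] using hx

theorem forall_vec₂ {p : Term → Prop} {x y : Term} (hx : p x) (hy : p y) :
    ∀ i : Fin 2, p (![x, y] i) := by
  simpa [forall_vecCons] using ⟨hx, hy⟩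

theorem forall_vec₃ {p : Term → Prop} {x y z : Term} (hx : p x) (hy : p y) (hz : p z) :
    ∀ i : Fin 3, p (![x, y, z] i) := by
  simpa [forall_vecCons] using ⟨hx, hy, hz⟩

/-! ### Terms that the attacker may know -/

section Known

variable (b : ℕ) (Big : Term → Prop) (K : Term → Prop) (k₀ m₀ : Name)

/-- The terms, in normal form, that the attacker may know, given the set `K` of terms that can be
obtained by other means. -/
inductive Known : Term → Prop
  | name (n : Name) : K (.name n) → Known (.name n)
  | app (f : Sym) (args : Fin f.arity → Term) : ¬ f.IsPrivate → (∀ i, Known (args i)) →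
      Known (.app f args)
  | prog (k : ℕ) : k < 3 → Known (prog (entryPoint k))
  | senc : Known (senc (.name m₀) (.name k₀))
  | sealD : Known (sealD (.name k₀) hchain)
  | tpmCh (e : Term) : e.DestructorFree → Known e → Known (tpmCh (TrustedPlatform.prog e))
  | state (p i c m a d e l : Term) : Known p → Known i → Known c → Known m → Known a → Known d →
      Known e → Known l → p.DestructorFree → Big p ∨ IsChain p →
      K (trans b Big (pst p i c m a d e l)) → Known (pst p i c m a d e l)

variable {b Big K k₀ m₀}

local notation "Kn" => Known b Big K k₀ m₀

theorem known_tup {n : ℕ} {args : Fin n → Term} : Kn (tup args) ↔ ∀ i, Kn (args i) := by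
  constructor
  · intro hk
    generalize hT : tup args = T at hk
    cases hk <;> simp [Term.app.injEq] at hT
    case app f args' hf ha =>
      obtain ⟨rfl, e⟩ := hT
      cases e
      exact ha
  · exact Known.app (.tup n) args (by simp [Sym.IsPrivate])

/-- The published ciphertext is the only known one whose components need not be known. The next
lemmas single out in the same way the sealed key, the trusted programs, and the channels granted to
programs. -/
theorem Known.senc_inv {x k : Term} (hk : Kn (TrustedPlatform.senc x k)) :
    (x = .name m₀ ∧ k = .name k₀) ∨ (Kn x ∧ Kn k) := by
  generalize hT : TrustedPlatform.senc x k = T at hk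
  cases hk <;> simp [Term.app.injEq] at hT
  case app f args' hf ha =>
    obtain ⟨rfl, e⟩ := hT
    cases e
    exact Or.inr ⟨ha 0, ha 1⟩
  case senc => exact Or.inl hT

theorem Known.sealD_inv {x k : Term} (hk : Kn (TrustedPlatform.sealD x k)) :
    (x = .name k₀ ∧ k = hchain) ∨ (Kn x ∧ Kn k) := by
  generalize hT : TrustedPlatform.sealD x k = T at hk
  cases hk <;> simp [Term.app.injEq] at hT
  case app f args' hf ha =>
    obtain ⟨rfl, e⟩ := hT
    cases e
    exact Or.inr ⟨ha 0, ha 1⟩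
  case sealD => exact Or.inl hT

theorem Known.prog_inv {e : Term} (hk : Kn (TrustedPlatform.prog e)) :
    (∃ k < 3, e = entryPoint k) ∨ Kn e := by
  generalize hT : TrustedPlatform.prog e = T at hk
  cases hk <;> simp [Term.app.injEq] at hT
  case app f args' hf ha =>
    obtain ⟨rfl, e⟩ := hT
    cases e
    exact Or.inr (ha 0)
  case prog k hk => exact Or.inl ⟨k, hk, hT⟩

theorem Known.tpmCh_inv {x : Term} (hk : Kn (TrustedPlatform.tpmCh x)) :
    ∃ e, x = TrustedPlatform.prog e ∧ e.DestructorFree ∧ Kn e := by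
  generalize hT : TrustedPlatform.tpmCh x = T at hk
  cases hk <;> simp [Term.app.injEq] at hT
  case app f args' hf ha =>
    obtain ⟨rfl, e⟩ := hT
    simp [Sym.IsPrivate] at hf
  case tpmCh e he hk => exact ⟨e, hT, he, hk⟩

/-- No clause of `Known` other than public application ends in a symbol without arguments; this
keeps the access keys, the hidden channel and the entry points secret. -/
theorem not_known_constant {f : Sym} {args : Fin f.arity → Term} (hf : f.IsPrivate)
    (ha : f.arity = 0) : ¬ Kn (.app f args) := by
  intro hk
  generalize hT : Term.app f args = T at hk
  cases hk with
  | name => cases hT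
  | app g args' hg _ => injection hT with e₁; exact hg (e₁ ▸ hf)
  | _ => injection hT with e₁; rw [e₁] at ha; cases ha

theorem known_h {x : Term} (hx : Kn x) : Kn (h x) :=
  .app .h _ (by simp [Sym.IsPrivate]) (by simpa [forall_vecCons] using hx)

theorem known_constant {f : Sym} (hf : ¬ f.IsPrivate) (ha : f.arity = 0)
    (args : Fin f.arity → Term) : Kn (.app f args) :=
  .app f args hf fun i => absurd i.isLt (by omega)

variable (b Big K k₀ m₀) in
/-- The properties of a known state. -/
structure KnownState (p i c m a d e l : Term) : Prop where
  pcr : Kn p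
  int : Kn i
  cache : Kn c
  stm : Kn m
  smi : Kn a
  init : Kn d
  pp : Kn e
  lock : Kn l
  pcrFree : p.DestructorFree
  pcrForm : Big p ∨ IsChain p
  obtainable : K (trans b Big (pst p i c m a d e l))

theorem KnownState.known {p i c m a d e l : Term}
    (hs : KnownState b Big K k₀ m₀ p i c m a d e l) : Kn (pst p i c m a d e l) :=
  .state _ _ _ _ _ _ _ _ hs.pcr hs.int hs.cache hs.stm hs.smi hs.init hs.pp hs.lock hs.pcrFree
    hs.pcrForm hs.obtainable

theorem Known.state_inv {t x y z : Term} (hk : Kn (TrustedPlatform.state t x y z)) :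
    ∃ p i c m a d e l, t = tpm p ∧ x = cpu i c ∧ y = smram m a ∧ z = drt d e l ∧
      KnownState b Big K k₀ m₀ p i c m a d e l := by
  generalize hT : TrustedPlatform.state t x y z = T at hk
  cases hk <;> simp [Term.app.injEq] at hT
  case app f args' hf ha =>
    obtain ⟨rfl, e⟩ := hT
    simp [Sym.IsPrivate] at hf
  case state p i c m a d e l h₁ h₂ h₃ h₄ h₅ h₆ h₇ h₈ h₉ h₁₀ h₁₁ =>
    obtain ⟨rfl, rfl, rfl, rfl⟩ := hT
    exact ⟨p, i, c, m, a, d, e, l, rfl, rfl, rfl, rfl,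
      h₁, h₂, h₃, h₄, h₅, h₆, h₇, h₈, h₉, h₁₀, h₁₁⟩

theorem known_pst {p i c m a d e l : Term} :
    Kn (pst p i c m a d e l) ↔ KnownState b Big K k₀ m₀ p i c m a d e l := by
  refine ⟨fun hk => ?_, KnownState.known⟩
  obtain ⟨p, i, c, m, a, d, e, l, h₁, h₂, h₃, h₄, hs⟩ := hk.state_inv
  simp [Term.app.injEq] at h₁ h₂ h₃ h₄
  obtain ⟨⟨rfl, rfl⟩, ⟨rfl, rfl⟩, rfl, rfl, rfl⟩ := And.intro h₂ (And.intro h₃ h₄)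
  subst h₁
  exact hs

/-- Known terms can be obtained, up to the translation. -/
theorem Known.obtainable (hK : Obtainable b K k₀ m₀) {T : Term} (hT : Kn T) :
    K (trans b Big T) := by
  induction hT with
  | name n hn => simpa using hn
  | app f args hf ha ih =>
    rw [trans_app (by rintro rfl; simp [Sym.IsPrivate] at hf)]
    exact hK.app f _ hf ih
  | prog k hk => simpa using hK.prog k hk
  | senc => simpa using hK.senc
  | sealD => simpa [trans_hchain] using hK.sealD
  | tpmCh e he _ ih => simpa using hK.tpmCh (trans_destructorFree he) ih
  | state => assumption

/-- Closure under public symbols and under equality modulo the theory gives closure under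
contraction. -/
theorem Obtainable.app₁ (hK : Obtainable b K k₀ m₀) {f : Sym} (hf : ¬ f.IsPrivate)
    {args : Fin f.arity → Term} {V : Term} (ha : ∀ i, K (args i))
    (hr : Rule b (.app f args) V) : K V :=
  hK.congr hr.nf_eq (hK.app f args hf ha)

/-- The corrected lock is the given value or the public constant `ff`, so it can be written wherever
the given value can. -/
theorem fixLock_obtainable (hK : Obtainable b K k₀ m₀) {l : Term} (hl : K l) :
    K (fixLock b l) := by
  rcases fixLock_or (b := b) l with e | e <;> rw [e]
  · exact hK.app .ff _ (by simp [Sym.IsPrivate]) fun i => i.elim0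
  · exact hl

/-- Contracting a public redex with known arguments yields a known term. -/
theorem Known.contract (hK : Obtainable b K k₀ m₀) {f : Sym} {args : Fin f.arity → Term}
    {V : Term} (hf : ¬ f.IsPrivate) (ha : ∀ i, Kn (args i)) (hr : Rule b (.app f args) V) :
    Kn V := by
  have ob := fun T (hT : Kn T) => hT.obtainable hK
  generalize hU : Term.app f args = U at hr
  cases hr <;> cases hU
  case proj.refl args i => exact known_tup.1 (ha 0) i
  case unsealD.refl | getEntry.refl | setPcr.refl | isSmall.refl | isBig.refl =>
    simp [Sym.IsPrivate] at hf
  all_goals simp only [forall_vecCons] at ha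
  -- These rules require `tpmAcc` or `cpuAcc`, which are not known.
  case resetPs.refl | resetPd.refl | extend.refl | setIntCpu.refl | setInit.refl | setPpCpu.refl
      | setLockCpu.refl =>
    exact absurd ha.2.1 (not_known_constant (by simp [Sym.IsPrivate]) rfl)
  case sdec.refl =>
    -- If the ciphertext is the published one, the decryption key is `k₀` itself; being known, it is
    -- obtainable, and the message is obtained by decrypting in `K`.
    rcases ha.1.senc_inv with ⟨rfl, rfl⟩ | h₁
    · exact .name _ (hK.app₁ (f := .sdec) hf
        (forall_vec₂ hK.senc (by simpa using ob _ ha.2.1)) (.sdec _ _))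
    · exact h₁.1
  -- The remaining redexes act on a known state. Its translation has the same shape, and `fixLock`
  -- fixes `tt` and `ff`, so the same rule applies to the translated state in `K`.
  all_goals
    obtain ⟨p, i, c, m, a, d, e, l, h₁, h₂, h₃, h₄, hs⟩ := ha.1.state_inv
    simp only [Term.app.injEq, heq_eq_eq, true_and, Matrix.vecCons_inj, and_true] at h₁ h₂ h₃ h₄
    obtain ⟨rfl, rfl⟩ := h₂
    obtain ⟨rfl, rfl⟩ := h₃
    obtain ⟨rfl, rfl, rfl⟩ := h₄
    subst h₁
    have hp := hs.obtainable
    simp only [trans_pst, trans_tt, trans_ff, trans_prog, fixLock_tt, fixLock_ff] at hp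
  case pcr.refl => exact hs.pcr
  case int.refl => exact hs.int
  case getCache.refl => exact hs.cache
  case stm.refl => exact hs.stm
  case smi.refl => exact hs.smi
  case init.refl => exact hs.init
  case pp.refl => exact hs.pp
  case lock.refl => exact hs.lock
  case setIntPp.refl =>
    refine KnownState.known { hs with int := ha.2.2.1, obtainable := ?_ }
    simp only [trans_pst, trans_tt, trans_ff, trans_prog, fixLock_tt, fixLock_ff]
    exact hK.app₁ (f := .setInt) hf
      (forall_vec₃ hp (ob _ ha.2.1) (ob _ ha.2.2.1)) (.setIntPp _ _ _ _ _ _ _)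
  case cache.refl =>
    refine KnownState.known { hs with cache := ha.2.1, obtainable := ?_ }
    simp only [trans_pst, trans_tt, trans_ff, trans_prog, fixLock_tt, fixLock_ff]
    exact hK.app₁ (f := .cache) hf
      (forall_vec₂ hp (ob _ ha.2.1)) (.cache _ _ _ _ _ _)
  case flushStm.refl =>
    refine KnownState.known { hs with stm := hs.cache, obtainable := ?_ }
    simp only [trans_pst, trans_tt, trans_ff, trans_prog, fixLock_tt, fixLock_ff]
    exact hK.app₁ (f := .flushStm) hf
      (forall_vec₁ hp) (.flushStm _ _ _ _ _ _ _)
  case flushSmi.refl =>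
    refine KnownState.known { hs with smi := hs.cache, obtainable := ?_ }
    simp only [trans_pst, trans_tt, trans_ff, trans_prog, fixLock_tt, fixLock_ff]
    exact hK.app₁ (f := .flushSmi) hf
      (forall_vec₁ hp) (.flushSmi _ _ _ _ _ _)
  case setPpInit.refl =>
    refine KnownState.known { hs with pp := ha.2.2.1, obtainable := ?_ }
    simp only [trans_pst, trans_tt, trans_ff, trans_prog, fixLock_tt, fixLock_ff]
    exact hK.app₁ (f := .setPp) hf
      (forall_vec₃ hp (ob _ ha.2.1) (ob _ ha.2.2.1)) (.setPpInit _ _ _ _ _ _ _)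
  case setPpSmi.refl =>
    refine KnownState.known { hs with pp := ha.2.2.1, obtainable := ?_ }
    simp only [trans_pst, trans_tt, trans_ff, trans_prog, fixLock_tt, fixLock_ff]
    exact hK.app₁ (f := .setPp) hf
      (forall_vec₃ hp (by simpa only [trans_tup, comp_vecCons, comp_vecEmpty] using ob _ ha.2.1) (ob _ ha.2.2.1)) (.setPpSmi _ _ _ _ _ _ _ _)
  -- The lock of the new state is corrected by the translation, so in `K` the corrected value is
  -- written.
  case setLockPp.refl =>
    refine KnownState.known { hs with lock := ha.2.2.1, obtainable := ?_ }
    simp only [trans_pst, trans_tt, trans_ff, trans_prog, fixLock_tt, fixLock_ff]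
    exact hK.app₁ (f := .setLock) hf
      (forall_vec₃ hp (ob _ ha.2.1) (fixLock_obtainable hK (ob _ ha.2.2.1))) (.setLockPp _ _ _ _ _ _ _)
  case setLockSmi.refl =>
    refine KnownState.known { hs with lock := ha.2.2.1, obtainable := ?_ }
    simp only [trans_pst, trans_tt, trans_ff, trans_prog, fixLock_tt, fixLock_ff]
    exact hK.app₁ (f := .setLock) hf
      (forall_vec₃ hp (by simpa only [trans_tup, comp_vecCons, comp_vecEmpty] using ob _ ha.2.1) (fixLock_obtainable hK (ob _ ha.2.2.1))) (.setLockSmi _ _ _ _ _ _ _ _)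

end Known

/-! ### The typing of the platform -/

section PlatformTyping

variable (b : ℕ) (Big : Term → Prop) (K : Term → Prop) (k₀ m₀ : Name)

local notation "Kn" => Known b Big K k₀ m₀

/-- An entry point of a trusted program. -/
def IsEntry (e : Term) : Prop := ∃ k < 3, e = entryPoint k

/-- The state that the CPU hands over to the trusted `INIT` program. -/
def IsLaunched (s : Term) : Prop :=
  ∃ p i c m a d e, Kn (pst p i c m a d e ff) ∧ (pst p ff c m a d e ff).DestructorFree ∧
    s = pst (h (tup ![pd, tup ![h (prog Tinit), h m]])) ff c m a (prog Tinit) e tt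

/-- The messages that are sent on the channels hidden from the attacker. In a world, the name that
identifies a request for extension of the register is mapped to the rest of the state and to the new
value of the register. -/
inductive Secret (W : World) : Term → Term → Prop
  | resetReq (n : Name) (p x₁ x₂ x₃ q : Term) : W n = some (x₁, x₂, x₃, q) →
      Secret W cpuTpm (tup ![resetReq, .name n, state (tpm p) x₁ x₂ x₃])
  | resetResp (n : Name) (x₁ x₂ x₃ q : Term) : W n = some (x₁, x₂, x₃, q) →
      Secret W cpuTpm (tup ![resetResp, .name n, state (tpm pd) x₁ x₂ x₃])
  | extendReq (U : Term) (n : Name) (x₁ x₂ x₃ p v : Term) :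
      U = cpuTpm ∨ U = tpmCh (prog Tinit) → p = pd ∨ (∃ w, p = h (tup ![pd, w])) →
      W n = some (x₁, x₂, x₃, h (tup ![p, v])) →
      Secret W U (tup ![extendReq, .name n, state (tpm p) x₁ x₂ x₃, v])
  | extendResp (U : Term) (n : Name) (x₁ x₂ x₃ q : Term) :
      U = cpuTpm ∨ U = tpmCh (prog Tinit) → W n = some (x₁, x₂, x₃, q) →
      Secret W U (tup ![extendResp, .name n, state (tpm q) x₁ x₂ x₃])
  | extChannel (e : Term) : IsEntry e ∨ Kn e ∧ e.DestructorFree →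
      Secret W cpuTpm (tup ![extChannel, tpmCh (prog e)])
  | launch (e n s c y : Term) : IsEntry e →
      (e = Tinit → IsLaunched b Big K k₀ m₀ s ∧ c = tpmCh (prog Tinit) ∧ Kn y) →
      Secret W e (tup ![n, s, c, y])
  | drtResp (e n s : Term) : IsEntry e → Kn s → Secret W e (tup ![drtResp, n, s])
  | run (e s c : Term) : IsEntry e → (e = Tpp → Kn s ∧ c = tpmCh (prog Tpp)) →
      Secret W e (tup ![s, c])
  | ppExtendReq (n p c m a d : Term) : Kn (pst p tt c m a d (prog Tpp) tt) →
      (pst p tt c m a d (prog Tpp) tt).DestructorFree →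
      Secret W (tpmCh (prog Tpp)) (tup ![extendReq, n, pst p tt c m a d (prog Tpp) tt, bot])
  | ppExtendResp (n p c m a d : Term) : Kn (pst p tt c m a d (prog Tpp) ff) →
      Secret W (tpmCh (prog Tpp)) (tup ![extendResp, n, pst p tt c m a d (prog Tpp) tt])
  | unsealTag (x : Term) : Kn x → Secret W (tpmCh (prog Tpp)) (tup ![unsealTag, x])
  | plainTag (x : Term) :
      Kn x ∨ x = .name k₀ ∧ (∃ i c m a d, Kn (pst hchain i c m a d (prog Tpp) tt)) →
      Secret W (tpmCh (prog Tpp)) (tup ![plainTag, x])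

/-- The typing of the platform. -/
def platformTyping : Typing where
  known := Kn
  allowed W U T := Kn U ∧ Kn T ∨ Secret b Big K k₀ m₀ W U T
  fresh n := (n.base = .kpp → n = k₀) ∧ (n.base = .hipp → n = m₀) ∧ (n.base = .nonce → K (.name n))
  evaluable T := ∀ s v, T = setPcr s tpmAcc v → HasLength (b + 1) (nf b v)

variable {b Big K k₀ m₀}

theorem not_known_entry (k : ℕ) : ¬ Kn (entryPoint k) :=
  not_known_constant (by simp [Sym.IsPrivate]) rfl

theorem not_known_cpuTpm : ¬ Kn cpuTpm :=
  not_known_constant (by simp [Sym.IsPrivate]) rfl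

theorem not_known_tpmCh (k : ℕ) : ¬ Kn (tpmCh (prog (entryPoint k))) := by
  intro hk
  obtain ⟨e, h₁, -, h₂⟩ := hk.tpmCh_inv
  simp [Term.app.injEq] at h₁
  exact not_known_entry k (h₁ ▸ h₂)

/-- Hidden messages travel only on `cpuTpm`, on entry points of trusted programs and on the module
channels of `Tinit` and `Tpp`. -/
theorem Secret.not_known {W : World} {U T : Term} (hs : Secret b Big K k₀ m₀ W U T) : ¬ Kn U := by
  have h₁ : ∀ {e}, IsEntry e → ¬ Kn e := by
    rintro _ ⟨k, -, rfl⟩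
    exact not_known_entry k
  have h₂ : ∀ {U}, U = cpuTpm ∨ U = tpmCh (prog Tinit) → ¬ Kn U := by
    rintro _ (rfl | rfl)
    · exact not_known_cpuTpm
    · exact not_known_tpmCh 0
  cases hs
  case resetReq | resetResp | extChannel => exact not_known_cpuTpm
  case extendReq => exact h₂ ‹_›
  case extendResp => exact h₂ ‹_›
  case launch => exact h₁ ‹_›
  case drtResp => exact h₁ ‹_›
  case run => exact h₁ ‹_›
  all_goals exact not_known_tpmCh 2

theorem Secret.mono {W W' : World} (hW : Typing.Le W W') {U T : Term}
    (hs : Secret b Big K k₀ m₀ W U T) : Secret b Big K k₀ m₀ W' U T := by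
  cases hs
  case resetReq hn => exact .resetReq _ _ _ _ _ _ (hW _ _ hn)
  case resetResp hn => exact .resetResp _ _ _ _ _ (hW _ _ hn)
  case extendReq => exact .extendReq _ _ _ _ _ _ _ ‹_› ‹_› (hW _ _ ‹_›)
  case extendResp => exact .extendResp _ _ _ _ _ _ ‹_› (hW _ _ ‹_›)
  case extChannel he => exact .extChannel _ he
  case launch => exact .launch _ _ _ _ _ ‹_› ‹_›
  case drtResp => exact .drtResp _ _ _ ‹_› ‹_›
  case run => exact .run _ _ _ ‹_› ‹_›
  case ppExtendReq h₁ h₂ => exact .ppExtendReq _ _ _ _ _ _ h₁ h₂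
  case ppExtendResp h₁ => exact .ppExtendResp _ _ _ _ _ _ h₁
  case unsealTag hx => exact .unsealTag _ hx
  case plainTag hx => exact .plainTag _ hx

/-- Normalization is innermost, so only a contraction at the root is at stake, and `Known.contract`
treats it. -/
theorem known_nf_app (hK : Obtainable b K k₀ m₀) {f : Sym} {args : Fin f.arity → Term}
    (hf : ¬ f.IsPrivate) (ha : ∀ i, Kn (nf b (args i))) : Kn (nf b (.app f args)) := by
  rw [nf]
  by_cases hr : ∃ V, Rule b (.app f fun i => nf b (args i)) V
  · obtain ⟨V, hV⟩ := hr
    rw [hV.contract_eq]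
    exact Known.contract hK hf ha hV
  · rw [contract_of_not_rule (by simpa using hr)]
    exact .app f _ hf ha

/-- Deduction is covered by `known_nf_app`; no secret leaks because its channel is not known. -/
theorem platformTyping_sound (hK : Obtainable b K k₀ m₀) :
    (platformTyping b Big K k₀ m₀).Sound b where
  deduce M T hM hT := by
    induction hT with
    | known hT' he => exact eqE_iff.1 he ▸ hM _ hT'
    | apply f args hf _ he ih => exact eqE_iff.1 he ▸ known_nf_app hK hf ih
  leak W U T hT hU := hT.elim And.right fun hs => absurd hU hs.not_known
  mono W W' U T hW hT := hT.imp id (Secret.mono hW)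

theorem known_nf_subst (hK : Obtainable b K k₀ m₀) {T : Term} {ρ : Ident → Term}
    (hs : ∀ f ∈ T.syms, ¬ f.IsPrivate) (hn : ∀ n ∈ T.names, n.base ∉ platformNames)
    (hρ : ∀ x ∈ T.vars, Kn (ρ x) ∧ nf b (ρ x) = ρ x) : Kn (nf b (T.subst ρ)) := by
  induction T with
  | var x =>
    obtain ⟨h₁, h₂⟩ := hρ x rfl
    rwa [Term.subst, h₂]
  | name n =>
    rw [Term.subst, nf_name]
    exact .name n (hK.name n (hn n rfl))
  | app f args ih =>
    refine known_nf_app hK (hs f (Or.inl rfl)) fun i => ih i (fun g hg => ?_) (fun n hn' => ?_)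
      fun x hx => ?_
    · exact hs g (Or.inr (Set.mem_iUnion.2 ⟨i, hg⟩))
    · exact hn n (Set.mem_iUnion.2 ⟨i, hn'⟩)
    · exact hρ x (Set.mem_iUnion.2 ⟨i, hx⟩)

theorem known_of_inst {A : Pat} {σ : Ident → Term} (hk : Kn (nf b (A.inst σ)))
    (hσ : ∀ x ∈ A.binders, nf b (σ x) = σ x) : ∀ x ∈ A.binders, Kn (σ x) := by
  induction A with
  | var x =>
    intro y hy
    simp only [Pat.binders, Finset.mem_singleton] at hy hσ
    subst hy
    rwa [Pat.inst, hσ y rfl] at hk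
  | eq T => simp [Pat.binders]
  | tup n ps ih =>
    simp only [Pat.binders, Finset.mem_biUnion, Finset.mem_univ, true_and,
      forall_exists_index] at hσ ⊢
    intro x i hx
    rw [Pat.inst, nf_tup, known_tup] at hk
    exact ih i (hk i) (fun y hy => hσ y i hy) x hx

/-- The symbol `setPcr` is private and heads no known term, so the constraint on evaluated terms is
vacuous for an attacker. -/
theorem term_subst_ne_setPcr {T s v : Term} {ρ : Ident → Term}
    (hs : ∀ f ∈ T.syms, ¬ f.IsPrivate) (hρ : ∀ x ∈ T.vars, Kn (ρ x)) :
    T.subst ρ ≠ setPcr s tpmAcc v := by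
  intro e
  cases T with
  | var x =>
    have hk := hρ x rfl
    rw [Term.subst] at e
    rw [e] at hk
    generalize hT : setPcr s tpmAcc v = T at hk
    cases hk <;> simp [Term.app.injEq] at hT
    case app f args hf _ =>
      obtain ⟨rfl, _⟩ := hT
      simp [Sym.IsPrivate] at hf
  | name n => simp [Term.subst] at e
  | app f args =>
    rw [Term.subst] at e
    injection e with e₁ e₂
    subst e₁
    exact hs _ (Or.inl rfl) (by simp [Sym.IsPrivate])

/-- A process over public symbols is well typed. -/
theorem ok_of_public (hK : Obtainable b K k₀ m₀) {Q : Proc} {W : World} {ρ : Ident → Term}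
    (hs : ∀ f ∈ Q.syms, ¬ f.IsPrivate) (hn : ∀ n ∈ Q.names, n.base ∉ platformNames)
    (hr : ∀ n ∈ Q.restricted, n ∉ platformNames)
    (hρ : ∀ x ∈ Q.freeVars, Kn (ρ x) ∧ nf b (ρ x) = ρ x) :
    (platformTyping b Big K k₀ m₀).Ok b Q W ρ := by
  have nfk : ∀ (P : Proc) (ρ : Ident → Term) (T : Term), (∀ f ∈ P.syms, ¬ f.IsPrivate) →
      (∀ n ∈ P.names, n.base ∉ platformNames) → T ∈ P.terms →
      (∀ x ∈ T.vars, Kn (ρ x) ∧ nf b (ρ x) = ρ x) → Kn (nf b (T.subst ρ)) := by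
    intro P ρ T hs hn hT hρ
    exact known_nf_subst hK (fun f hf => hs f (Set.mem_biUnion hT hf))
      (fun n hn' => hn n (Set.mem_biUnion hT hn')) hρ
  have sub : ∀ {P P' : Proc}, P'.terms ⊆ P.terms → P'.syms ⊆ P.syms ∧ P'.names ⊆ P.names :=
    fun h => ⟨Set.biUnion_mono h fun _ _ => subset_rfl, Set.biUnion_mono h fun _ _ => subset_rfl⟩
  induction Q generalizing W ρ with
  | nil => trivial
  | par P Q ihP ihQ =>
    have s₁ := sub (P := .par P Q) (P' := P) Set.subset_union_left
    have s₂ := sub (P := .par P Q) (P' := Q) Set.subset_union_right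
    exact ⟨ihP (fun f hf => hs f (s₁.1 hf)) (fun f hf => hn f (s₁.2 hf))
        (fun n h => hr n (Or.inl h)) fun x hx => hρ x (Or.inl hx),
      ihQ (fun f hf => hs f (s₂.1 hf)) (fun f hf => hn f (s₂.2 hf))
        (fun n h => hr n (Or.inr h)) fun x hx => hρ x (Or.inr hx)⟩
  | repl P ih => exact ih hs hn hr hρ
  | new n P ih =>
    intro W' i _ _ _
    -- Names of the attacker identify no pending request and carry no data.
    refine ⟨none, ih hs hn (fun m h => hr m (Or.inr h)) fun x hx => ?_⟩
    by_cases hxn : x = n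
    · subst hxn
      simp only [Function.update_self, nf_name, and_true]
      exact .name _ (hK.name _ (hr x (Or.inl rfl)))
    · simpa [hxn] using hρ x ⟨hx, hxn⟩
  | inp U A P ih =>
    intro W' σ _ hall hσ
    have s₁ := sub (P := .inp U A P) (P' := P) Set.subset_union_right
    have hU : Kn (nf b (U.subst ρ)) := nfk (.inp U A P) ρ U hs hn (Or.inl (Or.inl rfl))
      fun x hx => hρ x (Or.inl (Or.inl hx))
    have hT := (platformTyping_sound hK).leak _ _ _ hall hU
    refine ih (fun f hf => hs f (s₁.1 hf)) (fun f hf => hn f (s₁.2 hf)) hr fun x hx => ?_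
    by_cases hxA : x ∈ A.binders
    · simp only [hxA, if_true]
      refine ⟨?_, hσ x hxA⟩
      refine known_of_inst (A := A.subst ρ) hT ?_ x ?_ <;> rwa [A.binders_subst]
    · simpa [hxA] using hρ x (Or.inr ⟨hx, hxA⟩)
  | out U T P ih =>
    have s₁ := sub (P := .out U T P) (P' := P) Set.subset_union_right
    refine ⟨Or.inl ⟨?_, ?_⟩, ih (fun f hf => hs f (s₁.1 hf)) (fun f hf => hn f (s₁.2 hf)) hr
      fun x hx => hρ x (Or.inr hx)⟩
    · exact nfk (.out U T P) ρ U hs hn (Or.inl (Or.inl rfl)) fun x hx => hρ x (Or.inl (Or.inl hx))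
    · exact nfk (.out U T P) ρ T hs hn (Or.inl (Or.inr rfl)) fun x hx => hρ x (Or.inl (Or.inr hx))
  | ite U V P Q ihP ihQ =>
    have s₁ := sub (P := .ite U V P Q) (P' := P) fun x hx => Or.inl (Or.inr hx)
    have s₂ := sub (P := .ite U V P Q) (P' := Q) fun x hx => Or.inr hx
    exact ⟨fun _ => ihP (fun f hf => hs f (s₁.1 hf)) (fun f hf => hn f (s₁.2 hf))
        (fun n h => hr n (Or.inl h)) fun x hx => hρ x (Or.inl (Or.inr hx)),
      fun _ => ihQ (fun f hf => hs f (s₂.1 hf)) (fun f hf => hn f (s₂.2 hf))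
        (fun n h => hr n (Or.inr h)) fun x hx => hρ x (Or.inr hx)⟩
  | letIn y T P ih =>
    have s₁ := sub (P := .letIn y T P) (P' := P) Set.subset_union_right
    have hT : Kn (nf b (T.subst ρ)) := nfk (.letIn y T P) ρ T hs hn (Or.inl rfl)
      fun x hx => hρ x (Or.inl hx)
    refine ⟨fun s v e => absurd e (term_subst_ne_setPcr
      (fun f hf => hs f (Set.mem_biUnion (Or.inl rfl : T ∈ (Proc.letIn y T P).terms) hf))
      fun x hx => (hρ x (Or.inl hx)).1), ?_⟩
    rintro V rfl _
    refine ih (fun f hf => hs f (s₁.1 hf)) (fun f hf => hn f (s₁.2 hf)) hr fun x hx => ?_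
    by_cases hxy : x = y
    · subst hxy
      simpa [nf_nf] using hT
    · simpa [hxy] using hρ x (Or.inr ⟨hx, hxy⟩)

end PlatformTyping

/-! ### Inversion of evaluations -/

/-- A `let` proceeds only with a destructor-free value. A destructor at the root must therefore have
been contracted, and inverting that rule gives the shape of the arguments. -/
theorem Rule.of_nf_eq {b : ℕ} {f : Sym} {args : Fin f.arity → Term} {V : Term}
    (he : nf b (.app f args) = V) (hV : V.DestructorFree) (hf : f.IsDestructor)
    (ha : ∀ i, nf b (args i) = args i) : Rule b (.app f args) V := by
  subst he
  rw [nf, show (fun i => nf b (args i)) = args from funext ha] at hV ⊢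
  by_cases hr : ∃ V, Rule b (.app f args) V
  · obtain ⟨V, hr⟩ := hr
    rwa [hr.contract_eq]
  · rw [contract_of_not_rule (by simpa using hr), destructorFree_app] at hV
    exact absurd hf hV.1

theorem mem_binders_cons {n : ℕ} {A : Pat} {ps : Fin n → Pat} {x : Ident} :
    x ∈ (Pat.tup n.succ (Matrix.vecCons A ps)).binders ↔
      x ∈ A.binders ∨ x ∈ (Pat.tup n ps).binders := by
  simp only [Pat.binders, Finset.mem_biUnion, Finset.mem_univ, true_and]
  exact Fin.exists_fin_succ

theorem mem_binders_nil {ps : Fin 0 → Pat} {x : Ident} : x ∈ (Pat.tup 0 ps).binders ↔ False := by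
  simp [Pat.binders]

theorem mem_binders_var {x y : Ident} : x ∈ (Pat.var y).binders ↔ x = y := by
  simp [Pat.binders]

theorem mem_binders_eq {x : Ident} {T : Term} : x ∈ (Pat.eq T).binders ↔ False := by
  simp [Pat.binders]

/-! ### Known states under the operations of the platform -/

section PlatformTyping

variable {b : ℕ} {Big : Term → Prop} {K : Term → Prop} {k₀ m₀ : Name}

local notation "Kn" => Known b Big K k₀ m₀
local notation "Ks" => KnownState b Big K k₀ m₀
local notation "Γ₀" => platformTyping b Big K k₀ m₀

variable (b Big) in
/-- The properties of the big register values that are needed below. -/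
structure BigSpec : Prop where
  trans : ∀ {p}, Big p → Big (trans b Big p)
  extend : ∀ {p v}, Big p → Big (h (tup ![p, v]))

/-- A big register translates to `ps` and a chain to a chain or to `ps`; so the translated register
always meets the hypothesis under which `K` is closed under extension. -/
theorem BigSpec.isChain (hB : BigSpec b Big) {p : Term} (hp : Big p ∨ IsChain p) :
    IsChain (fixPcr Big (TrustedPlatform.trans b Big p)) := by
  by_cases ht : Big (TrustedPlatform.trans b Big p)
  · rw [fixPcr_big ht]
    exact isChain_ps
  · rw [fixPcr_not_big ht]
    exact (hp.resolve_left fun hp' => ht (hB.trans hp')).trans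

theorem fixPcr_destructorFree {p : Term} (hp : p.DestructorFree) :
    (fixPcr Big p).DestructorFree := by
  unfold fixPcr
  split_ifs
  · simp [destructorFree_app, Sym.IsDestructor]
  · exact hp

theorem fixLock_destructorFree {l : Term} (hl : l.DestructorFree) :
    (fixLock b l).DestructorFree := by
  rcases fixLock_or (b := b) l with e | e <;> rw [e]
  · simp [destructorFree_app, Sym.IsDestructor]
  · exact hl

theorem destructorFree_pst {p i c m a d e l : Term} : (pst p i c m a d e l).DestructorFree ↔
    p.DestructorFree ∧ (i.DestructorFree ∧ c.DestructorFree) ∧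
      (m.DestructorFree ∧ a.DestructorFree) ∧ d.DestructorFree ∧ e.DestructorFree ∧
        l.DestructorFree := by
  simp [destructorFree_app, forall_vecCons, Sym.IsDestructor]

theorem destructorFree_state {p x y z : Term} : (state (tpm p) x y z).DestructorFree ↔
    p.DestructorFree ∧ x.DestructorFree ∧ y.DestructorFree ∧ z.DestructorFree := by
  simp [destructorFree_app, forall_vecCons, Sym.IsDestructor]

theorem destructorFree_h {x : Term} : (h x).DestructorFree ↔ x.DestructorFree := by
  simp [destructorFree_app, Sym.IsDestructor]

theorem destructorFree_prog {x : Term} : (prog x).DestructorFree ↔ x.DestructorFree := by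
  simp [destructorFree_app, Sym.IsDestructor]

theorem destructorFree_pair {x y : Term} :
    (tup ![x, y]).DestructorFree ↔ x.DestructorFree ∧ y.DestructorFree := by
  simp [destructorFree_app, forall_vecCons, Sym.IsDestructor]

theorem destructorFree_constant {f : Sym} (hf : ¬ f.IsDestructor) (ha : f.arity = 0)
    (args : Fin f.arity → Term) : (Term.app f args).DestructorFree :=
  destructorFree_app.2 ⟨hf, fun i => absurd i.isLt (by omega)⟩

/-- The rest of a state can be equipped with the translation of a register value. -/
theorem fixPcr_obtainable (hK : Obtainable b K k₀ m₀) {q x y z : Term}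
    (hd : (state (tpm ps) x y z).DestructorFree) (hq : K (state (tpm q) x y z)) :
    K (state (tpm (fixPcr Big q)) x y z) := by
  by_cases hb : Big q
  · rw [fixPcr_big hb]
    exact hK.reset hd hq
  · rwa [fixPcr_not_big hb]

theorem known_pair {x y : Term} (hx : Kn x) (hy : Kn y) : Kn (tup ![x, y]) :=
  known_tup.2 (forall_vec₂ hx hy)

/-- The translation introduces no destructors, so the side conditions of the closure properties of
`K` carry over to translated states; the register is replaced separately. -/
theorem KnownState.transFree {p i c m a d e l q : Term}
    (hd : (pst p i c m a d e l).DestructorFree) (hq : q.DestructorFree) :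
    (pst q (trans b Big i) (trans b Big c) (trans b Big m) (trans b Big a) (trans b Big d)
      (trans b Big e) (fixLock b (trans b Big l))).DestructorFree := by
  rw [destructorFree_pst] at hd ⊢
  have := fun {T : Term} (hT : T.DestructorFree) => trans_destructorFree (b := b) (Big := Big) hT
  exact ⟨hq, ⟨this hd.2.1.1, this hd.2.1.2⟩, ⟨this hd.2.2.1.1, this hd.2.2.1.2⟩,
    this hd.2.2.2.1, this hd.2.2.2.2.1, fixLock_destructorFree (this hd.2.2.2.2.2)⟩

theorem ps_destructorFree : ps.DestructorFree :=
  destructorFree_constant (by simp [Sym.IsDestructor]) rfl _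

/-- Extending the register of a known state by a known value. -/
theorem KnownState.extend (hK : Obtainable b K k₀ m₀) (hB : BigSpec b Big)
    {p i c m a d e l v : Term} (hs : Ks p i c m a d e l) (hv : Kn v)
    (hd : (pst (h (tup ![p, v])) i c m a d e l).DestructorFree) :
    Ks (h (tup ![p, v])) i c m a d e l := by
  have hd' := (destructorFree_pst.1 hd).1
  rw [destructorFree_h, destructorFree_pair] at hd'
  refine { hs with
    pcr := known_h (known_pair hs.pcr hv)
    pcrFree := (destructorFree_pst.1 hd).1
    pcrForm := hs.pcrForm.imp hB.extend fun hc => hc.extend v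
    obtainable := ?_ }
  have ho := hs.obtainable
  rw [trans_pst] at ho ⊢
  rw [trans_h_tup]
  -- If the translated extension is big, the target register is `ps` and a reset suffices. Otherwise
  -- the translated old register was not big either, hence was kept, and the extension is carried
  -- out in `K`.
  by_cases hb : Big (h (tup ![trans b Big p, trans b Big v]))
  · rw [fixPcr_big hb]
    exact hK.reset (transFree hd ps_destructorFree) ho
  · have hb' : ¬ Big (trans b Big p) := fun hb' => hb (hB.extend hb')
    have hc := hB.isChain hs.pcrForm
    rw [fixPcr_not_big hb'] at ho hc
    rw [fixPcr_not_big hb]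
    exact hK.extend hc (transFree hd (trans_destructorFree hd'.1)) (trans_destructorFree hd'.2) ho
      (hv.obtainable hK)

/-- Setting the register of a known state to a known big value, or resetting it. -/
theorem KnownState.setPcr (hK : Obtainable b K k₀ m₀) (hB : BigSpec b Big)
    {p i c m a d e l q : Term} (hs : Ks p i c m a d e l) (hq : Kn q) (hb : Big q ∨ q = ps)
    (hd : (pst q i c m a d e l).DestructorFree) : Ks q i c m a d e l := by
  refine { hs with
    pcr := hq
    pcrFree := (destructorFree_pst.1 hd).1
    pcrForm := hb.imp id fun e' => by rw [e']; exact isChain_ps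
    obtainable := ?_ }
  have ho := hs.obtainable
  rw [trans_pst] at ho ⊢
  -- Either way the translated register is `ps`, so a single reset in `K` yields the new state.
  have e : fixPcr Big (trans b Big q) = ps := by
    rcases hb with hb | rfl
    · exact fixPcr_big (hB.trans hb)
    · rw [trans_ps]
      unfold fixPcr
      split_ifs <;> rfl
  rw [e]
  exact hK.reset (transFree hd ps_destructorFree) ho

/-- The end of the protected program: the register is extended and the lock is opened. -/
theorem KnownState.ppEnd (hK : Obtainable b K k₀ m₀) (hB : BigSpec b Big)
    {p i c m a d q : Term} (hs : Ks p i c m a d (prog Tpp) tt) (hq : Kn q)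
    (hb : Big q ∨ q = h (tup ![p, bot])) (hq' : q.DestructorFree)
    (hd : (pst p tt c m a d (prog Tpp) tt).DestructorFree) :
    Ks q tt c m a d (prog Tpp) ff := by
  have hff : Kn ff := known_constant (by simp [Sym.IsPrivate]) rfl _
  have htt : Kn tt := known_constant (by simp [Sym.IsPrivate]) rfl _
  refine { hs with
    pcr := hq
    int := htt
    lock := hff
    pcrFree := hq'
    pcrForm := ?_
    obtainable := ?_ }
  · rcases hb with hb | rfl
    · exact Or.inl hb
    · exact hs.pcrForm.imp hB.extend fun hc => hc.extend _
  have ho := hs.obtainable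
  have hd' := transFree (b := b) (Big := Big) hd
    (fixPcr_destructorFree (Big := Big)
      (trans_destructorFree (b := b) (Big := Big) (destructorFree_pst.1 hd).1))
  have hd'' := transFree (b := b) (Big := Big) (l := ff) (p := ps) (i := tt) (c := c) (m := m)
    (a := a) (d := d) (e := prog Tpp) (q := ps) (by
      rw [destructorFree_pst] at hd ⊢
      exact ⟨ps_destructorFree, hd.2.1, hd.2.2.1, hd.2.2.2.1, hd.2.2.2.2.1,
        destructorFree_constant (by simp [Sym.IsDestructor]) rfl _⟩) ps_destructorFree
  simp only [trans_pst, trans_prog, trans_entry, trans_tt, trans_ff, fixLock_tt, fixLock_ff]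
    at ho hd' hd'' ⊢
  have hend := hK.ppEnd (hB.isChain hs.pcrForm) hd' ho
  rcases hb with hb | rfl
  · rw [fixPcr_big (hB.trans hb)]
    exact hK.reset hd'' hend
  · simp only [trans_h, trans_tup, comp_vecCons, comp_vecEmpty, trans_bot]
    by_cases hb : Big (h (tup ![trans b Big p, bot]))
    · rw [fixPcr_big hb]
      exact hK.reset hd'' hend
    · rw [fixPcr_not_big hb]
      rwa [fixPcr_not_big fun hb' => hb (hB.extend hb')] at hend

theorem KnownState.ppInt (hK : Obtainable b K k₀ m₀) {p i c m a d : Term}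
    (hs : Ks p i c m a d (prog Tpp) tt) (hd : (pst p tt c m a d (prog Tpp) tt).DestructorFree) :
    Ks p tt c m a d (prog Tpp) tt := by
  refine { hs with
    int := known_constant (by simp [Sym.IsPrivate]) rfl _
    obtainable := ?_ }
  have ho := hs.obtainable
  have hd' := transFree (b := b) (Big := Big) hd
    (fixPcr_destructorFree (Big := Big)
      (trans_destructorFree (b := b) (Big := Big) (destructorFree_pst.1 hd).1))
  simp only [trans_pst, trans_prog, trans_entry, trans_tt, trans_ff, fixLock_tt, fixLock_ff]
    at ho hd' ⊢
  exact hK.ppInt hd' ho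

/-- The CPU overwrites the register by `pd` before measuring, so neither the old register nor its
translation affects the result. -/
theorem KnownState.launch (hK : Obtainable b K k₀ m₀) {p i c m a d e x : Term}
    (hs : Ks p i c m a d e ff) (hd : (pst p ff c m a d e ff).DestructorFree)
    (hx : Kn x) (hx' : x.DestructorFree) :
    Ks (h (tup ![pd, tup ![h (prog x), h m]])) ff c m a (prog x) e tt := by
  have hpx : Kn (prog x) := .app .prog _ (by simp [Sym.IsPrivate]) (forall_vec₁ hx)
  have hpd : pd.DestructorFree := destructorFree_constant (by simp [Sym.IsDestructor]) rfl _
  have htt : tt.DestructorFree := destructorFree_constant (by simp [Sym.IsDestructor]) rfl _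
  have hff : ff.DestructorFree := destructorFree_constant (by simp [Sym.IsDestructor]) rfl _
  have hm := (destructorFree_pst.1 hd).2.2.1.1
  refine { hs with
    pcr := known_h (known_pair (known_constant (by simp [Sym.IsPrivate]) rfl _)
      (known_pair (known_h hpx) (known_h hs.stm)))
    int := known_constant (by simp [Sym.IsPrivate]) rfl _
    init := hpx
    lock := known_constant (by simp [Sym.IsPrivate]) rfl _
    pcrFree := ?_
    pcrForm := Or.inr (isChain_pd.extend _)
    obtainable := ?_ }
  · simp only [destructorFree_h, destructorFree_pair, destructorFree_prog]
    exact ⟨hpd, hx', hm⟩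
  have ho := hs.obtainable
  have hd' := transFree (b := b) (Big := Big) hd
    (fixPcr_destructorFree (Big := Big)
      (trans_destructorFree (b := b) (Big := Big) (destructorFree_pst.1 hd).1))
  simp only [trans_pst, trans_prog, trans_entry, trans_tt, trans_ff, fixLock_tt, fixLock_ff,
    trans_h, trans_tup, comp_vecCons, comp_vecEmpty, trans_pd] at ho hd' ⊢
  -- Nothing is assumed about whether the new register is big; if its translation is, a reset
  -- follows the launch in `K`.
  refine fixPcr_obtainable hK ?_
    (hK.launch hd' (trans_destructorFree hx') (hx.obtainable hK) ho)
  rw [destructorFree_pst] at hd' ⊢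
  exact ⟨ps_destructorFree, hd'.2.1, hd'.2.2.1,
    destructorFree_prog.2 (trans_destructorFree hx'), hd'.2.2.2.2.1, htt⟩

/-- A separate closure property is used because the intermediate state, after the first measurement,
stays between the CPU and the trusted `INIT` program. -/
theorem KnownState.init' (hK : Obtainable b K k₀ m₀) {p i c m a d e y : Term}
    (hs : Ks p i c m a d e ff) (hd : (pst p ff c m a d e ff).DestructorFree)
    (hy : Kn y) (hy' : y.DestructorFree) :
    Ks (h (tup ![h (tup ![pd, tup ![h (prog Tinit), h m]]), h y])) ff c m a (prog Tinit) y tt := by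
  have hpx : Kn (prog Tinit) := .prog 0 (by omega)
  have hpx' : (prog Tinit).DestructorFree :=
    destructorFree_prog.2 (destructorFree_constant (by simp [Sym.IsDestructor]) rfl _)
  have hpd : pd.DestructorFree := destructorFree_constant (by simp [Sym.IsDestructor]) rfl _
  have htt : tt.DestructorFree := destructorFree_constant (by simp [Sym.IsDestructor]) rfl _
  have hm := (destructorFree_pst.1 hd).2.2.1.1
  refine { hs with
    pcr := known_h (known_pair (known_h (known_pair (known_constant (by simp [Sym.IsPrivate]) rfl _)
      (known_pair (known_h hpx) (known_h hs.stm)))) (known_h hy))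
    int := known_constant (by simp [Sym.IsPrivate]) rfl _
    init := hpx
    pp := hy
    lock := known_constant (by simp [Sym.IsPrivate]) rfl _
    pcrFree := ?_
    pcrForm := Or.inr ((isChain_pd.extend _).extend _)
    obtainable := ?_ }
  · simp only [destructorFree_h, destructorFree_pair]
    exact ⟨⟨hpd, hpx', hm⟩, hy'⟩
  have ho := hs.obtainable
  have hd' := transFree (b := b) (Big := Big) hd
    (fixPcr_destructorFree (Big := Big)
      (trans_destructorFree (b := b) (Big := Big) (destructorFree_pst.1 hd).1))
  simp only [trans_pst, trans_prog, trans_entry, trans_tt, trans_ff, fixLock_tt, fixLock_ff,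
    trans_h, trans_tup, comp_vecCons, comp_vecEmpty, trans_pd] at ho hd' ⊢
  refine fixPcr_obtainable hK ?_
    (hK.init hd' (trans_destructorFree hy') (hy.obtainable hK) ho)
  rw [destructorFree_pst] at hd' ⊢
  exact ⟨ps_destructorFree, hd'.2.1, hd'.2.2.1, hpx', trans_destructorFree hy', htt⟩

end PlatformTyping

/-- The form of `Rule.of_nf_eq` for nested destructors, whose arguments are not yet normal. -/
theorem Rule.of_nf_app {b : ℕ} {f : Sym} {args : Fin f.arity → Term} {V : Term}
    (he : nf b (.app f args) = V) (hV : V.DestructorFree) (hf : f.IsDestructor) :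
    Rule b (.app f fun i => nf b (args i)) V := by
  refine Rule.of_nf_eq ?_ hV hf fun i => nf_nf b _
  rw [← he, nf, nf]
  simp only [nf_nf]

/-! ### Shapes of states and terms on which each destructor succeeds -/

section RuleInversion

variable {b : ℕ} {s v V x k : Term}

theorem Rule.extend_inv (hr : Rule b (TrustedPlatform.extend s tpmAcc v) V) :
    ∃ p x y z, s = state (tpm p) x y z ∧ V = state (tpm (h (tup ![p, v]))) x y z := by
  generalize hU : TrustedPlatform.extend s tpmAcc v = U at hr
  cases hr <;> simp [Term.app.injEq] at hU
  simp only [hU]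
  exact ⟨_, _, _, _, rfl, rfl⟩

theorem Rule.setPcr_inv (hr : Rule b (TrustedPlatform.setPcr s tpmAcc v) V) :
    ∃ p x y z, s = state (tpm p) x y z ∧ V = state (tpm v) x y z := by
  generalize hU : TrustedPlatform.setPcr s tpmAcc v = U at hr
  cases hr <;> simp [Term.app.injEq] at hU
  simp only [hU]
  exact ⟨_, _, _, _, rfl, rfl⟩

theorem Rule.reset_inv (hr : Rule b (TrustedPlatform.reset s tpmAcc v) V) :
    ∃ p x y z, s = state (tpm p) x y z ∧ V = state (tpm v) x y z := by
  generalize hU : TrustedPlatform.reset s tpmAcc v = U at hr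
  cases hr <;> simp [Term.app.injEq] at hU
  all_goals
    simp only [hU]
    exact ⟨_, _, _, _, rfl, rfl⟩

theorem Rule.pcr_inv (hr : Rule b (TrustedPlatform.pcr s) V) :
    ∃ x y z, s = state (tpm V) x y z := by
  generalize hU : TrustedPlatform.pcr s = U at hr
  cases hr <;> simp [Term.app.injEq] at hU
  simp only [hU]
  exact ⟨_, _, _, rfl⟩

theorem Rule.lock_inv (hr : Rule b (TrustedPlatform.lock s) V) :
    ∃ x y z d e, s = state x y z (drt d e V) := by
  generalize hU : TrustedPlatform.lock s = U at hr
  cases hr <;> simp [Term.app.injEq] at hU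
  simp only [hU]
  exact ⟨_, _, _, _, _, rfl⟩

theorem Rule.pp_inv (hr : Rule b (TrustedPlatform.pp s) V) :
    ∃ x y z d l, s = state x y z (drt d V l) := by
  generalize hU : TrustedPlatform.pp s = U at hr
  cases hr <;> simp [Term.app.injEq] at hU
  simp only [hU]
  exact ⟨_, _, _, _, _, rfl⟩

theorem Rule.setIntCpu_inv (hr : Rule b (TrustedPlatform.setInt s cpuAcc v) V) :
    ∃ x i c y z, s = state x (cpu i c) y z ∧ V = state x (cpu v c) y z := by
  generalize hU : TrustedPlatform.setInt s cpuAcc v = U at hr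
  cases hr <;> simp [Term.app.injEq] at hU
  all_goals
    simp only [hU]
    exact ⟨_, _, _, _, _, rfl, rfl⟩

theorem Rule.setLockCpu_inv (hr : Rule b (TrustedPlatform.setLock s cpuAcc v) V) :
    ∃ x y z d e l, s = state x y z (drt d e l) ∧ V = state x y z (drt d e v) := by
  generalize hU : TrustedPlatform.setLock s cpuAcc v = U at hr
  cases hr <;> simp [Term.app.injEq] at hU
  all_goals
    simp only [hU]
    exact ⟨_, _, _, _, _, _, rfl, rfl⟩

theorem Rule.setInit_inv (hr : Rule b (TrustedPlatform.setInit s cpuAcc v) V) :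
    ∃ x y z d e l, s = state x y z (drt d e l) ∧ V = state x y z (drt v e l) := by
  generalize hU : TrustedPlatform.setInit s cpuAcc v = U at hr
  cases hr <;> simp [Term.app.injEq] at hU
  simp only [hU]
  exact ⟨_, _, _, _, _, _, rfl, rfl⟩

theorem Rule.setPpEntry_inv {j : ℕ} (hr : Rule b (TrustedPlatform.setPp s (entryPoint j) v) V) :
    ∃ x y z e l, s = state x y z (drt (prog (entryPoint j)) e l) ∧
      V = state x y z (drt (prog (entryPoint j)) v l) := by
  generalize hU : TrustedPlatform.setPp s (entryPoint j) v = U at hr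
  cases hr <;> simp [Term.app.injEq] at hU
  simp only [hU]
  exact ⟨_, _, _, _, _, rfl, rfl⟩

theorem Rule.setIntEntry_inv {j : ℕ} (hr : Rule b (TrustedPlatform.setInt s (entryPoint j) v) V) :
    ∃ x i c y d, s = state x (cpu i c) y (drt d (prog (entryPoint j)) tt) ∧
      V = state x (cpu v c) y (drt d (prog (entryPoint j)) tt) := by
  generalize hU : TrustedPlatform.setInt s (entryPoint j) v = U at hr
  cases hr <;> simp [Term.app.injEq] at hU
  simp only [hU]
  exact ⟨_, _, _, _, _, rfl, rfl⟩

theorem Rule.setLockEntry_inv {j : ℕ}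
    (hr : Rule b (TrustedPlatform.setLock s (entryPoint j) v) V) :
    ∃ x y z d l, s = state x y z (drt d (prog (entryPoint j)) l) ∧
      V = state x y z (drt d (prog (entryPoint j)) v) := by
  generalize hU : TrustedPlatform.setLock s (entryPoint j) v = U at hr
  cases hr <;> simp [Term.app.injEq] at hU
  simp only [hU]
  exact ⟨_, _, _, _, _, rfl, rfl⟩

theorem Rule.getEntry_inv (hr : Rule b (TrustedPlatform.getEntry x) V) : x = prog V := by
  generalize hU : TrustedPlatform.getEntry x = U at hr
  cases hr <;> simp [Term.app.injEq] at hU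
  simp only [hU]

theorem Rule.unsealD_inv (hr : Rule b (TrustedPlatform.unsealD x k) V) : x = sealD V k := by
  generalize hU : TrustedPlatform.unsealD x k = U at hr
  cases hr <;> simp [Term.app.injEq] at hU
  simp only [hU]

theorem Rule.sdec_inv (hr : Rule b (TrustedPlatform.sdec x k) V) : x = senc V k := by
  generalize hU : TrustedPlatform.sdec x k = U at hr
  cases hr <;> simp [Term.app.injEq] at hU
  simp only [hU]

/-- The rule leaves the initial value of the chain free: a register accepted by the bounded module
is long but need not start at a reset value. This is why known registers are required to be big or
chains, and not just chains. -/
theorem Rule.isBig_inv (hr : Rule b (TrustedPlatform.isBig x) V) : HasLength (b + 1) x := by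
  generalize hU : TrustedPlatform.isBig x = U at hr
  cases hr <;> simp [Term.app.injEq] at hU
  simp only [hU]
  exact ⟨_, _, ‹_›, rfl⟩

theorem nf_isSmall {p v₀ : Term} {l : List Term} (hp : p = chain v₀ l) (hv : v₀ = ps ∨ v₀ = pd)
    (hl : l.length < b) : nf b (isSmall p) = tt := by
  rw [hp, (Rule.isSmall v₀ l hv hl).nf_eq, nf_tt]

end RuleInversion

/-! ### Origin of the messages received on each channel -/

section PlatformTyping

variable {b : ℕ} {Big : Term → Prop} {K : Term → Prop} {k₀ m₀ : Name}

local notation "Kn" => Known b Big K k₀ m₀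
local notation "Ks" => KnownState b Big K k₀ m₀
local notation "Γ₀" => platformTyping b Big K k₀ m₀

theorem known_os : Kn os := known_constant (by simp [Sym.IsPrivate]) rfl _

theorem not_known_of_isEntry {e : Term} (he : IsEntry e) : ¬ Kn e := by
  obtain ⟨k, -, rfl⟩ := he
  exact not_known_entry k

theorem not_isEntry_cpuTpm : ¬ IsEntry cpuTpm := by
  rintro ⟨k, -, e⟩
  simp [Term.app.injEq] at e

theorem not_isEntry_tpmCh {x : Term} : ¬ IsEntry (tpmCh x) := by
  rintro ⟨k, -, e⟩
  simp [Term.app.injEq] at e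

theorem known_vec₃ {x y z : Term} : Kn (tup ![x, y, z]) ↔ Kn x ∧ Kn y ∧ Kn z := by
  simp [known_tup, forall_vecCons]

theorem known_vec₂ {x y : Term} : Kn (tup ![x, y]) ↔ Kn x ∧ Kn y := by
  simp [known_tup, forall_vecCons]

theorem known_vec₄ {x y z w : Term} : Kn (tup ![x, y, z, w]) ↔ Kn x ∧ Kn y ∧ Kn z ∧ Kn w := by
  simp [known_tup, forall_vecCons]

section Inversion

variable {W : World} {U n s v x : Term}

theorem allowed_os (ha : (Γ₀).allowed W os x) : Kn x :=
  ha.elim And.right fun hs => absurd known_os hs.not_known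

theorem allowed_resetReq (hU : ¬ IsEntry U)
    (ha : (Γ₀).allowed W U (tup ![resetReq, n, s])) :
    (Kn U ∧ Kn n ∧ Kn s) ∨ ∃ m p x₁ x₂ x₃ q, U = cpuTpm ∧ n = .name m ∧
      s = state (tpm p) x₁ x₂ x₃ ∧ W m = some (x₁, x₂, x₃, q) := by
  rcases ha with ⟨h₁, h₂⟩ | hs
  · exact Or.inl ⟨h₁, (known_vec₃.1 h₂).2⟩
  right
  generalize hT : tup ![resetReq, n, s] = T at hs
  cases hs <;> simp [Term.app.injEq] at hT
  case resetReq m p x₁ x₂ x₃ q hm => exact ⟨m, p, x₁, x₂, x₃, q, rfl, hT.1, hT.2, hm⟩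

theorem allowed_resetResp (hU : ¬ IsEntry U) (hU' : ¬ Kn U) {m : Name}
    (ha : (Γ₀).allowed W U (tup ![resetResp, .name m, s])) :
    ∃ x₁ x₂ x₃ q, s = state (tpm pd) x₁ x₂ x₃ ∧ W m = some (x₁, x₂, x₃, q) := by
  rcases ha with ⟨h₁, h₂⟩ | hs
  · exact absurd h₁ hU'
  generalize hT : tup ![resetResp, .name m, s] = T at hs
  cases hs <;> simp [Term.app.injEq] at hT
  case resetResp m p x₁ x₂ x₃ hm =>
    obtain ⟨rfl, rfl⟩ := hT
    exact ⟨_, _, _, _, rfl, hm⟩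

/-- Hidden messages are told apart by tag and size. The messages that start a trusted program have
no tag, which is why entry points are excluded as channels; a request then stems from the attacker,
from the CPU or `INIT`, or from the protected program. -/
theorem allowed_extendReq (hU : ¬ IsEntry U)
    (ha : (Γ₀).allowed W U (tup ![extendReq, n, s, v])) :
    (Kn U ∧ Kn n ∧ Kn s ∧ Kn v) ∨
    (∃ m x₁ x₂ x₃ p, (U = cpuTpm ∨ U = tpmCh (prog Tinit)) ∧ (p = pd ∨ ∃ w, p = h (tup ![pd, w])) ∧
      W m = some (x₁, x₂, x₃, h (tup ![p, v])) ∧ n = .name m ∧ s = state (tpm p) x₁ x₂ x₃) ∨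
    (∃ p c m a d, U = tpmCh (prog Tpp) ∧ Kn (pst p tt c m a d (prog Tpp) tt) ∧
      (pst p tt c m a d (prog Tpp) tt).DestructorFree ∧ s = pst p tt c m a d (prog Tpp) tt ∧
      v = bot) := by
  rcases ha with ⟨h₁, h₂⟩ | hs
  · exact Or.inl ⟨h₁, (known_vec₄.1 h₂).2⟩
  right
  generalize hT : tup ![extendReq, n, s, v] = T at hs
  cases hs <;> simp [Term.app.injEq, -Matrix.vecCons_inj] at hT <;>
    simp only [Matrix.vecCons_inj, Term.app.injEq] at hT
  case extendReq m x₁ x₂ x₃ p v' h₁ h₂ h₃ =>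
    obtain ⟨-, rfl, rfl, rfl, -⟩ := hT
    exact Or.inl ⟨_, _, _, _, _, ‹_›, ‹_›, ‹_›, rfl, rfl⟩
  case launch => exact absurd ‹IsEntry _› hU
  case ppExtendReq n' p c m a d h₁ h₂ =>
    obtain ⟨-, -, rfl, rfl, -⟩ := hT
    exact Or.inr ⟨_, _, _, _, _, rfl, h₁, h₂, rfl, rfl⟩

/-- The nonce determines, through the world, the state that the reply contains. -/
theorem allowed_extendResp (hU : U = cpuTpm ∨ U = tpmCh (prog Tinit)) {m : Name}
    (ha : (Γ₀).allowed W U (tup ![extendResp, .name m, s])) :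
    ∃ x₁ x₂ x₃ q, s = state (tpm q) x₁ x₂ x₃ ∧ W m = some (x₁, x₂, x₃, q) := by
  rcases ha with ⟨h₁, h₂⟩ | hs
  · rcases hU with rfl | rfl
    · exact absurd h₁ not_known_cpuTpm
    · exact absurd h₁ (not_known_tpmCh 0)
  generalize hT : tup ![extendResp, .name m, s] = T at hs
  cases hs <;> simp [Term.app.injEq] at hT
  case extendResp =>
    obtain ⟨rfl, rfl⟩ := hT
    exact ⟨_, _, _, _, rfl, ‹_›⟩
  case ppExtendResp => simp [Term.app.injEq] at hU

/-- No world is needed here: any reply on this channel holds a state whose unlocked version is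
already known, so it is irrelevant which request it answers. -/
theorem allowed_ppExtendResp
    (ha : (Γ₀).allowed W (tpmCh (prog Tpp)) (tup ![extendResp, n, s])) :
    ∃ p c m a d, s = pst p tt c m a d (prog Tpp) tt ∧ Kn (pst p tt c m a d (prog Tpp) ff) := by
  rcases ha with ⟨h₁, h₂⟩ | hs
  · exact absurd h₁ (not_known_tpmCh 2)
  generalize hT : tup ![extendResp, n, s] = T at hs
  generalize hU : tpmCh (prog Tpp) = U at hs
  cases hs <;> simp [Term.app.injEq] at hT
  case extendResp =>
    subst hU
    simp [Term.app.injEq] at *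
  case ppExtendResp => exact ⟨_, _, _, _, _, hT.2, ‹_›⟩

theorem allowed_extChannel (ha : (Γ₀).allowed W cpuTpm (tup ![extChannel, x])) :
    ∃ e, x = tpmCh (prog e) ∧ (IsEntry e ∨ Kn e ∧ e.DestructorFree) := by
  rcases ha with ⟨h₁, h₂⟩ | hs
  · exact absurd h₁ not_known_cpuTpm
  generalize hT : tup ![extChannel, x] = T at hs
  generalize hU : cpuTpm = U at hs
  cases hs <;> simp [Term.app.injEq] at hT hU
  case extChannel e he => exact ⟨e, hT, he⟩
  case run he _ => exact absurd (hU ▸ he) not_isEntry_cpuTpm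

theorem allowed_launch {c y : Term} (ha : (Γ₀).allowed W Tinit (tup ![n, s, c, y])) :
    IsLaunched b Big K k₀ m₀ s ∧ c = tpmCh (prog Tinit) ∧ Kn y := by
  rcases ha with ⟨h₁, h₂⟩ | hs
  · exact absurd h₁ (not_known_entry 0)
  generalize hT : tup ![n, s, c, y] = T at hs
  generalize hU : Tinit = U at hs
  cases hs <;> simp [Term.app.injEq, -Matrix.vecCons_inj] at hT hU <;>
    simp only [Matrix.vecCons_inj] at hT
  case launch h₁ =>
    subst hU
    rw [hT.2.1, hT.2.2.1, hT.2.2.2.1]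
    exact h₁ rfl
  case extendReq => subst hU; simp [Term.app.injEq] at *

/-- Nothing ties the returned state to the one handed out; that it is known is all that can be said,
and all that is needed. -/
theorem allowed_drtResp {e : Term} (he : Kn e ∨ IsEntry e)
    (ha : (Γ₀).allowed W e (tup ![drtResp, n, s])) : Kn s := by
  rcases ha with ⟨h₁, h₂⟩ | hs
  · exact (known_vec₃.1 h₂).2.2
  have he' := he.resolve_left hs.not_known
  generalize hT : tup ![drtResp, n, s] = T at hs
  cases hs <;> simp [Term.app.injEq] at hT
  case drtResp => exact hT.2 ▸ ‹_›

theorem allowed_run {c : Term} (ha : (Γ₀).allowed W Tpp (tup ![s, c])) :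
    Kn s ∧ c = tpmCh (prog Tpp) := by
  rcases ha with ⟨h₁, h₂⟩ | hs
  · exact absurd h₁ (not_known_entry 2)
  generalize hT : tup ![s, c] = T at hs
  generalize hU : Tpp = U at hs
  cases hs <;> simp [Term.app.injEq] at hT hU
  case run h₁ =>
    subst hU
    rw [hT.1, hT.2]
    exact h₁ rfl

theorem allowed_unsealTag (hU : ¬ IsEntry U) (ha : (Γ₀).allowed W U (tup ![unsealTag, x])) :
    (Kn U ∨ U = tpmCh (prog Tpp)) ∧ Kn x := by
  rcases ha with ⟨h₁, h₂⟩ | hs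
  · exact ⟨Or.inl h₁, (known_vec₂.1 h₂).2⟩
  generalize hT : tup ![unsealTag, x] = T at hs
  cases hs <;> simp [Term.app.injEq] at hT
  case run => exact absurd ‹IsEntry _› hU
  case unsealTag => exact ⟨Or.inr rfl, hT ▸ ‹_›⟩

theorem allowed_plainTag (ha : (Γ₀).allowed W (tpmCh (prog Tpp)) (tup ![plainTag, x])) :
    Kn x ∨ x = .name k₀ ∧ (∃ i c m a d, Kn (pst hchain i c m a d (prog Tpp) tt)) := by
  rcases ha with ⟨h₁, h₂⟩ | hs
  · exact absurd h₁ (not_known_tpmCh 2)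
  generalize hT : tup ![plainTag, x] = T at hs
  generalize hU : tpmCh (prog Tpp) = U at hs
  cases hs <;> simp [Term.app.injEq] at hT hU
  case run he _ => exact absurd (hU ▸ he) not_isEntry_tpmCh
  case plainTag => exact hT ▸ ‹_›

end Inversion

end PlatformTyping

/-! ### The trusted platform module is well typed -/

section PlatformTyping

variable {b : ℕ} {Big : Term → Prop} {K : Term → Prop} {k₀ m₀ : Name}

local notation "Kn" => Known b Big K k₀ m₀
local notation "Ks" => KnownState b Big K k₀ m₀
local notation "Γ₀" => platformTyping b Big K k₀ m₀

/-- Only `setPcr`, which occurs in the reply of the bounded module alone, is constrained. -/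
theorem evaluable_app {f : Sym} (hf : f ≠ .setPcr) (args : Fin f.arity → Term) :
    (Γ₀).evaluable (.app f args) := by
  intro s v e
  injection e with e₁
  exact absurd e₁ hf

/-- The reply to a request for extension of the register. -/
theorem allowed_extendResp_of_extend (hK : Obtainable b K k₀ m₀) (hB : BigSpec b Big)
    {W : World} {U n s v V : Term} (hU : ¬ IsEntry U)
    (ha : (Γ₀).allowed W U (tup ![extendReq, n, s, v]))
    (hr : Rule b (extend s tpmAcc v) V) (hV : V.DestructorFree) :
    (Γ₀).allowed W U (tup ![extendResp, n, V]) := by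
  obtain ⟨p, x, y, z, rfl, rfl⟩ := hr.extend_inv
  rcases allowed_extendReq hU ha with ⟨h₁, h₂, h₃, h₄⟩ |
    ⟨m, x₁, x₂, x₃, q, h₁, -, h₂, rfl, h₃⟩ | ⟨q, c, m, a, d, rfl, h₂, h₃, h₄, rfl⟩
  · obtain ⟨p', i, c, m, a, d, e, l, h₅, rfl, rfl, rfl, hs⟩ := h₃.state_inv
    simp [Term.app.injEq] at h₅
    subst h₅
    exact Or.inl ⟨h₁, known_vec₃.2 ⟨known_constant (by simp [Sym.IsPrivate]) rfl _, h₂,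
      (hs.extend hK hB h₄ hV).known⟩⟩
  · simp [Term.app.injEq] at h₃
    obtain ⟨rfl, rfl, rfl, rfl⟩ := h₃
    exact Or.inr (.extendResp _ _ _ _ _ _ h₁ h₂)
  · simp [Term.app.injEq] at h₄
    obtain ⟨rfl, rfl, rfl, rfl⟩ := h₄
    refine Or.inr (.ppExtendResp _ _ _ _ _ _ (KnownState.known ?_))
    have hs := known_pst.1 h₂
    exact hs.ppEnd hK hB (known_h (known_pair hs.pcr (known_constant (by simp [Sym.IsPrivate]) rfl _)))
      (Or.inr rfl) (destructorFree_state.1 hV).1 h₃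

/-- The reply to a request for extension that sets the register to a big value. -/
theorem allowed_extendResp_of_setPcr (hK : Obtainable b K k₀ m₀) (hB : BigSpec b Big)
    {W : World} {U n p x y z v q : Term} (hU : ¬ IsEntry U)
    (ha : (Γ₀).allowed W U (tup ![extendReq, n, state (tpm p) x y z, v]))
    (hp : p ≠ pd ∧ ∀ w, p ≠ h (tup ![pd, w])) :
    Kn p ∧ Kn v ∧ (Kn q → Big q → (state (tpm q) x y z).DestructorFree →
      (Γ₀).allowed W U (tup ![extendResp, n, state (tpm q) x y z])) := by
  rcases allowed_extendReq hU ha with ⟨h₁, h₂, h₃, h₄⟩ |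
    ⟨m, x₁, x₂, x₃, q, h₁, h₂, -, rfl, h₃⟩ | ⟨q, c, m, a, d, rfl, h₂, h₃, h₄, rfl⟩
  · obtain ⟨p', i, c, m, a, d, e, l, h₅, rfl, rfl, rfl, hs⟩ := h₃.state_inv
    simp [Term.app.injEq] at h₅
    subst h₅
    refine ⟨hs.pcr, h₄, fun hq hb hd => ?_⟩
    exact Or.inl ⟨h₁, known_vec₃.2 ⟨known_constant (by simp [Sym.IsPrivate]) rfl _, h₂,
      (hs.setPcr hK hB hq (Or.inl hb) hd).known⟩⟩
  · simp [Term.app.injEq] at h₃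
    obtain ⟨rfl, rfl, rfl, rfl⟩ := h₃
    rcases h₂ with h₂ | ⟨w, h₂⟩
    · exact absurd h₂ hp.1
    · exact absurd h₂ (hp.2 w)
  · simp [Term.app.injEq] at h₄
    obtain ⟨rfl, rfl, rfl, rfl⟩ := h₄
    have hs := known_pst.1 h₂
    refine ⟨hs.pcr, known_constant (by simp [Sym.IsPrivate]) rfl _, fun hq hb hd => ?_⟩
    refine Or.inr (.ppExtendResp _ _ _ _ _ _ (KnownState.known ?_))
    exact hs.ppEnd hK hB hq (Or.inl hb) (destructorFree_state.1 hd).1 h₃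

variable (b Big K k₀ m₀) in
/-- Well-typed processes for the extension of the register. -/
def ExtendOk (ext : Proc) : Prop :=
  ∀ W ρ, ¬ IsEntry (ρ .ch) → nf b (ρ .ch) = ρ .ch → (Γ₀).Ok b ext W ρ

theorem extendOk_pcrExtend (hK : Obtainable b K k₀ m₀) (hB : BigSpec b Big) :
    ExtendOk b Big K k₀ m₀ pcrExtend := by
  intro W ρ hch hnf
  simp only [pcrExtend, Typing.Ok, Term.subst, Pat.subst, Pat.inst, comp_vecCons, comp_vecEmpty,
    mem_binders_cons, mem_binders_nil, mem_binders_var, mem_binders_eq, Function.update_apply,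
    reduceCtorEq, or_false, false_or, if_true, if_false, or_true, true_or, nf_tup, nf_extendReq, nf_extendResp,
    forall_eq_or_imp, forall_eq, and_true, hnf]
  rintro W' σ hW hall ⟨hn, hs, hv⟩
  rw [hn, hs, hv] at hall
  refine ⟨evaluable_app (by simp) _, fun V hV hdf => ?_⟩
  rw [hn, hdf.nf_eq]
  refine allowed_extendResp_of_extend hK hB hch hall (Rule.of_nf_eq hV hdf (by simp [Sym.IsDestructor]) ?_) hdf
  exact forall_vec₃ (p := fun T => nf b T = T) hs (nf_tpmAcc b) hv

/-- The small branch is an ordinary extension. The other branch may publish the register and the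
value, because the hidden requests of the CPU and of `INIT` never reach it; the value returned there
is big. -/
theorem extendOk_pcrExtendBounded (hb : 2 ≤ b) (hK : Obtainable b K k₀ m₀) (hB : BigSpec b Big)
    (hB' : ∀ p, HasLength (b + 1) p → Big p) :
    ExtendOk b Big K k₀ m₀ pcrExtendBounded := by
  intro W ρ hch hnf
  simp only [pcrExtendBounded, pcrExtendSmall, pcrExtendBig, bigReply, Typing.Ok, Term.subst, Pat.subst, Pat.inst, comp_vecCons, comp_vecEmpty,
    mem_binders_cons, mem_binders_nil, mem_binders_var, mem_binders_eq, Function.update_apply,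
    reduceCtorEq, or_false, false_or, if_true, if_false, or_true, true_or, nf_tup, nf_extendReq, nf_extendResp, nf_os,
    forall_eq_or_imp, forall_eq, and_true, hnf, nf_tt]
  rintro W' σ hW hall ⟨hn, hs, hv⟩
  rw [hn, hs, hv] at hall
  refine ⟨evaluable_app (by simp) _, fun p hp hpf => ⟨fun hsm => ?_, fun hsm => ?_⟩⟩
  · refine ⟨evaluable_app (by simp) _, fun V hV hdf => ?_⟩
    rw [hn, hdf.nf_eq]
    refine allowed_extendResp_of_extend hK hB hch hall (Rule.of_nf_eq hV hdf (by simp [Sym.IsDestructor]) ?_) hdf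
    exact forall_vec₃ (p := fun T => nf b T = T) hs (nf_tpmAcc b) hv
  obtain ⟨x, y, z, hst⟩ := (Rule.of_nf_eq hp hpf (by simp [Sym.IsDestructor])
    (forall_vec₁ (p := fun T => nf b T = T) hs)).pcr_inv
  rw [hst] at hall
  -- Both forms are chains on `pd` with at most one extension, hence small because `1 < b`.
  have hp' : p ≠ pd ∧ ∀ w, p ≠ h (tup ![pd, w]) := by
    refine ⟨fun e => hsm ?_, fun w e => hsm ?_⟩
    · exact nf_isSmall (v₀ := pd) (l := []) (by rw [e]; rfl) (Or.inr rfl) (by simp; omega)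
    · exact nf_isSmall (v₀ := pd) (l := [w]) (by rw [e]; rfl) (Or.inr rfl) (by simp; omega)
  -- The value `q` chosen by the attacker is left open: that `p` and `v` are known does not depend
  -- on it, and `ps` is a dummy when only this is used.
  have key := fun q => allowed_extendResp_of_setPcr (q := q) hK hB hch hall hp'
  refine ⟨Or.inl ⟨known_os, ?_⟩, ?_⟩
  · rw [hpf.nf_eq, hv]
    exact known_pair (key ps).1 (key ps).2.1
  intro W'' τ _ hq hqn
  -- Passing the test is the only source of information on the new value; it serves both the
  -- constraint on `setPcr` and the bigness of the reply.
  have hbig := fun h₁ => (Rule.of_nf_eq (b := b) (f := .isBig) (args := ![τ .newPcr]) (V := tt) h₁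
    (destructorFree_constant (by simp [Sym.IsDestructor]) rfl _)
    (by simp [Sym.IsDestructor]) (forall_vec₁ (p := fun T => nf b T = T) hqn)).isBig_inv
  refine ⟨fun h₁ => ⟨?_, fun V hV hdf => ?_⟩, fun _ => trivial⟩
  · intro s v e
    simp [Term.app.injEq] at e
    rw [← e.2, hqn]
    exact hbig h₁
  · obtain ⟨p', x', y', z', h₃, rfl⟩ := (Rule.of_nf_eq hV hdf (by simp [Sym.IsDestructor])
      (forall_vec₃ (p := fun T => nf b T = T) hs (nf_tpmAcc b) hqn)).setPcr_inv
    rw [hst] at h₃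
    simp [Term.app.injEq] at h₃
    obtain ⟨rfl, rfl, rfl, rfl⟩ := h₃
    rw [hn, hdf.nf_eq]
    rw [hqn] at hq
    exact (platformTyping_sound hK).mono _ _ _ _ ‹_›
      ((key _).2.2 (allowed_os hq) (hB' _ (hbig h₁)) hdf)

/-- A granted channel is always of the form `tpmCh (prog e)`, so it cannot be confused with an entry
point. -/
theorem ok_tpmExtend {ext : Proc} (he : ExtendOk b Big K k₀ m₀ ext)
    (W : World) (ρ : Ident → Term) : (Γ₀).Ok b (tpmExtend ext) W ρ := by
  simp only [tpmExtend, Typing.Ok, Term.subst, Pat.subst, Pat.inst, comp_vecCons, comp_vecEmpty,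
    mem_binders_cons, mem_binders_nil, mem_binders_var, mem_binders_eq,
    reduceCtorEq, or_false, false_or, if_true, if_false, nf_tup, nf_extChannel, nf_cpuTpm, nf_os,
    forall_eq]
  refine ⟨⟨evaluable_app (by simp) _, ?_⟩, ⟨evaluable_app (by simp) _, ?_⟩, ?_⟩
  · rintro _ rfl _
    exact he _ _ (by simpa using not_isEntry_cpuTpm) (by simp)
  · rintro _ rfl _
    refine he _ _ ?_ (by simp)
    simp only [Function.update_self]
    exact fun h₁ => not_known_of_isEntry (b := b) (Big := Big) (K := K) (k₀ := k₀) (m₀ := m₀)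
      h₁ known_os
  · intro W' σ _ hall hn
    rw [hn] at hall
    obtain ⟨e, he', -⟩ := allowed_extChannel hall
    refine he _ _ ?_ ?_ <;> simp only [if_true]
    · rw [he']
      exact not_isEntry_tpmCh
    · exact hn

/-- A reset to `pd` can only be requested by the CPU, and one to `ps` only on `os`, with a known
state; the two copies of the process differ in nothing else. -/
theorem ok_tpmReset (hK : Obtainable b K k₀ m₀) (hB : BigSpec b Big)
    (W : World) (ρ : Ident → Term) : (Γ₀).Ok b tpmReset W ρ := by
  have hos : ¬ IsEntry os := fun h₁ => not_known_of_isEntry (b := b) (Big := Big) (K := K)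
    (k₀ := k₀) (m₀ := m₀) h₁ known_os
  simp only [tpmReset, pcrReset, Typing.Ok, Term.subst, Pat.subst, Pat.inst, comp_vecCons,
    comp_vecEmpty, mem_binders_cons, mem_binders_nil, mem_binders_var, mem_binders_eq,
    Function.update_apply, reduceCtorEq, or_false, false_or, if_true, if_false, or_true, true_or,
    nf_tup, nf_resetReq, nf_resetResp, nf_cpuTpm, nf_os, nf_ps, nf_pd, forall_eq_or_imp,
    forall_eq, forall_eq', and_true]
  refine ⟨⟨evaluable_app (by simp) _, fun _ => ⟨evaluable_app (by simp) _, fun _ => ?_⟩⟩,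
    ⟨evaluable_app (by simp) _, fun _ => ⟨evaluable_app (by simp) _, fun _ => ?_⟩⟩⟩ <;>
  · rintro W' σ hW hall ⟨hn, hs⟩
    rw [hn, hs] at hall
    refine ⟨evaluable_app (by simp) _, fun hdf => ?_⟩
    generalize hV : nf b _ = V at hdf
    rw [hn, hdf.nf_eq]
    obtain ⟨p, x, y, z, hst, rfl⟩ := (Rule.of_nf_eq hV hdf (by simp [Sym.IsDestructor])
      (forall_vec₃ (p := fun T => nf b T = T) hs (nf_tpmAcc b) (by simp))).reset_inv
    rw [hst] at hall
    rcases allowed_resetReq (by first | exact not_isEntry_cpuTpm | exact hos) hall with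
      ⟨h₁, h₂, h₃⟩ | ⟨m, p', x₁, x₂, x₃, q, h₁, h₂, h₃, h₄⟩
    · first
      | exact absurd h₁ not_known_cpuTpm
      | obtain ⟨p', i, c, m, a, d, e, l, h₅, rfl, rfl, rfl, hs⟩ := h₃.state_inv
        exact Or.inl ⟨h₁, known_vec₃.2 ⟨known_constant (by simp [Sym.IsPrivate]) rfl _, h₂,
          (hs.setPcr hK hB (known_constant (by simp [Sym.IsPrivate]) rfl _) (Or.inr rfl)
            hdf).known⟩⟩
    · first
      | simp [Term.app.injEq] at h₁; done
      | simp [Term.app.injEq] at h₃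
        obtain ⟨rfl, rfl, rfl, rfl⟩ := h₃
        rw [h₂]
        exact Or.inr (.resetResp _ _ _ _ _ h₄)

theorem tt_destructorFree : tt.DestructorFree :=
  destructorFree_constant (by simp [Sym.IsDestructor]) rfl _

theorem hchain_destructorFree : hchain.DestructorFree := by
  simp [hchain, destructorFree_app, forall_vecCons, Sym.IsDestructor]

/-- The only sealed term that can reveal an unknown value is the key under `hchain`. As `hchain` is
not big, the translated state has the same register, so the key can be unsealed in `K` as well or is
sent to the protected program. -/
theorem ok_tpmUnseal (hK : Obtainable b K k₀ m₀) (hB : ¬ Big hchain)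
    (W : World) (ρ : Ident → Term) : (Γ₀).Ok b tpmUnseal W ρ := by
  simp only [tpmUnseal, unsealProc, Typing.Ok, Term.subst, Pat.subst, Pat.inst, comp_vecCons,
    comp_vecEmpty, mem_binders_cons, mem_binders_nil, mem_binders_var, mem_binders_eq,
    Function.update_apply, reduceCtorEq, or_false, false_or, if_true, if_false, or_true, true_or,
    nf_tup, nf_unsealTag, nf_plainTag, nf_os, nf_tt, forall_eq_or_imp,
    forall_eq, and_true]
  intro W' σ hW hst hs
  have hunseal : ∀ x V, nf b x = x → nf b (unsealD x (pcr (σ .pfState))) = V → V.DestructorFree →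
      x = sealD V (nf b (pcr (σ .pfState))) := by
    intro x V hx hV hVf
    have hr := Rule.of_nf_app hV hVf (by simp [Sym.IsDestructor])
    simp only [comp_vecCons, comp_vecEmpty, hx] at hr
    exact hr.unsealD_inv
  rw [hs] at hst
  replace hst := allowed_os hst
  refine ⟨fun hl => ⟨evaluable_app (by simp) _, fun U hU hUf W'' τ hW' hall hb => ?_⟩,
    fun hl => ⟨evaluable_app (by simp) _, fun U hU hUf W'' τ hW' hall hb => ?_⟩⟩ <;>
  refine ⟨evaluable_app (by simp) _, fun V hV hVf => ?_⟩ <;>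
  rw [hUf.nf_eq] at hall ⊢ <;> rw [hVf.nf_eq] <;> rw [hb] at hall
  · rw [nf_tpmCh] at hU
    subst hU
    simp only [destructorFree_app, forall_vecCons] at hUf
    obtain ⟨x, y, z, d, l, h₁⟩ := (Rule.of_nf_eq rfl hUf.2.1 (by simp [Sym.IsDestructor])
      (forall_vec₁ (p := fun T => nf b T = T) hs)).pp_inv
    obtain ⟨x', y', z', d', e', h₂⟩ := (Rule.of_nf_eq hl tt_destructorFree
      (by simp [Sym.IsDestructor]) (forall_vec₁ (p := fun T => nf b T = T) hs)).lock_inv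
    generalize nf b (pp (σ .pfState)) = e at *
    rw [h₁] at h₂
    simp [Term.app.injEq] at h₂
    obtain ⟨-, -, -, -, -, rfl⟩ := h₂
    rw [h₁] at hst
    obtain ⟨p, i, c, m, a, d', e', l', rfl, rfl, rfl, h₃, hks⟩ := hst.state_inv
    simp [Term.app.injEq] at h₃
    obtain ⟨rfl, rfl, rfl⟩ := h₃
    obtain ⟨hU, hbl⟩ := allowed_unsealTag not_isEntry_tpmCh hall
    have h₄ := hunseal _ _ hb hV hVf
    rw [h₁, (Rule.pcr _ _ _ _).nf_eq, hks.pcrFree.nf_eq] at h₄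
    rw [h₄] at hbl
    have hKV : Kn V → (Γ₀).allowed W'' (tpmCh e) (tup ![plainTag, V]) := by
      intro h₅
      rcases hU with hU | hU
      · exact Or.inl ⟨hU, known_pair (known_constant (by simp [Sym.IsPrivate]) rfl _) h₅⟩
      · rw [hU]
        exact Or.inr (.plainTag _ (Or.inl h₅))
    -- For a locked state the channel belongs to a program of the attacker, in which case the key is
    -- obtained by `unsealCh`, or to `Tpp`; then the key stays hidden, but the state is remembered
    -- as a witness for `unsealPp`.
    rcases hbl.sealD_inv with ⟨rfl, rfl⟩ | ⟨h₅, -⟩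
    · rcases hU with hU | hU
      · obtain ⟨e', rfl, h₅, h₆⟩ := hU.tpmCh_inv
        refine hKV (.name _ ?_)
        have ho := hks.obtainable
        simp only [trans_pst, trans_hchain, fixPcr_not_big hB, trans_prog, trans_tt, fixLock_tt] at ho
        exact hK.unsealCh (trans_destructorFree h₅) (h₆.obtainable hK) ho
      · rw [hU]
        simp [Term.app.injEq] at hU
        subst hU
        exact Or.inr (.plainTag _ (Or.inr ⟨rfl, _, _, _, _, _, hks.known⟩))
    · exact hKV h₅
  · subst hU
    have hbl := (known_vec₂.1 (allowed_os hall)).2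
    refine Or.inl ⟨known_os, known_pair (known_constant (by simp [Sym.IsPrivate]) rfl _) ?_⟩
    have h₄ := hunseal _ _ hb hV hVf
    rw [h₄] at hbl
    rcases hbl.sealD_inv with ⟨rfl, h₅⟩ | ⟨h₅, -⟩
    · obtain ⟨x, y, z, h₁⟩ := (Rule.of_nf_eq h₅ hchain_destructorFree (by simp [Sym.IsDestructor])
        (forall_vec₁ (p := fun T => nf b T = T) hs)).pcr_inv
      rw [h₁] at hst hl
      obtain ⟨p, i, c, m, a, d, e, l, h₃, rfl, rfl, rfl, hks⟩ := hst.state_inv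
      simp only [Term.app.injEq, heq_eq_eq, true_and, Matrix.vecCons_inj, and_true] at h₃
      subst h₃
      -- The state is not locked, and by the choice of `fixLock` neither is its translation.
      have hl' : l ≠ tt := by
        rintro rfl
        exact hl (by rw [(Rule.lock _ _ _ _ _ _).nf_eq, nf_tt])
      have ho := hks.obtainable
      simp only [trans_pst, trans_hchain, fixPcr_not_big hB] at ho
      exact .name _ (hK.unsealOs (nf_fixLock_ne fun h₆ => hl' (trans_eq_tt h₆)) ho)
    · exact h₅

end PlatformTyping

/-! ### The CPU and the programs are well typed -/

section PlatformTyping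

variable {b : ℕ} {Big : Term → Prop} {K : Term → Prop} {k₀ m₀ : Name}

local notation "Kn" => Known b Big K k₀ m₀
local notation "Ks" => KnownState b Big K k₀ m₀
local notation "Γ₀" => platformTyping b Big K k₀ m₀

/-- The freshness condition of the typing identifies the generated names with `k₀` and `m₀`. -/
theorem ok_DATA (W : World) (ρ : Ident → Term) : (Γ₀).Ok b DATA W ρ := by
  simp only [DATA, hchain, Typing.Ok, Term.subst, comp_vecCons,
    comp_vecEmpty, Function.update_apply, reduceCtorEq, if_true, if_false, 
    nf_tup, nf_h, nf_prog, nf_entry, nf_pd, nf_sealD, nf_senc, nf_os, nf_name, forall_eq', and_true]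
  intro W' i _ hf _
  refine ⟨none, fun W'' j _ hf' _ => ⟨none, ?_⟩⟩
  have h₁ : (⟨.kpp, i⟩ : Name) = k₀ := hf.1 rfl
  have h₂ : (⟨.hipp, j⟩ : Name) = m₀ := hf'.2.1 rfl
  rw [h₁, h₂]
  exact ⟨Or.inl ⟨known_os, .senc⟩, evaluable_app (by simp) _, fun _ => Or.inl ⟨known_os, .sealD⟩⟩

theorem ok_SETUP (hK : Obtainable b K k₀ m₀)
    (W : World) (ρ : Ident → Term) : (Γ₀).Ok b SETUP W ρ := by
  simp only [SETUP, Typing.Ok, Term.subst, Pat.subst, Pat.inst, comp_vecCons,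
    comp_vecEmpty, mem_binders_cons, mem_binders_nil, mem_binders_var, mem_binders_eq,
    Function.update_apply, reduceCtorEq, or_false, false_or, if_true, if_false, or_true, true_or,
    nf_tup, nf_os, nf_tt, nf_state, nf_tpm, nf_cpu, nf_smram, nf_drt, nf_ps, nf_bot, nf_ff, nf_drtReq, forall_eq_or_imp,
    forall_eq, and_true]
  intro W₁ σ₁ _ h₁ e₁ W₂ σ₂ _ h₂ e₂
  rw [e₁] at h₁ 
  rw [e₂] at h₂
  rw [e₁, e₂]
  replace h₁ := allowed_os h₁
  replace h₂ := allowed_os h₂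
  have htt : Kn tt := known_constant (by simp [Sym.IsPrivate]) rfl _
  have hff : Kn ff := known_constant (by simp [Sym.IsPrivate]) rfl _
  have hbot : Kn bot := known_constant (by simp [Sym.IsPrivate]) rfl _
  have hps : Kn ps := known_constant (by simp [Sym.IsPrivate]) rfl _
  refine ⟨Or.inl ⟨known_os, KnownState.known ?_⟩, ?_⟩
  · refine ⟨hps, htt, hbot, h₁, h₂, hbot, hbot, hff, ps_destructorFree, Or.inr isChain_ps, ?_⟩
    have o₁ := h₁.obtainable hK
    have o₂ := h₂.obtainable hK
    have ob := hbot.obtainable hK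
    simp only [trans_pst, trans_tt, trans_ff, trans_bot, trans_ps, fixLock_ff] at ob ⊢
    have e : fixPcr Big ps = ps := by unfold fixPcr; split_ifs <;> rfl
    rw [e]
    -- The closure properties provide only the start state with empty memory. The chosen contents
    -- are brought in through the cache and flushed, which the open lock permits, and finally the
    -- cache is restored to `bot`.
    have s₁ := hK.app₁ (f := .cache) (by simp [Sym.IsPrivate]) (forall_vec₂ hK.start o₁)
      (.cache _ _ _ _ _ _)
    have s₂ := hK.app₁ (f := .flushStm) (by simp [Sym.IsPrivate]) (forall_vec₁ s₁)
      (.flushStm _ _ _ _ _ _ _)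
    have s₃ := hK.app₁ (f := .cache) (by simp [Sym.IsPrivate]) (forall_vec₂ s₂ o₂)
      (.cache _ _ _ _ _ _)
    have s₄ := hK.app₁ (f := .flushSmi) (by simp [Sym.IsPrivate]) (forall_vec₁ s₃)
      (.flushSmi _ _ _ _ _ _)
    exact hK.app₁ (f := .cache) (by simp [Sym.IsPrivate]) (forall_vec₂ s₄ ob)
      (.cache _ _ _ _ _ _)
  · intro W₃ σ₃ _ h₃ e₃ W₄ σ₄ _ h₄ e₄ W₅ σ₅ _ h₅ e₅
    exact Or.inl ⟨known_os, known_vec₄.2 ⟨known_constant (by simp [Sym.IsPrivate]) rfl _,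
      allowed_os h₃, allowed_os h₄, allowed_os h₅⟩⟩

open Classical in
-- The extension runs over a channel unknown to the attacker. Only the final state becomes public,
-- and it is known by `KnownState.init'`.
theorem ok_INIT (hK : Obtainable b K k₀ m₀) 
    (W : World) (ρ : Ident → Term) : (Γ₀).Ok b INIT W ρ := by
  simp only [INIT, Typing.Ok, Term.subst, Pat.subst, Pat.inst, comp_vecCons,
    comp_vecEmpty, mem_binders_cons, mem_binders_nil, mem_binders_var, mem_binders_eq,
    Function.update_apply, reduceCtorEq, or_false, false_or, if_true, if_false, or_true, true_or,
    nf_tup, nf_extendReq, nf_extendResp, nf_drtResp, nf_os, nf_prog, nf_entry, nf_h, nf_name, forall_eq_or_imp,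
    forall_eq, forall_eq', and_true]
  refine ⟨Or.inl ⟨known_os, .prog 0 (by omega)⟩, Or.inl ⟨known_os, .prog 1 (by omega)⟩, ?_⟩
  rintro W₁ σ hW₁ hall ⟨e₁, e₂, e₃, e₄⟩
  rw [e₁, e₂, e₃, e₄] at hall
  rw [e₁, e₂, e₃, e₄]
  obtain ⟨⟨p, i, c, m, a, d, e, hk, hdf, hs⟩, hc, hy⟩ := allowed_launch hall
  refine ⟨evaluable_app (by simp) _, fun hyf W₂ j hW₂ _ _ => ?_⟩
  rw [hs, hc]
  -- The data attached to the nonce are the untouched parts of the state and the register expected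
  -- in the reply.
  refine ⟨some (cpu ff c, smram m a, drt (prog Tinit) e tt,
    h (tup ![h (tup ![pd, tup ![h (prog Tinit), h m]]), h (σ .pp)])), ?_, ?_⟩
  · rw [e₄]
    exact Or.inr (.extendReq _ _ _ _ _ _ _ (Or.inr rfl) (Or.inr ⟨_, rfl⟩)
      (Function.update_self _ _ _))
  intro W₃ τ hW₃ hall' hs'
  refine ⟨evaluable_app (by simp) _, fun hVf => ?_⟩
  generalize hV : nf b _ = V at hVf
  rw [hVf.nf_eq]
  rw [hs'] at hall'
  obtain ⟨x₁, x₂, x₃, q, h₁, h₂⟩ := allowed_extendResp (Or.inr rfl) hall'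
  -- Worlds only grow, so the data recorded with the request are still there at the reply.
  rw [hW₃ _ _ (Function.update_self _ _ _)] at h₂
  cases h₂
  have hr := Rule.of_nf_eq hV hVf (by simp [Sym.IsDestructor])
    (forall_vec₃ (p := fun T => nf b T = T) hs' (nf_entry b 0) e₄)
  rw [h₁] at hr
  obtain ⟨x, y, z, e', l, h₃, rfl⟩ := hr.setPpEntry_inv
  simp [Term.app.injEq] at h₃
  obtain ⟨rfl, rfl, rfl, rfl, rfl⟩ := h₃
  have hV := ((known_pst.1 hk).init' hK hdf hy (destructorFree_h.1 hyf)).known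
  exact ⟨Or.inr (.drtResp _ _ _ ⟨0, by omega, rfl⟩ hV), Or.inl ⟨known_os, hV⟩⟩

/-- Two outputs need an argument: the decrypted message, and the final state, which is accounted for
when the module replies. -/
theorem ok_PP (hK : Obtainable b K k₀ m₀) (hB : ¬ Big hchain)
    (W : World) (ρ : Ident → Term) : (Γ₀).Ok b PP W ρ := by
  simp only [PP, Typing.Ok, Term.subst, Pat.subst, Pat.inst, comp_vecCons,
    comp_vecEmpty, mem_binders_cons, mem_binders_nil, mem_binders_var, mem_binders_eq,
    Function.update_apply, reduceCtorEq, or_false, false_or, if_true, if_false, or_true, true_or,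
    nf_tup, nf_extendReq, nf_extendResp, nf_unsealTag, nf_plainTag, nf_bot, nf_os, nf_prog,
    nf_entry, nf_name, forall_eq_or_imp, forall_eq, and_true]
  refine ⟨Or.inl ⟨known_os, .prog 2 (by omega)⟩, ?_⟩
  rintro W₁ σ hW₁ hall ⟨e₁, e₂⟩
  rw [e₁, e₂] at hall
  obtain ⟨hk, hc⟩ := allowed_run hall
  rw [e₂, hc]
  refine ⟨evaluable_app (by simp) _, fun s hs hsf => ?_⟩
  rw [hsf.nf_eq]
  have hr := Rule.of_nf_eq hs hsf (by simp [Sym.IsDestructor])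
    (forall_vec₃ (p := fun T => nf b T = T) e₁ (nf_entry b 2) (nf_tt b))
  obtain ⟨x, i, c, y, d, h₁, rfl⟩ := hr.setIntEntry_inv
  rw [h₁] at hk
  obtain ⟨p, i', c', m, a, d', e', l', rfl, h₂, rfl, h₃, hks⟩ := hk.state_inv
  simp [Term.app.injEq] at h₂ h₃
  obtain ⟨rfl, rfl⟩ := h₂
  obtain ⟨rfl, rfl, rfl⟩ := h₃
  have hks' := hks.ppInt hK hsf
  refine ⟨Or.inl ⟨known_os, hks'.known⟩, ?_⟩
  intro W₂ σ₂ hW₂ hb eb W₃ σ₃ hW₃ hy ey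
  rw [eb] at hb
  rw [ey] at hy
  replace hb := allowed_os hb
  replace hy := allowed_os hy
  rw [eb]
  refine ⟨Or.inr (.unsealTag _ hb), ?_⟩
  intro W₄ σ₄ hW₄ hk' ek
  rw [ek] at hk'
  replace hk' := allowed_plainTag hk'
  refine ⟨evaluable_app (by simp) _, fun M hM hMf => ?_⟩
  rw [hMf.nf_eq]
  have hMk : Kn M := by
    have h₄ := (Rule.of_nf_eq hM hMf (by simp [Sym.IsDestructor])
      (forall_vec₂ (p := fun T => nf b T = T) ey ek)).sdec_inv
    rw [h₄] at hy
    -- For the published ciphertext the key is `k₀`. It is known, and `K` contains the decryption,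
    -- or it was unsealed on the hidden channel, and the recorded state with register `hchain` gives
    -- the message by `unsealPp`.
    rcases hy.senc_inv with ⟨h₅, h₆⟩ | ⟨h₅, -⟩
    · rw [h₅]
      refine .name _ ?_
      rcases hk' with hk' | ⟨-, i₀, c₀, m₁, a₀, d₀, hk'⟩
      · rw [h₆] at hk'
        have := hk'.obtainable hK
        rw [trans_name] at this
        exact hK.app₁ (f := .sdec) (by simp [Sym.IsPrivate]) (forall_vec₂ hK.senc this) (.sdec _ _)
      · have o₁ := (known_pst.1 hk').obtainable
        have o₂ := hks'.obtainable
        have hd := trans_destructorFree (b := b) (Big := Big) hsf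
        simp only [trans_pst, trans_hchain, fixPcr_not_big hB, trans_prog, trans_entry, trans_tt,
          fixLock_tt] at o₁ o₂ hd
        exact hK.unsealPp hd o₁ o₂
    · exact h₅
  refine ⟨Or.inl ⟨known_os, hMk⟩, ?_⟩
  intro W₅ j hW₅ _ _
  -- Messages on the channel of the protected program are not indexed by nonces.
  refine ⟨none, Or.inr (.ppExtendReq _ _ _ _ _ _ hks'.known hsf), ?_⟩
  intro W₆ σ₆ hW₆ hx ex
  rw [ex] at hx
  obtain ⟨p', c', m', a', d', h₇, h₈⟩ := allowed_ppExtendResp hx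
  refine ⟨evaluable_app (by simp) _, fun V hV hVf => ?_⟩
  rw [hVf.nf_eq]
  have hr := Rule.of_nf_eq hV hVf (by simp [Sym.IsDestructor])
    (forall_vec₃ (p := fun T => nf b T = T) ex (nf_entry b 2) (nf_ff b))
  rw [h₇] at hr
  obtain ⟨x, y, z, d'', l, h₉, rfl⟩ := hr.setLockEntry_inv
  simp [Term.app.injEq] at h₉
  obtain ⟨rfl, rfl, rfl, rfl, rfl⟩ := h₉
  exact Or.inl ⟨known_os, h₈⟩

theorem ff_destructorFree : ff.DestructorFree :=
  destructorFree_constant (by simp [Sym.IsDestructor]) rfl _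

open Classical in
-- The replies to the two hidden requests are pinned down by the world. Afterwards the CPU hands a
-- known state to a known program, or a hidden state to a trusted one, and merely forwards what
-- comes back.
theorem ok_CPU (hK : Obtainable b K k₀ m₀)
    (W : World) (ρ : Ident → Term) : (Γ₀).Ok b CPU W ρ := by
  simp only [CPU, Typing.Ok, Term.subst, Pat.subst, Pat.inst, comp_vecCons,
    comp_vecEmpty, mem_binders_cons, mem_binders_nil, mem_binders_var, mem_binders_eq,
    Function.update_apply, reduceCtorEq, or_false, false_or, if_true, if_false, or_true, true_or,
    nf_tup, nf_drtReq, nf_drtResp, nf_extendReq, nf_extendResp, nf_resetReq, nf_resetResp,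
    nf_extChannel, nf_cpuTpm, nf_os, nf_prog, nf_h, nf_ff, nf_tpmCh,
    nf_entry, nf_name, forall_eq_or_imp, forall_eq, and_true, implies_true]
  rintro W₁ σ hW₁ hall ⟨ex, ey, es⟩ hl
  rw [ex, ey, es] at hall
  rw [ex, ey]
  obtain ⟨-, hx, hy, hs⟩ := known_vec₄.1 (allowed_os hall)
  have hlr := (Rule.of_nf_eq hl ff_destructorFree (by simp [Sym.IsDestructor])
    (forall_vec₁ (p := fun T => nf b T = T) es)).lock_inv
  generalize σ .pfState = s at *
  obtain ⟨x₁, x₂, x₃, d, e, rfl⟩ := hlr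
  obtain ⟨p, i, c, m, a, d', e', l', rfl, rfl, rfl, h₂, hks⟩ := hs.state_inv
  simp [Term.app.injEq] at h₂
  obtain ⟨rfl, rfl, rfl⟩ := h₂
  refine ⟨evaluable_app (by simp) _, fun V hV hVf => ?_⟩
  obtain ⟨_, _, _, _, _, h₃, rfl⟩ := (Rule.of_nf_eq hV hVf (by simp [Sym.IsDestructor])
    (forall_vec₃ (p := fun T => nf b T = T) es (nf_cpuAcc b) (nf_ff b))).setIntCpu_inv
  simp [Term.app.injEq] at h₃
  obtain ⟨rfl, ⟨rfl, rfl⟩, rfl, rfl⟩ := h₃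
  refine ⟨evaluable_app (by simp) _, fun V' hV' hVf' => ?_⟩
  obtain ⟨_, _, _, _, _, _, h₃, rfl⟩ := (Rule.of_nf_eq hV' hVf' (by simp [Sym.IsDestructor])
    (forall_vec₃ (p := fun T => nf b T = T) hVf.nf_eq (nf_cpuAcc b) (nf_tt b))).setLockCpu_inv
  simp [Term.app.injEq] at h₃
  obtain ⟨rfl, rfl, rfl, rfl, rfl, rfl⟩ := h₃
  rw [hVf'.nf_eq]
  have hmf := (destructorFree_pst.1 hVf).2.2.1.1
  rw [(Rule.stm _ _ _ _ _).nf_eq, hmf.nf_eq]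
  refine ⟨evaluable_app (by simp) _, fun w hw hwf W₂ j hW₂ hf _ => ?_⟩
  subst hw
  rw [hwf.nf_eq]
  -- One entry serves both requests: it fixes the state apart from the register, which is `pd` after
  -- the reset and the recorded value after the extension.
  refine ⟨some (cpu ff c, smram m a, drt d e tt,
    h (tup ![pd, tup ![h (σ .init), h m]])), ?_, ?_⟩
  · exact Or.inr (.resetReq _ _ _ _ _ _ (Function.update_self _ _ _))
  intro W₃ σ₃ hW₃ h₃ e₃
  rw [e₃] at h₃ ⊢
  obtain ⟨x₁, x₂, x₃, q, h₄, h₅⟩ := allowed_resetResp not_isEntry_cpuTpm not_known_cpuTpm h₃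
  rw [hW₃ _ _ (Function.update_self _ _ _)] at h₅
  cases h₅
  rw [h₄]
  refine ⟨Or.inr (.extendReq _ _ _ _ _ _ _ (Or.inl rfl) (Or.inl rfl)
    (hW₃ _ _ (Function.update_self _ _ _))), ?_⟩
  intro W₄ σ₄ hW₄ h₆ e₆
  rw [e₆] at h₆
  obtain ⟨x₁, x₂, x₃, q, h₇, h₈⟩ := allowed_extendResp (Or.inl rfl) h₆
  rw [hW₄ _ _ (hW₃ _ _ (Function.update_self _ _ _))] at h₈
  cases h₈
  rw [h₇] at e₆ ⊢
  refine ⟨evaluable_app (by simp) _, fun V'' hV'' hVf'' => ?_⟩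
  obtain ⟨_, _, _, _, _, _, h₉, rfl⟩ := (Rule.of_nf_eq hV'' hVf'' (by simp [Sym.IsDestructor])
    (forall_vec₃ (p := fun T => nf b T = T) e₆ (nf_cpuAcc b) ex)).setInit_inv
  simp only [Term.app.injEq, heq_eq_eq, true_and, Matrix.vecCons_inj, and_true] at h₉
  obtain ⟨rfl, rfl, rfl, rfl, rfl, rfl⟩ := h₉
  rw [hVf''.nf_eq]
  refine ⟨evaluable_app (by simp) _, fun x' hx' hxf => ?_⟩
  have hxe := (Rule.of_nf_eq hx' hxf (by simp [Sym.IsDestructor])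
    (forall_vec₁ (p := fun T => nf b T = T) ex)).getEntry_inv
  rw [hxf.nf_eq]
  generalize σ .init = x at *
  subst hxe
  have hIE : Kn x' ∨ IsEntry x' := hx.prog_inv.symm
  -- A program of the attacker receives the nonce, which is why the typing asks that generated
  -- nonces be obtainable.
  have hfn : Kn (.name ⟨.nonce, j⟩) := .name _ (hf.2.2 rfl)
  refine ⟨?_, Or.inr (.extChannel _ (hIE.symm.imp id fun h₁ => ⟨h₁, hxf⟩)), ?_⟩
  · rcases hIE with h₁ | h₁
    · exact Or.inl ⟨h₁, known_vec₄.2 ⟨hfn, (hks.launch hK hVf h₁ hxf).known, .tpmCh _ hxf h₁, hy⟩⟩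
    · refine Or.inr (.launch _ _ _ _ _ h₁ ?_)
      rintro rfl
      exact ⟨⟨_, _, _, _, _, _, _, hks.known, hVf, rfl⟩, rfl, hy⟩
  intro W₅ σ₅ hW₅ h₁₀ e₁₀
  rw [e₁₀] at h₁₀ ⊢
  have hs' := allowed_drtResp hIE h₁₀
  refine ⟨evaluable_app (by simp) _, fun f hf' hff => ?_⟩
  have hr := Rule.of_nf_app hf' hff (by simp [Sym.IsDestructor])
  simp only [comp_vecCons, comp_vecEmpty] at hr
  have hr' := hr.getEntry_inv
  obtain ⟨_, _, _, _, _, h₁₁⟩ := (Rule.of_nf_eq hr' (destructorFree_prog.2 hff)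
    (by simp [Sym.IsDestructor]) (forall_vec₁ (p := fun T => nf b T = T) e₁₀)).pp_inv
  rw [hff.nf_eq]
  have hpf : Kn (prog f) := by
    rw [h₁₁] at hs'
    obtain ⟨p, i, c, m, a, d', e', l', -, -, -, h₂, hks⟩ := hs'.state_inv
    simp only [Term.app.injEq, heq_eq_eq, true_and, Matrix.vecCons_inj, and_true] at h₂
    rw [h₂.2.1]
    exact hks.pp
  have hIE' : Kn f ∨ IsEntry f := hpf.prog_inv.symm
  refine ⟨?_, Or.inr (.extChannel _ (hIE'.symm.imp id fun h₁ => ⟨h₁, hff⟩))⟩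
  rcases hIE' with h₁ | h₁
  · exact Or.inl ⟨h₁, known_pair hs' (.tpmCh _ hff h₁)⟩
  · exact Or.inr (.run _ _ _ h₁ fun h₂ => ⟨hs', by rw [h₂]⟩)

/-- The platform is well typed. -/
theorem ok_platform (hK : Obtainable b K k₀ m₀) (hB : BigSpec b Big) (hB' : ¬ Big hchain)
    {ext : Proc} (he : ExtendOk b Big K k₀ m₀ ext) (W : World) (ρ : Ident → Term) :
    (Γ₀).Ok b (.par (TPM ext) EXEC) W ρ :=
  ⟨⟨ok_tpmReset hK hB W ρ, ok_tpmExtend he W ρ, ok_tpmUnseal hK hB' W ρ⟩,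
    ok_CPU hK W ρ, ok_INIT hK W ρ, ok_SETUP hK W ρ, ok_DATA W ρ, ok_PP hK hB' W ρ⟩

end PlatformTyping

/-! ### Executions of a platform driven by an environment -/

/-- A thread: a process with the values of its free variables. -/
abbrev Thread := (Ident → Term) × Proc

/-- Deducibility by an environment that has received the messages `E`. -/
def Ded (b : ℕ) (E : Set Term) (T : Term) : Prop :=
  Deduce b (E ∪ {T | ∃ n : Name, n.base ∉ platformNames ∧ T = .name n}) T

/-- Starting from the names in use, the messages received and the threads, the platform and its
environment can reach a situation described by `Φ`. -/
inductive Can (b : ℕ) (Φ : Set Name → Set Term → Multiset Thread → Prop) :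
    Set Name → Set Term → Multiset Thread → Prop
  | done {N E R} : Φ N E R → Can b Φ N E R
  | bang {N E R ρ P} : Can b Φ N E ((ρ, P) ::ₘ (ρ, .repl P) ::ₘ R) →
      Can b Φ N E ((ρ, .repl P) ::ₘ R)
  | par {N E R ρ P Q} : Can b Φ N E ((ρ, P) ::ₘ (ρ, Q) ::ₘ R) → Can b Φ N E ((ρ, .par P Q) ::ₘ R)
  | new {N E R ρ n P} (i : ℕ) : n ∈ platformNames → ⟨n, i⟩ ∉ N →
      Can b Φ (insert ⟨n, i⟩ N) E ((Function.update ρ n (.name ⟨n, i⟩), P) ::ₘ R) →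
      Can b Φ N E ((ρ, .new n P) ::ₘ R)
  | comm {N E R ρ δ U T P U' A Q} (σ : Ident → Term) :
      nf b (U.subst ρ) = nf b (U'.subst δ) → nf b (T.subst ρ) = nf b ((A.subst δ).inst σ) →
      (∀ x ∈ A.binders, nf b (σ x) = σ x) →
      Can b Φ N E ((ρ, P) ::ₘ (fun x => if x ∈ A.binders then σ x else δ x, Q) ::ₘ R) →
      Can b Φ N E ((ρ, .out U T P) ::ₘ (δ, .inp U' A Q) ::ₘ R)
  | iteTrue {N E R ρ U V P Q} : nf b (U.subst ρ) = nf b (V.subst ρ) →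
      Can b Φ N E ((ρ, P) ::ₘ R) → Can b Φ N E ((ρ, .ite U V P Q) ::ₘ R)
  | iteFalse {N E R ρ U V P Q} : nf b (U.subst ρ) ≠ nf b (V.subst ρ) →
      Can b Φ N E ((ρ, Q) ::ₘ R) → Can b Φ N E ((ρ, .ite U V P Q) ::ₘ R)
  | letIn {N E R ρ x T P} (V : Term) : nf b (T.subst ρ) = V → V.DestructorFree →
      Can b Φ N E ((Function.update ρ x V, P) ::ₘ R) → Can b Φ N E ((ρ, .letIn x T P) ::ₘ R)
  | recv {N E R ρ U A P} (σ : Ident → Term) : Ded b E (U.subst ρ) →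
      Ded b E ((A.subst ρ).inst σ) → (∀ x ∈ A.binders, nf b (σ x) = σ x) →
      Can b Φ N E ((fun x => if x ∈ A.binders then σ x else ρ x, P) ::ₘ R) →
      Can b Φ N E ((ρ, .inp U A P) ::ₘ R)
  | send {N E R ρ U T P} : Ded b E (U.subst ρ) →
      Can b Φ N (insert (nf b (T.subst ρ)) E) ((ρ, P) ::ₘ R) → Can b Φ N E ((ρ, .out U T P) ::ₘ R)

/-- Sequential composition of runs: the situation reached by the first is where the second starts.
-/
theorem Can.trans {b : ℕ} {Φ Ψ : Set Name → Set Term → Multiset Thread → Prop} {N : Set Name}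
    {E : Set Term} {R : Multiset Thread} (hc : Can b Φ N E R)
    (hΦ : ∀ N E R, Φ N E R → Can b Ψ N E R) : Can b Ψ N E R := by
  induction hc with
  | done h₁ => exact hΦ _ _ _ h₁
  | bang _ ih => exact .bang ih
  | par _ ih => exact .par ih
  | new i h₁ h₂ _ ih => exact .new i h₁ h₂ ih
  | comm σ h₁ h₂ h₃ _ ih => exact .comm σ h₁ h₂ h₃ ih
  | iteTrue h₁ _ ih => exact .iteTrue h₁ ih
  | iteFalse h₁ _ ih => exact .iteFalse h₁ ih
  | letIn V h₁ h₂ _ ih => exact .letIn V h₁ h₂ ih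
  | recv σ h₁ h₂ h₃ _ ih => exact .recv σ h₁ h₂ h₃ ih
  | send h₁ _ ih => exact .send h₁ ih

/-! ### Attackers that follow a given strategy -/

/-- The variables that hold the first `k` messages received. -/
def auxVars (k : ℕ) : Set Ident := {x | ∃ i < k, x = .aux i}

/-- Terms that the attacker can write down after having received `k` messages. -/
structure IsRecipe (k : ℕ) (T : Term) : Prop where
  isPublic : ∀ f ∈ T.syms, ¬ f.IsPrivate
  names : ∀ n ∈ T.names, n.base ∉ platformNames
  vars : T.vars ⊆ auxVars k

/-- Processes that the attacker can run after having received `k` messages. -/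
structure IsStrategy (k : ℕ) (Q : Proc) : Prop where
  isPublic : ∀ T ∈ Q.terms, ∀ f ∈ T.syms, ¬ f.IsPrivate
  names : ∀ T ∈ Q.terms, ∀ n ∈ T.names, n.base ∉ platformNames
  restricted : Q.restricted = ∅
  vars : Q.freeVars ⊆ auxVars k

/-- The messages `E` are held by the first `k` variables. -/
structure Holds (ρ : Ident → Term) (k : ℕ) (E : Set Term) : Prop where
  isEnv : IsEnv ρ
  closed : ∀ i < k, (ρ (.aux i)).Closed
  holds : ∀ T ∈ E, ∃ i < k, ρ (.aux i) = T

/-- A deduction is replayed as a term over the variables holding the received messages, since an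
attacker process can only write such terms. -/
theorem Ded.exists_recipe {b : ℕ} {E : Set Term} {T : Term} (hT : Ded b E T) {ρ : Ident → Term}
    {k : ℕ} (hρ : Holds ρ k E) : ∃ R, IsRecipe k R ∧ nf b (R.subst ρ) = nf b T := by
  induction hT with
  | known hT' he =>
    rw [eqE_iff] at he
    rcases hT' with hT' | ⟨n, hn, rfl⟩
    · obtain ⟨i, hi, e⟩ := hρ.holds _ hT'
      refine ⟨.var (.aux i), ⟨?_, ?_, ?_⟩, by rw [Term.subst, e, he]⟩
      · simp [Term.syms]
      · simp [Term.names]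
      · rintro x rfl
        exact ⟨i, hi, rfl⟩
    · refine ⟨.name n, ⟨?_, ?_, ?_⟩, he⟩
      · simp [Term.syms]
      · simpa [Term.names] using hn
      · simp [Term.vars]
  | apply f args hf _ he ih =>
    choose R hR e using ih
    refine ⟨.app f R, ⟨?_, ?_, ?_⟩, ?_⟩
    · simp only [Term.syms, Set.singleton_union, Set.mem_insert_iff, Set.mem_iUnion,
        forall_eq_or_imp, forall_exists_index]
      exact ⟨hf, fun g i hg => (hR i).isPublic g hg⟩
    · simp only [Term.names, Set.mem_iUnion, forall_exists_index]
      exact fun n i hn => (hR i).names n hn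
    · simp only [Term.vars, Set.iUnion_subset_iff]
      exact fun i => (hR i).vars
    · rw [← eqE_iff.1 he, Term.subst, nf, nf]
      simp only [e]

theorem Holds.closed_subst {ρ : Ident → Term} {k : ℕ} {E : Set Term} (hρ : Holds ρ k E) {R : Term}
    (hR : IsRecipe k R) : (R.subst ρ).Closed :=
  Term.closed_subst fun x hx => by
    obtain ⟨i, hi, rfl⟩ := hR.vars hx
    exact hρ.closed i hi

theorem deduce_os {b : ℕ} {M : Set Term} : Deduce b M os :=
  .apply .os _ (by simp [Sym.IsPrivate]) (fun i => i.elim0) (eqE_iff.2 rfl)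

theorem isRecipe_os {k : ℕ} : IsRecipe k os := by
  refine ⟨?_, ?_, ?_⟩ <;> simp [Term.syms, Term.names, Term.vars, Sym.IsPrivate]

theorem IsStrategy.out {k : ℕ} {U T : Term} {Q : Proc} (hU : IsRecipe k U) (hT : IsRecipe k T)
    (hQ : IsStrategy k Q) : IsStrategy k (.out U T Q) where
  isPublic := by
    rintro S ((rfl | rfl) | hS)
    exacts [hU.isPublic, hT.isPublic, hQ.isPublic S hS]
  names := by
    rintro S ((rfl | rfl) | hS)
    exacts [hU.names, hT.names, hQ.names S hS]
  restricted := hQ.restricted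
  vars := Set.union_subset (Set.union_subset hU.vars hT.vars) hQ.vars

/-- Strategies are assembled from the last action backwards; the new variable of index `k` is
available to the rest and bound here. -/
theorem IsStrategy.inp {k : ℕ} {U : Term} {Q : Proc} (hU : IsRecipe k U)
    (hQ : IsStrategy (k + 1) Q) : IsStrategy k (.inp U (.var (.aux k)) Q) where
  isPublic := by
    rintro S ((rfl | hS) | hS)
    exacts [hU.isPublic, by simp [Pat.terms] at hS, hQ.isPublic S hS]
  names := by
    rintro S ((rfl | hS) | hS)
    exacts [hU.names, by simp [Pat.terms] at hS, hQ.names S hS]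
  restricted := hQ.restricted
  vars := by
    rintro x ((hx | hx) | ⟨hx, hx'⟩)
    · exact hU.vars hx
    · simp [Pat.terms] at hx
    · obtain ⟨i, hi, rfl⟩ := hQ.vars hx
      refine ⟨i, ?_, rfl⟩
      have : i ≠ k := by rintro rfl; simp [Pat.binders] at hx'
      omega

theorem isStrategy_nil {k : ℕ} : IsStrategy k .nil := by
  refine ⟨?_, ?_, ?_, ?_⟩ <;> simp [Proc.terms, Proc.restricted, Proc.freeVars]

theorem IsStrategy.par {k : ℕ} {P Q : Proc} (hP : IsStrategy k P) (hQ : IsStrategy k Q) :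
    IsStrategy k (.par P Q) where
  isPublic := by
    rintro S (hS | hS)
    exacts [hP.isPublic S hS, hQ.isPublic S hS]
  names := by
    rintro S (hS | hS)
    exacts [hP.names S hS, hQ.names S hS]
  restricted := by simp [Proc.restricted, hP.restricted, hQ.restricted]
  vars := Set.union_subset hP.vars hQ.vars

/-- The processes of the threads. -/
def Thread.proc (t : Thread) : Proc := t.2.subst t.1

/-- What the environment can obtain, an attacker can obtain by following a strategy. -/
theorem Can.exists_strategy {b : ℕ} {T : Term} {N : Set Name} {E : Set Term}
    {R : Multiset Thread} (hc : Can b (fun _ E _ => Ded b E T) N E R)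
    (hR : ∀ t ∈ R, Interprets t.1 t.2) {ρ : Ident → Term} {k : ℕ} (hρ : Holds ρ k E) :
    ∃ Q, IsStrategy k Q ∧ ∀ N' M, (∀ x ∈ N', x.base ∈ platformNames → x ∈ N) →
      ∃ c, Relation.ReflTransGen (Step b) ⟨N', M, Q.subst ρ ::ₘ R.map Thread.proc⟩ c ∧
        Deduce b c.known T := by
  induction hc generalizing ρ k with
  | @done N E R h₁ =>
    obtain ⟨S, hS, e⟩ := h₁.exists_recipe hρ
    -- To make the target term known, the attacker sends it to itself on the public channel `os`.
    -- The earlier content of `M` plays no role, as messages are kept in variables.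
    refine ⟨.par (.out os S .nil) (.inp os (.var (.aux k)) .nil),
      (isStrategy_nil.out isRecipe_os hS).par (isStrategy_nil.inp isRecipe_os), fun N' M _ => ?_⟩
    refine ⟨_, (Relation.ReflTransGen.single (.par _ _ _ _ _)).tail
      (.comm N' M (insert (S.subst ρ) M) _ _ _ _ _ _ _ (fun _ => nf b T)
        (eqE_iff.2 rfl) (eqE_iff.2 ?_) ?_ (fun _ => rfl) fun hn => absurd (deduce_os (b := b) (M := M)) ?_), ?_⟩
    · rw [e, Pat.subst, Pat.inst, nf_nf]
    · exact fun _ _ => irreducible_nf _ _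
    · simpa [Term.subst, comp_vecEmpty] using hn
    · exact .known (Set.mem_insert _ _) (eqE_iff.2 e)
  | @bang N E R δ P hc ih =>
    simp only [Multiset.mem_cons, forall_eq_or_imp] at hR ih
    obtain ⟨Q, hQ, hr⟩ := ih ⟨hR.1.repl, hR⟩ hρ
    refine ⟨Q, hQ, fun N' M hN => ?_⟩
    obtain ⟨c, h₁, h₂⟩ := hr N' M hN
    refine ⟨c, .head ?_ h₁, h₂⟩
    simp only [Multiset.map_cons, Multiset.cons_swap (Q.subst ρ), Thread.proc, Proc.subst]
    exact .bang _ _ _ _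
  | @par N E R δ P P' hc ih =>
    simp only [Multiset.mem_cons, forall_eq_or_imp] at hR ih
    obtain ⟨Q, hQ, hr⟩ := ih ⟨hR.1.parLeft, hR.1.parRight, hR.2⟩ hρ
    refine ⟨Q, hQ, fun N' M hN => ?_⟩
    obtain ⟨c, h₁, h₂⟩ := hr N' M hN
    refine ⟨c, .head ?_ h₁, h₂⟩
    simp only [Multiset.map_cons, Multiset.cons_swap (Q.subst ρ), Thread.proc, Proc.subst]
    exact .par _ _ _ _ _
  | @new N E R δ n P i hn hi hc ih =>
    simp only [Multiset.mem_cons, forall_eq_or_imp] at hR ih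
    obtain ⟨Q, hQ, hr⟩ := ih ⟨hR.1.new _, hR.2⟩ hρ
    refine ⟨Q, hQ, fun N' M hN => ?_⟩
    obtain ⟨c, h₁, h₂⟩ := hr (insert ⟨n, i⟩ N') M (by
      rintro x (rfl | hx) hb
      · exact Set.mem_insert _ _
      · exact Set.mem_insert_of_mem _ (hN x hx hb))
    refine ⟨c, .head ?_ h₁, h₂⟩
    simp only [Multiset.map_cons, Multiset.cons_swap (Q.subst ρ), Thread.proc, Proc.subst]
    rw [← Proc.subst_update P hR.1.isEnv n (.name ⟨n, i⟩)]
    exact .new _ _ _ _ _ _ fun hx => hi (hN _ hx hn)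
  | @comm N E R δ δ' U S P U' A P' σ hU hS hσ hc ih =>
    simp only [Multiset.mem_cons, forall_eq_or_imp] at hR ih
    obtain ⟨Q, hQ, hr⟩ := ih ⟨hR.1.out, hR.2.1.inp hR.1.out_closed hS
      fun x hx => irreducible_iff_nf_eq.2 (hσ x hx), hR.2.2⟩ hρ
    refine ⟨Q, hQ, fun N' M hN => ?_⟩
    obtain ⟨M', hM₁, hM₂⟩ : ∃ M' : Set Term, (Deduce b M (U.subst δ) → M' = insert (S.subst δ) M) ∧
        (¬ Deduce b M (U.subst δ) → M' = M) := by
      by_cases hd : Deduce b M (U.subst δ)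
      · exact ⟨_, fun _ => rfl, fun h => absurd hd h⟩
      · exact ⟨_, fun h => absurd h hd, fun _ => rfl⟩
    obtain ⟨c, h₁, h₂⟩ := hr N' M' hN
    refine ⟨c, .head ?_ h₁, h₂⟩
    simp only [Multiset.map_cons, Multiset.cons_swap (Q.subst ρ), Thread.proc, Proc.subst]
    rw [← Proc.subst_binders P' hR.2.1.isEnv A.binders σ, ← A.binders_subst δ']
    refine .comm _ _ _ _ _ _ _ _ _ _ _ (eqE_iff.2 hU) (eqE_iff.2 hS) ?_ hM₁ hM₂
    rw [A.binders_subst]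
    exact fun x hx => irreducible_iff_nf_eq.2 (hσ x hx)
  | @iteTrue N E R δ U V P P' hU hc ih =>
    simp only [Multiset.mem_cons, forall_eq_or_imp] at hR ih
    obtain ⟨Q, hQ, hr⟩ := ih ⟨hR.1.iteLeft, hR.2⟩ hρ
    refine ⟨Q, hQ, fun N' M hN => ?_⟩
    obtain ⟨c, h₁, h₂⟩ := hr N' M hN
    refine ⟨c, .head ?_ h₁, h₂⟩
    simp only [Multiset.map_cons, Multiset.cons_swap (Q.subst ρ), Thread.proc, Proc.subst]
    exact .iteTrue _ _ _ _ _ _ _ (eqE_iff.2 hU)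
  | @iteFalse N E R δ U V P P' hU hc ih =>
    simp only [Multiset.mem_cons, forall_eq_or_imp] at hR ih
    obtain ⟨Q, hQ, hr⟩ := ih ⟨hR.1.iteRight, hR.2⟩ hρ
    refine ⟨Q, hQ, fun N' M hN => ?_⟩
    obtain ⟨c, h₁, h₂⟩ := hr N' M hN
    refine ⟨c, .head ?_ h₁, h₂⟩
    simp only [Multiset.map_cons, Multiset.cons_swap (Q.subst ρ), Thread.proc, Proc.subst]
    exact .iteFalse _ _ _ _ _ _ _ fun e => hU (eqE_iff.1 e)
  | @letIn N E R δ x S P V hV hVf hc ih =>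
    subst hV
    simp only [Multiset.mem_cons, forall_eq_or_imp] at hR ih
    obtain ⟨Q, hQ, hr⟩ := ih ⟨hR.1.letIn, hR.2⟩ hρ
    refine ⟨Q, hQ, fun N' M hN => ?_⟩
    obtain ⟨c, h₁, h₂⟩ := hr N' M hN
    refine ⟨c, .head ?_ h₁, h₂⟩
    simp only [Multiset.map_cons, Multiset.cons_swap (Q.subst ρ), Thread.proc, Proc.subst]
    rw [← Proc.subst_update P hR.1.isEnv x (nf b (S.subst δ))]
    exact .letIn _ _ _ _ _ _ _ (normalForm_iff.2 rfl) hVf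
  | @recv N E R δ U A P σ hU hS hσ hc ih =>
    simp only [Multiset.mem_cons, forall_eq_or_imp] at hR ih
    obtain ⟨X, hX, e⟩ := hU.exists_recipe hρ
    obtain ⟨Y, hY, e'⟩ := hS.exists_recipe hρ
    obtain ⟨Q, hQ, hr⟩ := ih ⟨hR.1.inp (hρ.closed_subst hY) e'
      fun x hx => irreducible_iff_nf_eq.2 (hσ x hx), hR.2⟩ hρ
    refine ⟨.out X Y Q, hQ.out hX hY, fun N' M hN => ?_⟩
    obtain ⟨M', hM₁, hM₂⟩ : ∃ M' : Set Term, (Deduce b M (X.subst ρ) → M' = insert (Y.subst ρ) M) ∧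
        (¬ Deduce b M (X.subst ρ) → M' = M) := by
      by_cases hd : Deduce b M (X.subst ρ)
      · exact ⟨_, fun _ => rfl, fun h => absurd hd h⟩
      · exact ⟨_, fun h => absurd h hd, fun _ => rfl⟩
    obtain ⟨c, h₁, h₂⟩ := hr N' M' hN
    refine ⟨c, .head ?_ h₁, h₂⟩
    simp only [Multiset.map_cons, Thread.proc, Proc.subst]
    rw [← Proc.subst_binders P hR.1.isEnv A.binders σ, ← A.binders_subst δ]
    refine .comm _ _ _ _ _ _ _ _ _ _ _ (eqE_iff.2 e) (eqE_iff.2 e') ?_ hM₁ hM₂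
    rw [A.binders_subst]
    exact fun x hx => irreducible_iff_nf_eq.2 (hσ x hx)
  | @send N E R δ U S P hU hc ih =>
    simp only [Multiset.mem_cons, forall_eq_or_imp] at hR ih
    obtain ⟨X, hX, e⟩ := hU.exists_recipe hρ
    have hS : (nf b (S.subst δ)).Closed := hR.1.out_closed.nf
    obtain ⟨Q, hQ, hr⟩ := ih ⟨hR.1.out, hR.2⟩
      -- The message received is stored in normal form in the next unused variable.
      (ρ := fun x => if x ∈ (Pat.var (.aux k)).binders then nf b (S.subst δ) else ρ x) (k := k + 1) (by
        refine ⟨fun x => ?_, fun i hi => ?_, ?_⟩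
        · split_ifs
          · exact Or.inl hS
          · exact hρ.isEnv x
        · split_ifs with hik
          · exact hS
          · refine hρ.closed i ?_
            have : i ≠ k := by rintro rfl; simp [Pat.binders] at hik
            omega
        · rintro S' (rfl | hS')
          · exact ⟨k, by omega, by simp [Pat.binders]⟩
          · obtain ⟨i, hi, e⟩ := hρ.holds S' hS'
            refine ⟨i, by omega, ?_⟩
            rw [if_neg, e]
            simp only [Pat.binders, Finset.mem_singleton, Ident.aux.injEq]
            omega)
    refine ⟨.inp X (.var (.aux k)) Q, hQ.inp hX, fun N' M hN => ?_⟩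
    obtain ⟨M', hM₁, hM₂⟩ : ∃ M' : Set Term, (Deduce b M (U.subst δ) → M' = insert (S.subst δ) M) ∧
        (¬ Deduce b M (U.subst δ) → M' = M) := by
      by_cases hd : Deduce b M (U.subst δ)
      · exact ⟨_, fun _ => rfl, fun h => absurd hd h⟩
      · exact ⟨_, fun h => absurd h hd, fun _ => rfl⟩
    obtain ⟨c, h₁, h₂⟩ := hr N' M' hN
    refine ⟨c, .head ?_ h₁, h₂⟩
    simp only [Multiset.map_cons, Thread.proc, Proc.subst]
    rw [Multiset.cons_swap (Proc.inp _ _ _), Multiset.cons_swap (Proc.subst _ Q),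
      ← Proc.subst_binders Q hρ.isEnv (Pat.var (.aux k)).binders fun _ => nf b (S.subst δ)]
    refine .comm _ _ _ _ _ _ _ _ _ _ (fun _ => nf b (S.subst δ)) (eqE_iff.2 e.symm)
      (eqE_iff.2 ?_) ?_ hM₁ hM₂
    · rw [Pat.subst, Pat.inst, nf_nf]
    · exact fun _ _ => irreducible_nf _ _

/-- At the start no message is held, so the strategy is a closed process; it restricts no names and
uses none of the names of the platform. -/
theorem att_of_can {b : ℕ} {P : Proc} {T : Term} (hv : P.freeVars = ∅) (hn : P.names = ∅)
    (hr : P.restricted ⊆ platformNames)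
    (hc : Can b (fun _ E _ => Ded b E T) ∅ ∅ {(.var, P)}) : T ∈ Att b P := by
  obtain ⟨Q, hQ, hs⟩ := hc.exists_strategy (ρ := .var) (k := 0)
    (by simp only [Multiset.mem_singleton, forall_eq]; exact ⟨fun x => Or.inr rfl, by simp [hv]⟩)
    ⟨fun x => Or.inr rfl, by simp, by simp⟩
  refine ⟨Q, ⟨?_, ?_, ?_, ?_⟩, ?_⟩
  · exact Set.eq_empty_of_forall_notMem fun x hx => by
      obtain ⟨i, hi, -⟩ := hQ.vars hx
      omega
  · intro f hf
    obtain ⟨S, hS, hf⟩ := Set.mem_iUnion₂.1 hf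
    exact hQ.isPublic S hS f hf
  · intro n hn' hb
    obtain ⟨S, hS, hn'⟩ := Set.mem_iUnion₂.1 hn'
    exact hQ.names S hS n hn' (hr hb)
  · simp [hQ.restricted]
  · obtain ⟨c, h₁, h₂⟩ := hs (Proc.par P Q).names ∅ (by
      intro x hx hb
      obtain ⟨S, hS, hx⟩ := Set.mem_iUnion₂.1 hx
      rcases hS with hS | hS
      · exact absurd (Set.mem_biUnion hS hx) (by rw [← Proc.names, hn]; simp)
      · exact absurd hb (hQ.names S hS x hx))
    refine ⟨c, .head (.par _ _ 0 P Q) ?_, h₂⟩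
    simpa only [Proc.subst_var, Multiset.map_singleton, Multiset.map_cons, Multiset.map_zero,
      Thread.proc, ← Multiset.cons_zero, Multiset.cons_swap Q] using h₁

/-! ### Deducibility by the environment -/

section Ded

variable {b : ℕ} {E E' : Set Term} {T T' : Term}

theorem Ded.congr (hT : Ded b E T) (he : nf b T = nf b T') : Ded b E T' := by
  cases hT with
  | known h₁ h₂ => exact .known h₁ (eqE_iff.2 ((eqE_iff.1 h₂).trans he))
  | apply f args h₁ h₂ h₃ => exact .apply f args h₁ h₂ (eqE_iff.2 ((eqE_iff.1 h₃).trans he))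

theorem ded_nf : Ded b E (nf b T) ↔ Ded b E T :=
  ⟨fun h₁ => h₁.congr (nf_nf b T), fun h₁ => h₁.congr (nf_nf b T).symm⟩

theorem Ded.mono (hT : Ded b E T) (hE : E ⊆ E') : Ded b E' T := by
  induction hT with
  | known h₁ h₂ => exact .known (h₁.imp (fun h => hE h) id) h₂
  | apply f args h₁ _ h₃ ih => exact .apply f args h₁ ih h₃

theorem ded_of_mem (hT : T ∈ E) : Ded b E T := .known (Or.inl hT) (eqE_iff.2 rfl)

theorem ded_name {n : Name} (hn : n.base ∉ platformNames) : Ded b E (.name n) :=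
  .known (Or.inr ⟨n, hn, rfl⟩) (eqE_iff.2 rfl)

theorem ded_app {f : Sym} {args : Fin f.arity → Term} (hf : ¬ f.IsPrivate)
    (ha : ∀ i, Ded b E (args i)) : Ded b E (.app f args) :=
  .apply f args hf ha (eqE_iff.2 rfl)

theorem ded_constant {f : Sym} (hf : ¬ f.IsPrivate) (ha : f.arity = 0)
    (args : Fin f.arity → Term) : Ded b E (.app f args) :=
  ded_app hf fun i => absurd i.isLt (by omega)

theorem ded_os : Ded b E os := ded_constant (by simp [Sym.IsPrivate]) rfl _

theorem ded_subst_os {ρ : Ident → Term} : Ded b E (os.subst ρ) :=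
  ded_constant (by simp [Sym.IsPrivate]) rfl _

theorem ded_bot : Ded b E bot := ded_constant (by simp [Sym.IsPrivate]) rfl _

theorem ded_of_rule {f : Sym} {args : Fin f.arity → Term} (hf : ¬ f.IsPrivate)
    (ha : ∀ i, Ded b E (args i)) (hr : Rule b (.app f args) T) : Ded b E T :=
  (ded_app hf ha).congr hr.nf_eq

theorem ded_tup {n : ℕ} {args : Fin n → Term} :
    Ded b E (tup args) ↔ ∀ i, Ded b E (args i) := by
  refine ⟨fun h₁ i => ?_, fun h₁ => ded_app (by simp [Sym.IsPrivate]) h₁⟩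
  exact ded_of_rule (f := .proj n i) (by simp [Sym.IsPrivate]) (forall_vec₁ h₁) (.proj args i)

theorem ded_vec₂ {x y : Term} : Ded b E (tup ![x, y]) ↔ Ded b E x ∧ Ded b E y := by
  simp [ded_tup, forall_vecCons]

theorem ded_vec₃ {x y z : Term} :
    Ded b E (tup ![x, y, z]) ↔ Ded b E x ∧ Ded b E y ∧ Ded b E z := by
  simp [ded_tup, forall_vecCons]

theorem ded_vec₄ {x y z w : Term} :
    Ded b E (tup ![x, y, z, w]) ↔ Ded b E x ∧ Ded b E y ∧ Ded b E z ∧ Ded b E w := by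
  simp [ded_tup, forall_vecCons]

end Ded

/-! ### The services of the platform -/

section Services

variable {b : ℕ} {Φ : Set Name → Set Term → Multiset Thread → Prop} {N : Set Name} {E : Set Term}
  {R : Multiset Thread}

/-- A replicated thread survives its use, so the collection of services never shrinks. -/
theorem Can.spawn {ρ : Ident → Term} {P : Proc} (hm : (ρ, .repl P) ∈ R)
    (hc : Can b Φ N E ((ρ, P) ::ₘ R)) : Can b Φ N E R := by
  obtain ⟨R', rfl⟩ := Multiset.exists_cons_of_mem hm
  exact .bang hc

theorem Can.of_eq {R' : Multiset Thread} (hc : Can b Φ N E R') (he : R = R') : Can b Φ N E R :=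
  he ▸ hc

theorem Can.recvVar {ρ : Ident → Term} {U : Term} {x : Ident} {P : Proc} (T : Term)
    (hU : Ded b E (U.subst ρ)) (hT : Ded b E T) (hn : nf b T = T)
    (hc : Can b Φ N E ((Function.update ρ x T, P) ::ₘ R)) :
    Can b Φ N E ((ρ, inVar U x P) ::ₘ R) := by
  refine .recv (fun _ => T) hU hT (fun _ _ => hn) (hc.of_eq ?_)
  congr 2
  funext y
  simp only [mem_binders_var, Function.update_apply]

/-- The permanent threads of the platform. -/
def services (ext : Proc) : Set Thread :=
  {(.var, .repl tpmReset), (.var, .repl (tpmExtend ext)), (.var, .repl tpmUnseal), (.var, CPU),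
    (.var, .repl INIT), (.var, .repl PP)}

/-- The threads include the permanent threads of the platform. -/
def Serves (ext : Proc) (R : Multiset Thread) : Prop := ∀ t ∈ services ext, t ∈ R

theorem Serves.cons {ext : Proc} (hR : Serves ext R) (t : Thread) : Serves ext (t ::ₘ R) :=
  fun s hs => Multiset.mem_cons_of_mem (hR s hs)

theorem Serves.mono {ext : Proc} (hR : Serves ext R) {R' : Multiset Thread} (hle : R ≤ R') :
    Serves ext R' :=
  fun s hs => Multiset.mem_of_le hle (hR s hs)

/-- The last step of an extension of the register. -/
def extendReply : Proc := .out (vr .ch) (tup ![extendResp, vr .nonce, vr .newSt]) .nil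

variable (b) in
/-- The process serves a request for an extension of the register. -/
def ExtendRuns (ext : Proc) : Prop :=
  ∃ body, ext = inTup (vr .ch) ![.eq extendReq, .var .nonce, .var .pfState, .var .val] body ∧
    ∀ {Φ N E R} {ρ : Ident → Term} {p x y z : Term}, ρ .pfState = state (tpm p) x y z →
      IsChain p → (state (tpm p) x y z).DestructorFree → (ρ .val).DestructorFree →
      (∀ ρ' E', E ⊆ E' → ρ' .ch = ρ .ch → ρ' .nonce = ρ .nonce →
        ρ' .newSt = state (tpm (h (tup ![p, ρ .val]))) x y z →
        Can b Φ N E' ((ρ', extendReply) ::ₘ R)) →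
      Can b Φ N E ((ρ, body) ::ₘ R)

theorem destructorFree_extend {p x y z v : Term} (hs : (state (tpm p) x y z).DestructorFree)
    (hv : v.DestructorFree) : (state (tpm (h (tup ![p, v]))) x y z).DestructorFree := by
  rw [destructorFree_state] at hs ⊢
  exact ⟨destructorFree_h.2 (destructorFree_pair.2 ⟨hs.1, hv⟩), hs.2⟩

theorem extendRuns_pcrExtend : ExtendRuns b pcrExtend := by
  refine ⟨_, rfl, fun {Φ N E R ρ p x y z} hs hp hsf hvf hc => ?_⟩
  refine .letIn (state (tpm (h (tup ![p, ρ .val]))) x y z) ?_ (destructorFree_extend hsf hvf)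
    (hc _ E subset_rfl ?_ ?_ ?_)
  · simp only [Term.subst, comp_vecCons, comp_vecEmpty, hs]
    rw [(Rule.extend _ _ _ _ _).nf_eq, (destructorFree_extend hsf hvf).nf_eq]
  all_goals simp

/-- Surplus extensions are put into the initial value. -/
theorem HasLength.of_chain {n : ℕ} {v : Term} {l : List Term} (hl : n ≤ l.length) :
    HasLength n (chain v l) := by
  refine ⟨chain v (l.take (l.length - n)), l.drop (l.length - n), by simp; omega, ?_⟩
  rw [chain, chain, chain, ← List.foldl_append, List.take_append_drop]

theorem nf_isBig {p : Term} (hp : HasLength (b + 1) p) : nf b (isBig p) = tt := by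
  obtain ⟨v, l, hl, rfl⟩ := hp
  rw [(Rule.isBig v l hl).nf_eq, nf_tt]

/-- A chain that fails the small test has at least `b` extensions, so its honest extension passes
the big test. The environment computes it from the published pair and returns it. -/
theorem extendRuns_pcrExtendBounded : ExtendRuns b pcrExtendBounded := by
  refine ⟨_, rfl, fun {Φ N E R ρ p x y z} hs hp hsf hvf hc => ?_⟩
  have hef := destructorFree_extend hsf hvf
  have hpf := (destructorFree_state.1 hsf).1
  refine .letIn p ?_ hpf ?_
  · simp only [Term.subst, comp_vecCons, comp_vecEmpty, hs]
    rw [(Rule.pcr _ _ _ _).nf_eq, hpf.nf_eq]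
  by_cases hsm : nf b (isSmall p) = tt
  · refine .iteTrue ?_ (.letIn (state (tpm (h (tup ![p, ρ .val]))) x y z) ?_ hef
      (hc _ E subset_rfl ?_ ?_ ?_))
    · simpa only [Term.subst, comp_vecCons, comp_vecEmpty, Function.update_self, nf_tt] using hsm
    · simp only [Term.subst, comp_vecCons, comp_vecEmpty, hs, Function.update_apply, reduceCtorEq,
        if_false]
      rw [(Rule.extend _ _ _ _ _).nf_eq, hef.nf_eq]
    all_goals simp
  -- Here it matters that the register is a chain on a reset value: only then does failing `isSmall`
  -- give a lower bound for its length.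
  · have hl : HasLength (b + 1) (h (tup ![p, ρ .val])) := by
      obtain ⟨v₀, l, hv, rfl⟩ := hp
      rw [← chain_append_singleton]
      refine .of_chain ?_
      by_contra hlt
      exact hsm (nf_isSmall rfl hv (by simpa using hlt))
    have hhf : (h (tup ![p, ρ .val])).DestructorFree := (destructorFree_state.1 hef).1
    -- The environment receives the register and the value, and answers with the hash of the pair.
    refine .iteFalse ?_ (.send ded_subst_os (.recvVar (h (tup ![p, ρ .val])) ded_subst_os ?_ hhf.nf_eq
      (.iteTrue ?_ (.letIn (state (tpm (h (tup ![p, ρ .val]))) x y z) ?_ hef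
        (hc _ _ (Set.subset_insert _ _) ?_ ?_ ?_)))))
    · simpa only [Term.subst, comp_vecCons, comp_vecEmpty, Function.update_self, nf_tt] using hsm
    · refine ded_app (by simp [Sym.IsPrivate]) (forall_vec₁ (ded_of_mem (Or.inl ?_)))
      simp only [Term.subst, comp_vecCons, comp_vecEmpty, Function.update_apply, reduceCtorEq,
        if_true, if_false, nf_tup, hpf.nf_eq, hvf.nf_eq]
    · simpa only [Term.subst, comp_vecCons, comp_vecEmpty, Function.update_self, nf_tt]
        using nf_isBig hl
    · simp only [Term.subst, comp_vecCons, comp_vecEmpty, hs, Function.update_apply, reduceCtorEq,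
        if_false, if_true]
      rw [(Rule.setPcr _ _ _ _ _).nf_eq, hef.nf_eq]
    all_goals simp

end Services

/-! ### Extension, reset and launch as single moves -/

section Services

variable {b : ℕ} {Φ : Set Name → Set Term → Multiset Thread → Prop} {N : Set Name} {E : Set Term}
  {R : Multiset Thread} {ext : Proc}

/-- The environment that results from an input with a single variable. -/
theorem update_of_binders {A : Pat} {δ : Ident → Term} {z : Ident} {T : Term}
    (hA : ∀ x, x ∈ A.binders ↔ x = z) :
    (fun x => if x ∈ A.binders then T else δ x) = Function.update δ z T := by
  funext x
  simp only [hA, Function.update_apply]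

/-- Extension of the register on behalf of the environment. -/
theorem Can.extendEnv (he : ExtendRuns b ext) {ρ : Ident → Term} {p x y z v : Term}
    (hch : Ded b E (ρ .ch)) (hs : Ded b E (state (tpm p) x y z)) (hv : Ded b E v)
    (hp : IsChain p) (hsf : (state (tpm p) x y z).DestructorFree) (hvf : v.DestructorFree)
    (hc : ∀ E' R', E ⊆ E' → R ≤ R' → Ded b E' (state (tpm (h (tup ![p, v]))) x y z) →
      Can b Φ N E' R') : Can b Φ N E ((ρ, ext) ::ₘ R) := by
  obtain ⟨body, rfl, hbody⟩ := he
  -- The nonce of the request is of no importance; the default value `bot` stands for it.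
  refine .recv (Function.update (Function.update (fun _ => bot) .pfState (state (tpm p) x y z))
    .val v) hch ?_ ?_ ?_
  · simp only [Pat.subst, Pat.inst, Term.subst, comp_vecCons, comp_vecEmpty, Function.update_apply,
      reduceCtorEq, if_true, if_false]
    exact ded_vec₄.2 ⟨ded_constant (by simp [Sym.IsPrivate]) rfl _, ded_bot, hs, hv⟩
  · simp only [mem_binders_cons, mem_binders_nil, mem_binders_var, mem_binders_eq, or_false,
      false_or, forall_eq_or_imp, forall_eq, Function.update_apply, reduceCtorEq, if_true, if_false,
      nf_bot, hsf.nf_eq, hvf.nf_eq, and_self]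
  · refine hbody (p := p) (x := x) (y := y) (z := z) ?_ hp hsf ?_ ?_
    · simp only [mem_binders_cons, mem_binders_nil, mem_binders_var, mem_binders_eq, or_false,
        false_or, Function.update_apply, reduceCtorEq, if_true, if_false, true_or, or_true]
    · simpa only [mem_binders_cons, mem_binders_nil, mem_binders_var, mem_binders_eq, or_false,
        false_or, Function.update_apply, reduceCtorEq, if_true, if_false, true_or, or_true]
        using hvf
    · simp only [mem_binders_cons, mem_binders_nil, mem_binders_var, mem_binders_eq, or_false,
        false_or, Function.update_apply, reduceCtorEq, if_true, if_false, true_or, or_true]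
      intro ρ' E' hE h₁ h₂ h₃
      refine .send ?_ (hc _ _ (hE.trans (Set.subset_insert _ _))
        (Multiset.le_cons_self _ _) ?_)
      · simp only [Term.subst, h₁]
        exact hch.mono hE
      · have h₄ : Ded b (insert (nf b ((tup ![extendResp, vr .nonce, vr .newSt]).subst ρ')) E')
            ((tup ![extendResp, vr .nonce, vr .newSt]).subst ρ') :=
          ded_nf.1 (ded_of_mem (Set.mem_insert _ _))
        simp only [Term.subst, comp_vecCons, comp_vecEmpty, h₂, h₃] at h₄ ⊢
        exact (ded_vec₃.1 h₄).2.2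

/-- Extension of the register on behalf of another thread. -/
theorem Can.extendComm (he : ExtendRuns b ext) {ρ δ : Ident → Term} {p x y z v U S V : Term}
    {n r : Ident} {m : Name} {P : Proc} (hU : nf b (U.subst δ) = nf b (ρ .ch))
    (hn : δ n = .name m) (hS : S.subst δ = state (tpm p) x y z) (hV : V.subst δ = v)
    (hp : IsChain p) (hsf : (state (tpm p) x y z).DestructorFree) (hvf : v.DestructorFree)
    (hc : ∀ E' R', E ⊆ E' → R ≤ R' → Can b Φ N E'
      ((Function.update δ r (state (tpm (h (tup ![p, v]))) x y z), P) ::ₘ R')) :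
    Can b Φ N E ((ρ, ext) ::ₘ (δ, .out U (tup ![extendReq, vr n, S, V])
      (inTup U ![.eq extendResp, .eq (vr n), .var r] P)) ::ₘ R) := by
  obtain ⟨body, rfl, hbody⟩ := he
  have hef := destructorFree_extend hsf hvf
  refine .of_eq (.comm (Function.update (Function.update (fun _ => .name m) .pfState
    (state (tpm p) x y z)) .val v) hU ?_ ?_ (.of_eq (hbody (p := p) (x := x) (y := y) (z := z)
      (R := (δ, inTup U ![.eq extendResp, .eq (vr n), .var r] P) ::ₘ R) ?_ hp hsf ?_ ?_)
      (Multiset.cons_swap _ _ _))) (Multiset.cons_swap _ _ _)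
  · simp only [Pat.subst, Pat.inst, Term.subst, comp_vecCons, comp_vecEmpty, Function.update_apply,
      reduceCtorEq, if_true, if_false, hn, hS, hV]
  · simp only [mem_binders_cons, mem_binders_nil, mem_binders_var, mem_binders_eq, or_false,
      false_or, forall_eq_or_imp, forall_eq, Function.update_apply, reduceCtorEq, if_true, if_false,
      nf_name, hsf.nf_eq, hvf.nf_eq, and_self]
  · simp only [mem_binders_cons, mem_binders_nil, mem_binders_var, mem_binders_eq, or_false,
      false_or, Function.update_apply, reduceCtorEq, if_true, if_false, true_or, or_true]
  · simpa only [mem_binders_cons, mem_binders_nil, mem_binders_var, mem_binders_eq, or_false,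
      false_or, Function.update_apply, reduceCtorEq, if_true, if_false, true_or, or_true]
      using hvf
  · simp only [mem_binders_cons, mem_binders_nil, mem_binders_var, mem_binders_eq, or_false,
      false_or, Function.update_apply, reduceCtorEq, if_true, if_false, true_or, or_true]
    intro ρ' E' hE h₁ h₂ h₃
    refine .comm (fun _ => state (tpm (h (tup ![p, v]))) x y z) ?_ ?_ (fun _ _ => hef.nf_eq)
      ((hc E' ((ρ', .nil) ::ₘ R) hE (Multiset.le_cons_self _ _)).of_eq ?_)
    · simp only [Term.subst, h₁, hU]
    · simp only [Pat.subst, Pat.inst, Term.subst, comp_vecCons, comp_vecEmpty, h₂, h₃, hn]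
    · rw [Multiset.cons_swap, update_of_binders]
      simp only [mem_binders_cons, mem_binders_nil, mem_binders_var, mem_binders_eq, or_false,
        false_or, implies_true]

theorem le_cons₂ (t u : Thread) : R ≤ t ::ₘ u ::ₘ R :=
  (Multiset.le_cons_self _ _).trans (Multiset.le_cons_self _ _)

theorem le_cons₃ (t u v : Thread) : R ≤ t ::ₘ u ::ₘ v ::ₘ R :=
  (Multiset.le_cons_self _ _).trans (le_cons₂ _ _)

theorem cons_rotate₃ (t u v : Thread) : t ::ₘ u ::ₘ v ::ₘ R = v ::ₘ t ::ₘ u ::ₘ R := by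
  rw [Multiset.cons_swap u v, Multiset.cons_swap t v]

theorem cons_rotate₄ (t u v w : Thread) :
    t ::ₘ u ::ₘ v ::ₘ w ::ₘ R = w ::ₘ t ::ₘ u ::ₘ v ::ₘ R := by
  rw [cons_rotate₃ u v w, Multiset.cons_swap t w]

theorem cons_rotate₅ (t u v w s : Thread) :
    t ::ₘ u ::ₘ v ::ₘ w ::ₘ s ::ₘ R = s ::ₘ t ::ₘ u ::ₘ v ::ₘ w ::ₘ R := by
  rw [cons_rotate₄ u v w s, Multiset.cons_swap t s]

theorem exists_cons_of_cons_le {t : Thread} {R' : Multiset Thread} (hle : t ::ₘ R ≤ R') :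
    ∃ R'', R' = t ::ₘ R'' ∧ R ≤ R'' := by
  obtain ⟨Q, rfl⟩ := Multiset.le_iff_exists_add.1 hle
  exact ⟨R + Q, Multiset.cons_add _ _ _, Multiset.le_add_right _ _⟩

theorem Can.spawnExtend (hR : Serves ext R) (U : Term) (hU : U = cpuTpm ∨ U = os)
    (hc : ∀ ρ R', R ≤ R' → ρ .ch = U → Can b Φ N E ((ρ, ext) ::ₘ R')) : Can b Φ N E R := by
  refine .spawn (hR (.var, .repl (tpmExtend ext)) (by simp [services])) (.par ?_)
  rcases hU with rfl | rfl
  · exact .letIn cpuTpm (by simp [Term.subst, comp_vecEmpty])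
      (destructorFree_constant (by simp [Sym.IsDestructor]) rfl _)
      (.bang (hc _ _ (le_cons₂ _ _) (by simp)))
  · exact .of_eq (.par (.letIn os (by simp [Term.subst, comp_vecEmpty])
      (destructorFree_constant (by simp [Sym.IsDestructor]) rfl _)
      (.bang (hc _ _ (le_cons₃ _ _ _) (by simp))))) (Multiset.cons_swap _ _ _)

/-- Granting a program access to the module. -/
theorem Can.extChannel (hR : Serves ext R) {δ : Ident → Term} {S c : Term} {P : Proc}
    (hS : nf b (S.subst δ) = c) (hcn : nf b c = c)
    (hc : ∀ R', R ≤ R' → (Function.update .var .ch c, .repl ext) ∈ R' →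
      Can b Φ N E ((δ, P) ::ₘ R')) :
    Can b Φ N E ((δ, .out cpuTpm (tup ![extChannel, S]) P) ::ₘ R) := by
  refine .spawn (hR.cons _ (.var, .repl (tpmExtend ext)) (by simp [services])) (.par ?_)
  rw [Multiset.cons_swap]
  refine .par ?_
  rw [Multiset.cons_swap]
  refine .bang ?_
  rw [cons_rotate₅]
  refine .comm (fun _ => c) ?_ ?_ ?_ ((hc _ ?_ ?_))
  · simp only [Term.subst, comp_vecEmpty]
  · simp only [Pat.subst, Pat.inst, Term.subst, comp_vecCons, comp_vecEmpty, nf_tup, hS, hcn]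
  · exact fun _ _ => hcn
  · exact (le_cons₃ _ _ _).trans (Multiset.le_cons_self _ _)
  · rw [update_of_binders (z := .ch)]
    · exact Multiset.mem_cons_self _ _
    · simp only [mem_binders_cons, mem_binders_nil, mem_binders_var, mem_binders_eq, or_false,
        false_or, implies_true]

/-- Reset of the register on behalf of the CPU. -/
theorem Can.resetComm (hR : Serves ext R) {δ : Ident → Term} {p x y z S : Term}
    {n r : Ident} {m : Name} {P : Proc} (hn : δ n = .name m) (hS : S.subst δ = state (tpm p) x y z)
    (hsf : (state (tpm p) x y z).DestructorFree)
    (hc : ∀ R', R ≤ R' → Can b Φ N E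
      ((Function.update δ r (state (tpm pd) x y z), P) ::ₘ R')) :
    Can b Φ N E ((δ, .out cpuTpm (tup ![resetReq, vr n, S])
      (inTup cpuTpm ![.eq resetResp, .eq (vr n), .var r] P)) ::ₘ R) := by
  have hpd : pd.DestructorFree := destructorFree_constant (by simp [Sym.IsDestructor]) rfl _
  have hdf : (state (tpm pd) x y z).DestructorFree := by
    rw [destructorFree_state] at hsf ⊢
    exact ⟨hpd, hsf.2⟩
  refine .spawn (hR.cons _ (.var, .repl tpmReset) (by simp [services])) (.par ?_)
  refine .letIn cpuTpm (by simp only [Term.subst, comp_vecEmpty, nf_cpuTpm])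
    (destructorFree_constant (by simp [Sym.IsDestructor]) rfl _)
    (.letIn pd (by simp only [Term.subst, comp_vecEmpty, nf_pd]) hpd (.bang ?_))
  rw [cons_rotate₄]
  refine .comm (Function.update (fun _ => .name m) .pfState (state (tpm p) x y z)) ?_ ?_ ?_ ?_
  · simp only [Term.subst, comp_vecEmpty, Function.update_apply, reduceCtorEq, if_true, if_false]
  · simp only [Pat.subst, Pat.inst, Term.subst, comp_vecCons, comp_vecEmpty, Function.update_apply,
      reduceCtorEq, if_true, if_false, hn, hS]
  · simp only [mem_binders_cons, mem_binders_nil, mem_binders_var, mem_binders_eq, or_false,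
      false_or, forall_eq_or_imp, forall_eq, Function.update_apply, reduceCtorEq, if_true, if_false,
      nf_name, hsf.nf_eq, and_self]
  rw [Multiset.cons_swap]
  refine .letIn (state (tpm pd) x y z) ?_ hdf (.comm (fun _ => state (tpm pd) x y z) ?_ ?_
    (fun _ _ => hdf.nf_eq) ?_)
  · simp only [Term.subst, comp_vecCons, comp_vecEmpty, mem_binders_cons, mem_binders_nil,
      mem_binders_var, mem_binders_eq, or_false, false_or, Function.update_apply, reduceCtorEq,
      if_true, if_false, true_or, or_true]
    rw [(Rule.resetPd _ _ _ _).nf_eq, hdf.nf_eq]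
  · simp only [Term.subst, comp_vecCons, comp_vecEmpty, mem_binders_cons, mem_binders_nil,
      mem_binders_var, mem_binders_eq, or_false, false_or, Function.update_apply, reduceCtorEq,
      if_true, if_false, true_or, or_true]
  · simp only [Pat.subst, Pat.inst, Term.subst, comp_vecCons, comp_vecEmpty, mem_binders_cons, mem_binders_nil,
      mem_binders_var, mem_binders_eq, or_false, false_or, Function.update_apply, reduceCtorEq,
      if_true, if_false, true_or, or_true, hn]
  rw [Multiset.cons_swap, update_of_binders (z := r)]
  · exact hc _ (le_cons₃ _ _ _)
  · simp only [mem_binders_cons, mem_binders_nil, mem_binders_var, mem_binders_eq, or_false,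
      false_or, implies_true]

/-- The CPU after the reset and the first extension of the register. -/
def cpuTail : Proc :=
  .out (vr .einit) (tup ![vr .nonce, vr .s3, tpmCh (vr .init), vr .pp]) <|
  .out cpuTpm (tup ![extChannel, tpmCh (vr .init)]) <|
  inTup (vr .einit) ![.eq drtResp, .eq (vr .nonce), .var .newState] <|
  .letIn .epp (getEntry (pp (vr .newState))) <|
  .out (vr .epp) (tup ![vr .newState, tpmCh (prog (vr .epp))]) <|
  .out cpuTpm (tup ![extChannel, tpmCh (prog (vr .epp))]) .nil

/-- A dynamic root of trust, started by the environment. -/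
theorem Can.launch (he : ExtendRuns b ext) (hR : Serves ext R) {p i c m a d e x y : Term} (j : ℕ)
    (hj : (⟨.nonce, j⟩ : Name) ∉ N) (hx : Ded b E (prog x)) (hxf : x.DestructorFree)
    (hy : Ded b E y) (hyn : nf b y = y)
    (hs : Ded b E (pst p i c m a d e ff)) (hsf : (pst p ff c m a d e ff).DestructorFree)
    (hc : ∀ δ E' R', E ⊆ E' → R ≤ R' → δ .nonce = .name ⟨.nonce, j⟩ →
      δ .s3 = pst (h (tup ![pd, tup ![h (prog x), h m]])) ff c m a (prog x) e tt →
      δ .init = prog x → δ .pp = y → δ .einit = x →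
      Can b Φ (insert ⟨.nonce, j⟩ N) E' ((δ, cpuTail) ::ₘ R')) : Can b Φ N E R := by
  have hpd : pd.DestructorFree := destructorFree_constant (by simp [Sym.IsDestructor]) rfl _
  have hsf' := destructorFree_pst.1 hsf
  have hxf' : (prog x).DestructorFree := destructorFree_prog.2 hxf
  have hwf : (tup ![h (prog x), h m]).DestructorFree := by
    simpa only [destructorFree_pair, destructorFree_h] using And.intro hxf' hsf'.2.2.1.1
  have h₁ : (pst p ff c m a d e tt).DestructorFree := by
    rw [destructorFree_pst]
    exact ⟨hsf'.1, hsf'.2.1, hsf'.2.2.1, hsf'.2.2.2.1, hsf'.2.2.2.2.1, tt_destructorFree⟩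
  have h₂ : (pst pd ff c m a d e tt).DestructorFree := by
    rw [destructorFree_pst] at h₁ ⊢
    exact ⟨hpd, h₁.2⟩
  have h₃ : (pst (h (tup ![pd, tup ![h (prog x), h m]])) ff c m a (prog x) e tt).DestructorFree := by
    have := destructorFree_extend h₂ hwf
    rw [destructorFree_pst] at this ⊢
    exact ⟨this.1, this.2.1, this.2.2.1, hxf', this.2.2.2.2⟩
  -- The interrupt flag `i` is not assumed normal, whereas received values must be. It is sent in
  -- normal form, and the CPU overwrites it anyway.
  have hsn : nf b (pst p (nf b i) c m a d e ff) = pst p (nf b i) c m a d e ff := by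
    simp only [nf_state, nf_tpm, nf_cpu, nf_smram, nf_drt, nf_nf, nf_ff, hsf'.1.nf_eq,
      hsf'.2.1.2.nf_eq, hsf'.2.2.1.1.nf_eq, hsf'.2.2.1.2.nf_eq, hsf'.2.2.2.1.nf_eq,
      hsf'.2.2.2.2.1.nf_eq]
  have hs' : Ded b E (pst p (nf b i) c m a d e ff) :=
    hs.congr (by simp only [nf_state, nf_tpm, nf_cpu, nf_smram, nf_drt, nf_nf])
  refine .spawn (hR (.var, CPU) (by simp [services])) ?_
  refine .recv (Function.update (Function.update (Function.update (fun _ => bot) .init (prog x))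
    .pp y) .pfState (pst p (nf b i) c m a d e ff)) ded_subst_os ?_ ?_ ?_
  · simp only [Pat.subst, Pat.inst, Term.subst, comp_vecCons, comp_vecEmpty, Function.update_apply,
      reduceCtorEq, if_true, if_false]
    exact ded_vec₄.2 ⟨ded_constant (by simp [Sym.IsPrivate]) rfl _, hx, hy, hs'⟩
  · simp only [mem_binders_cons, mem_binders_nil, mem_binders_var, mem_binders_eq, or_false,
      false_or, forall_eq_or_imp, forall_eq, Function.update_apply, reduceCtorEq, if_true, if_false,
      hyn, hxf'.nf_eq, hsn, and_self]
  refine .iteTrue ?_ (.letIn (pst p ff c m a d e ff) ?_ hsf (.letIn (pst p ff c m a d e tt) ?_ h₁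
    (.letIn (tup ![h (prog x), h m]) ?_ hwf (.new j (by simp [platformNames]) hj
      (.resetComm hR (m := ⟨.nonce, j⟩) ?_ ?_ h₁ fun R₁ hR₁ => ?_)))))
  · simp only [Term.subst, comp_vecCons, comp_vecEmpty, mem_binders_cons, mem_binders_nil,
      mem_binders_var, mem_binders_eq, or_false, false_or, Function.update_apply, reduceCtorEq,
      if_true, if_false, true_or, or_true]
    rw [(Rule.lock _ _ _ _ _ _).nf_eq]
  · simp only [Term.subst, comp_vecCons, comp_vecEmpty, mem_binders_cons, mem_binders_nil,
      mem_binders_var, mem_binders_eq, or_false, false_or, Function.update_apply, reduceCtorEq,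
      if_true, if_false, true_or, or_true]
    rw [(Rule.setIntCpu _ _ _ _ _ _).nf_eq, hsf.nf_eq]
  · simp only [Term.subst, comp_vecCons, comp_vecEmpty, mem_binders_cons, mem_binders_nil,
      mem_binders_var, mem_binders_eq, or_false, false_or, Function.update_apply, reduceCtorEq,
      if_true, if_false, true_or, or_true]
    rw [(Rule.setLockCpu _ _ _ _ _ _ _).nf_eq, h₁.nf_eq]
  · simp only [Term.subst, comp_vecCons, comp_vecEmpty, mem_binders_cons, mem_binders_nil,
      mem_binders_var, mem_binders_eq, or_false, false_or, Function.update_apply, reduceCtorEq,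
      if_true, if_false, true_or, or_true, nf_tup, nf_h, nf_prog, hxf.nf_eq]
    rw [(Rule.stm _ _ _ _ _).nf_eq, hsf'.2.2.1.1.nf_eq]
  · simp only [Function.update_apply, reduceCtorEq, if_true, if_false]
  · simp only [Term.subst, Function.update_apply, reduceCtorEq, if_true, if_false]
  refine .spawnExtend ((hR.mono hR₁).cons _) cpuTpm (Or.inl rfl) fun ρ R₂ hR₂ hρ => ?_
  obtain ⟨R₃, rfl, hR₃⟩ := exists_cons_of_cons_le hR₂
  refine .extendComm he (m := ⟨.nonce, j⟩) ?_ ?_ ?_ ?_ isChain_pd h₂ hwf fun E' R₄ hE hR₄ => ?_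
  · simp only [Term.subst, comp_vecEmpty, hρ]
  · simp only [Function.update_apply, reduceCtorEq, if_true, if_false]
  · simp only [Term.subst, Function.update_apply, reduceCtorEq, if_true, if_false]
  · simp only [Term.subst, Function.update_apply, reduceCtorEq, if_true, if_false]
  refine .letIn (pst (h (tup ![pd, tup ![h (prog x), h m]])) ff c m a (prog x) e tt) ?_ h₃
    (.letIn x ?_ hxf (hc _ E' R₄ hE ((hR₁.trans hR₃).trans hR₄) ?_ ?_ ?_ ?_ ?_))
  · simp only [Term.subst, comp_vecCons, comp_vecEmpty, mem_binders_cons, mem_binders_nil,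
      mem_binders_var, mem_binders_eq, or_false, false_or, Function.update_apply, reduceCtorEq,
      if_true, if_false, true_or, or_true]
    rw [(Rule.setInit _ _ _ _ _ _ _).nf_eq, h₃.nf_eq]
  · simp only [Term.subst, comp_vecCons, comp_vecEmpty, mem_binders_cons, mem_binders_nil,
      mem_binders_var, mem_binders_eq, or_false, false_or, Function.update_apply, reduceCtorEq,
      if_true, if_false, true_or, or_true]
    rw [(Rule.getEntry _).nf_eq, hxf.nf_eq]
  all_goals simp only [mem_binders_cons, mem_binders_nil,
      mem_binders_var, mem_binders_eq, or_false, false_or, Function.update_apply, reduceCtorEq,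
      if_true, if_false, true_or, or_true]

end Services

/-! ### Running the environment's and the trusted programs -/

section Services

variable {b : ℕ} {Φ : Set Name → Set Term → Multiset Thread → Prop} {N : Set Name} {E : Set Term}
  {R : Multiset Thread} {ext : Proc}

/-- Only finitely many names are in use at any time, so a fresh copy of each restricted name exists.
-/
theorem exists_fresh (hN : N.Finite) (n : Ident) : ∃ i, (⟨n, i⟩ : Name) ∉ N := by
  by_contra! hall
  refine Set.infinite_of_injective_forall_mem (f := fun i : ℕ => (⟨n, i⟩ : Name)) ?_ hall hN
  intro i j hij
  simpa using hij

theorem nf_app_nf (f : Sym) (args : Fin f.arity → Term) :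
    nf b (.app f args) = nf b (.app f fun i => nf b (args i)) := by
  rw [nf, nf]
  simp only [nf_nf]

/-- The CPU after the environment has received the message for its own `INIT` program. -/
def cpuTailEnd : Proc :=
  .out cpuTpm (tup ![extChannel, tpmCh (vr .init)]) <|
  inTup (vr .einit) ![.eq drtResp, .eq (vr .nonce), .var .newState] <|
  .letIn .epp (getEntry (pp (vr .newState))) <|
  .out (vr .epp) (tup ![vr .newState, tpmCh (prog (vr .epp))]) <|
  .out cpuTpm (tup ![extChannel, tpmCh (prog (vr .epp))]) .nil

/-- A dynamic root of trust with an `INIT` program of the environment. -/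
theorem Can.launchEnv (he : ExtendRuns b ext) (hR : Serves ext R) {p i c m a d e x : Term} (j : ℕ)
    (hj : (⟨.nonce, j⟩ : Name) ∉ N) (hx : Ded b E x) (hxf : x.DestructorFree)
    (hs : Ded b E (pst p i c m a d e ff)) (hsf : (pst p ff c m a d e ff).DestructorFree)
    (hc : ∀ δ E' R', E ⊆ E' → R ≤ R' → Ded b E' (.name ⟨.nonce, j⟩) →
      Ded b E' (pst (h (tup ![pd, tup ![h (prog x), h m]])) ff c m a (prog x) e tt) →
      Ded b E' (tpmCh (prog x)) → δ .nonce = .name ⟨.nonce, j⟩ → δ .init = prog x → δ .einit = x →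
      Can b Φ (insert ⟨.nonce, j⟩ N) E' ((δ, cpuTailEnd) ::ₘ R')) : Can b Φ N E R := by
  refine .launch he hR j hj (ded_app (by simp [Sym.IsPrivate]) (forall_vec₁ hx)) hxf
    ded_bot (nf_bot b) hs hsf fun δ E' R' hE hR' h₁ h₂ h₃ h₄ h₅ => ?_
  have key : Ded b (insert (nf b ((tup ![vr .nonce, vr .s3, tpmCh (vr .init), vr .pp]).subst δ)) E')
      ((tup ![vr .nonce, vr .s3, tpmCh (vr .init), vr .pp]).subst δ) :=
    ded_nf.1 (ded_of_mem (Set.mem_insert _ _))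
  refine .send ?_ (hc δ _ R' (hE.trans (Set.subset_insert _ _)) hR' ?_ ?_ ?_ h₁ h₃ h₅)
  · simp only [Term.subst, h₅]
    exact hx.mono hE
  all_goals
    simp only [Term.subst, comp_vecCons, comp_vecEmpty, h₁, h₂, h₃, h₄] at key ⊢
    rw [ded_vec₄] at key
  · exact key.1
  · exact key.2.1
  · exact key.2.2.1

/-- The state in which the platform starts. -/
abbrev startState : Term := pst ps tt bot bot bot bot bot ff

theorem startState_destructorFree : (pst ps ff bot bot bot bot bot ff).DestructorFree := by
  simp [destructorFree_app, forall_vecCons, Sym.IsDestructor]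

/-- The protected program after the interrupts have been enabled. -/
def ppTail : Proc :=
  .out os (vr .pfSt) <|
  inVar os .xBlob <| inVar os .xCipher <|
  .out (vr .tpmc) (tup ![unsealTag, vr .xBlob]) <|
  inTup (vr .tpmc) ![.eq plainTag, .var .xk] <|
  .letIn .mess (sdec (vr .xCipher) (vr .xk)) <|
  .out os (vr .mess) <|
  .new .rand <|
  .out (vr .tpmc) (tup ![extendReq, vr .rand, vr .pfSt, bot]) <|
  inTup (vr .tpmc) ![.eq extendResp, .eq (vr .rand), .var .exts] <|
  .letIn .ends (setLock (vr .exts) Tpp ff) <|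
  .out os (vr .ends) .nil

/-- The protected program after the message has been published. -/
def ppTailEnd : Proc :=
  .new .rand <|
  .out (vr .tpmc) (tup ![extendReq, vr .rand, vr .pfSt, bot]) <|
  inTup (vr .tpmc) ![.eq extendResp, .eq (vr .rand), .var .exts] <|
  .letIn .ends (setLock (vr .exts) Tpp ff) <|
  .out os (vr .ends) .nil

/-- The environment makes the CPU run the protected program in a state of its choice. -/
theorem Can.runPp (he : ExtendRuns b ext) (hR : Serves ext R) (hN : N.Finite)
    (hst : Ded b E startState) {p i c m a d : Term}
    (hs : Ded b E (pst p i c m a d (prog Tpp) tt))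
    (hsf : (pst p tt c m a d (prog Tpp) tt).DestructorFree)
    (hc : ∀ δ N' E' R', N'.Finite → E ⊆ E' → R ≤ R' →
      δ .pfSt = pst p tt c m a d (prog Tpp) tt → δ .tpmc = tpmCh (prog Tpp) →
      (Function.update .var .ch (tpmCh (prog Tpp)), .repl ext) ∈ R' →
      Can b Φ N' E' ((δ, ppTail) ::ₘ R')) : Can b Φ N E R := by
  obtain ⟨j, hj⟩ := exists_fresh hN .nonce
  have hsf' := destructorFree_pst.1 hsf
  have hsn : nf b (pst p (nf b i) c m a d (prog Tpp) tt) = pst p (nf b i) c m a d (prog Tpp) tt := by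
    simp only [nf_state, nf_tpm, nf_cpu, nf_smram, nf_drt, nf_nf, nf_tt, hsf'.1.nf_eq,
      hsf'.2.1.2.nf_eq, hsf'.2.2.1.1.nf_eq, hsf'.2.2.1.2.nf_eq, hsf'.2.2.2.1.nf_eq,
      hsf'.2.2.2.2.1.nf_eq]
  have hs' : Ded b E (pst p (nf b i) c m a d (prog Tpp) tt) :=
    hs.congr (by simp only [nf_state, nf_tpm, nf_cpu, nf_smram, nf_drt, nf_nf])
  have hosf : os.DestructorFree := destructorFree_constant (by simp [Sym.IsDestructor]) rfl _
  -- An auxiliary launch from the start state, with an `INIT` program whose entry point is the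
  -- public constant `os`, gives the environment the nonce. The CPU then accepts any state in the
  -- response and passes it on to `Tpp`.
  refine .launchEnv he hR j hj ded_os hosf hst startState_destructorFree
    fun δ E₁ R₁ hE₁ hR₁ hn _ _ h₁ h₂ h₃ => ?_
  refine .extChannel (hR.mono hR₁) (c := tpmCh (prog os)) ?_ ?_ fun R₂ hR₂ _ => ?_
  · simp only [Term.subst, comp_vecCons, comp_vecEmpty, h₂, nf_tpmCh, nf_prog, nf_os]
  · simp only [nf_tpmCh, nf_prog, nf_os]
  refine .recv (fun _ => pst p (nf b i) c m a d (prog Tpp) tt) ?_ ?_ (fun _ _ => hsn) ?_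
  · simp only [Term.subst, h₃]
    exact ded_os
  · simp only [Pat.subst, Pat.inst, Term.subst, comp_vecCons, comp_vecEmpty, h₁]
    exact ded_vec₃.2 ⟨ded_constant (by simp [Sym.IsPrivate]) rfl _, hn, hs'.mono hE₁⟩
  rw [update_of_binders (z := .newState) (by
    simp only [mem_binders_cons, mem_binders_nil, mem_binders_var, mem_binders_eq, or_false,
      false_or, implies_true])]
  refine .letIn Tpp ?_ (destructorFree_constant (by simp [Sym.IsDestructor]) rfl _) ?_
  · simp only [Term.subst, comp_vecCons, comp_vecEmpty, Function.update_self]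
    rw [nf_app_nf]
    simp only [comp_vecCons, comp_vecEmpty]
    rw [(Rule.pp _ _ _ _ _ _).nf_eq, nf_prog, nf_entry, (Rule.getEntry _).nf_eq, nf_entry]
  refine .spawn (((hR.mono (hR₁.trans hR₂)).cons _) (.var, .repl PP) (by simp [services])) ?_
  refine .send ded_subst_os ?_
  rw [Multiset.cons_swap]
  refine .comm (Function.update (fun _ => tpmCh (prog Tpp)) .pfState0
    (pst p (nf b i) c m a d (prog Tpp) tt)) ?_ ?_ ?_ ?_
  · simp only [Term.subst, comp_vecEmpty, Function.update_self]
  · simp only [Pat.subst, Pat.inst, Term.subst, comp_vecCons, comp_vecEmpty, Function.update_apply,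
      reduceCtorEq, if_true, if_false]
  · simp only [mem_binders_cons, mem_binders_nil, mem_binders_var, mem_binders_eq, or_false,
      false_or, forall_eq_or_imp, forall_eq, Function.update_apply, reduceCtorEq, if_true, if_false,
      hsn, nf_tpmCh, nf_prog, nf_entry, and_self]
  refine .extChannel ((hR.mono (hR₁.trans hR₂)).cons _) (c := tpmCh (prog Tpp)) ?_ ?_
    fun R₃ hR₃ hm => ?_
  · simp only [Term.subst, comp_vecCons, comp_vecEmpty, Function.update_self, nf_tpmCh, nf_prog,
      nf_entry]
  · simp only [nf_tpmCh, nf_prog, nf_entry]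
  obtain ⟨R₄, rfl, hR₄⟩ := exists_cons_of_cons_le hR₃
  rw [Multiset.cons_swap]
  refine .letIn (pst p tt c m a d (prog Tpp) tt) ?_ hsf (hc _ _ _ _ (hN.insert _)
    (hE₁.trans (Set.subset_insert _ _)) (((hR₁.trans hR₂).trans hR₄).trans (Multiset.le_cons_self _ _))
    ?_ ?_ ?_)
  · simp only [Term.subst, comp_vecCons, comp_vecEmpty, mem_binders_cons, mem_binders_nil,
      mem_binders_var, mem_binders_eq, or_false, false_or, Function.update_apply, reduceCtorEq,
      if_true, if_false, true_or, or_true]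
    rw [(Rule.setIntPp _ _ _ _ _ _ _).nf_eq, hsf.nf_eq]
  · simp only [Function.update_self]
  · simp only [mem_binders_cons, mem_binders_nil, mem_binders_var, mem_binders_eq, or_false,
      false_or, Function.update_apply, reduceCtorEq, if_true, if_false, true_or, or_true]
  · rcases Multiset.mem_cons.1 hm with hm | hm
    · have := congrArg Prod.snd hm
      simp at this
    · exact Multiset.mem_cons_of_mem hm

/-- The protected program publishes a message encrypted by a key that is sealed by the register
value of a state known to the environment. -/
theorem Can.ppUnseal (hR : Serves ext R) {δ : Ident → Term} {q i c m a d k w : Term}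
    (hδ : δ .tpmc = tpmCh (prog Tpp))
    (hs : Ded b E (pst q i c m a d (prog Tpp) tt)) (hq : q.DestructorFree)
    (hk : Ded b E (sealD k q)) (hkf : k.DestructorFree)
    (hw : Ded b E (senc w k)) (hwf : w.DestructorFree)
    (hc : ∀ δ' E' R', E ⊆ E' → R ≤ R' → δ' .pfSt = δ .pfSt → δ' .tpmc = tpmCh (prog Tpp) →
      Ded b E' w → Can b Φ N E' ((δ', ppTailEnd) ::ₘ R')) :
    Can b Φ N E ((δ, ppTail) ::ₘ R) := by
  refine .send ded_subst_os ?_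
  replace hs := hs.mono (Set.subset_insert (nf b (Term.subst δ (vr .pfSt))) E)
  replace hk := hk.mono (Set.subset_insert (nf b (Term.subst δ (vr .pfSt))) E)
  replace hw := hw.mono (Set.subset_insert (nf b (Term.subst δ (vr .pfSt))) E)
  refine .recvVar (sealD k q) ded_subst_os hk (by simp only [nf_sealD, hkf.nf_eq, hq.nf_eq])
    (.recvVar (senc w k) ded_subst_os hw (by simp only [nf_senc, hkf.nf_eq, hwf.nf_eq]) ?_)
  -- The module unseals for whatever state it is given, so the state with register `q` need not be
  -- the one in which the protected program runs.
  refine .spawn (hR.cons _ (.var, .repl tpmUnseal) (by simp [services]))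
    (.recvVar (nf b (pst q i c m a d (prog Tpp) tt)) ded_subst_os (ded_nf.2 hs) (nf_nf _ _) ?_)
  simp only [nf_state, nf_tpm, nf_cpu, nf_smram, nf_drt, nf_prog, nf_entry, nf_tt, hq.nf_eq]
  refine .iteTrue ?_ (.letIn (tpmCh (prog Tpp)) ?_ ?_ ?_)
  · simp only [Term.subst, comp_vecCons, comp_vecEmpty, Function.update_self]
    rw [(Rule.lock _ _ _ _ _ _).nf_eq]
  · simp only [Term.subst, comp_vecCons, comp_vecEmpty, Function.update_self, nf_tpmCh]
    rw [(Rule.pp _ _ _ _ _ _).nf_eq, nf_prog, nf_entry]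
  · simp [destructorFree_app, Sym.IsDestructor]
  rw [Multiset.cons_swap]
  refine .comm (fun _ => sealD k q) ?_ ?_ ?_ ?_
  · simp only [Term.subst, Function.update_apply, reduceCtorEq, if_true, if_false, hδ]
  · simp only [Pat.subst, Pat.inst, Term.subst, comp_vecCons, comp_vecEmpty, Function.update_apply,
      reduceCtorEq, if_true, if_false]
  · exact fun _ _ => by simp only [nf_sealD, hkf.nf_eq, hq.nf_eq]
  rw [update_of_binders (z := .blob) (by
    simp only [mem_binders_cons, mem_binders_nil, mem_binders_var, mem_binders_eq, or_false,
      false_or, implies_true]), Multiset.cons_swap]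
  refine .letIn k ?_ hkf (.comm (fun _ => k) ?_ ?_ (fun _ _ => hkf.nf_eq) ?_)
  · simp only [Term.subst, comp_vecCons, comp_vecEmpty, Function.update_apply, reduceCtorEq,
      if_true, if_false]
    rw [nf_app_nf]
    simp only [comp_vecCons, comp_vecEmpty]
    rw [(Rule.pcr _ _ _ _).nf_eq, nf_sealD, (Rule.unsealD _ _).nf_eq, nf_nf, hkf.nf_eq]
  · simp only [Term.subst, Function.update_apply, reduceCtorEq, if_true, if_false, hδ]
  · simp only [Pat.subst, Pat.inst, Term.subst, comp_vecCons, comp_vecEmpty, Function.update_apply,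
      reduceCtorEq, if_true, if_false]
  rw [update_of_binders (z := .xk) (by
    simp only [mem_binders_cons, mem_binders_nil, mem_binders_var, mem_binders_eq, or_false,
      false_or, implies_true]), Multiset.cons_swap]
  refine .letIn w ?_ hwf (.send ded_subst_os (hc _ _ _
    ((Set.subset_insert _ _).trans (Set.subset_insert _ _)) (Multiset.le_cons_self _ _) ?_ ?_ ?_))
  · simp only [Term.subst, comp_vecCons, comp_vecEmpty, Function.update_apply, reduceCtorEq,
      if_true, if_false]
    rw [(Rule.sdec _ _).nf_eq, hwf.nf_eq]
  · simp only [Function.update_apply, reduceCtorEq, if_true, if_false]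
  · simp only [Function.update_apply, reduceCtorEq, if_true, if_false, hδ]
  · refine ded_of_mem (Or.inl ?_)
    simp only [Term.subst, Function.update_self, hwf.nf_eq]

/-- Unsealing on behalf of the environment. -/
theorem Can.unsealEnv {ρ : Ident → Term} {k q : Term} (hch : Ded b E (ρ .ch))
    (hq : nf b (pcr (ρ .pfState)) = q) (hqf : q.DestructorFree) (hk : Ded b E (sealD k q))
    (hkf : k.DestructorFree)
    (hc : ∀ E' R', E ⊆ E' → R ≤ R' → Ded b E' k → Can b Φ N E' R') :
    Can b Φ N E ((ρ, unsealProc) ::ₘ R) := by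
  refine .recv (fun _ => sealD k q) hch ?_ ?_ ?_
  · simp only [Pat.subst, Pat.inst, Term.subst, comp_vecCons, comp_vecEmpty]
    exact ded_vec₂.2 ⟨ded_constant (by simp [Sym.IsPrivate]) rfl _, hk⟩
  · exact fun _ _ => by simp only [nf_sealD, hkf.nf_eq, hqf.nf_eq]
  rw [update_of_binders (z := .blob) (by
    simp only [mem_binders_cons, mem_binders_nil, mem_binders_var, mem_binders_eq, or_false,
      false_or, implies_true])]
  refine .letIn k ?_ hkf (.send ?_ (hc _ _ (Set.subset_insert _ _) (Multiset.le_cons_self _ _) ?_))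
  · simp only [Term.subst, comp_vecCons, comp_vecEmpty, Function.update_apply, reduceCtorEq,
      if_true, if_false]
    rw [nf_app_nf]
    simp only [comp_vecCons, comp_vecEmpty, hq]
    rw [nf_sealD, hqf.nf_eq, (Rule.unsealD _ _).nf_eq, nf_nf, hkf.nf_eq]
  · simpa only [Term.subst, Function.update_apply, reduceCtorEq, if_true, if_false] using hch
  · have key := ded_of_mem (b := b) (Set.mem_insert (nf b ((tup ![plainTag, vr .plain]).subst
      (Function.update (Function.update ρ .blob (sealD k q)) .plain k))) E)
    rw [ded_nf] at key
    simp only [Term.subst, comp_vecCons, comp_vecEmpty, Function.update_apply, reduceCtorEq,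
      if_true, if_false] at key ⊢
    exact (ded_vec₂.1 key).2

/-- The trusted `INIT` program, started by the environment. -/
theorem Can.runInit (he : ExtendRuns b ext) (hR : Serves ext R) (hN : N.Finite)
    {p i c m a d e y : Term} (hs : Ded b E (pst p i c m a d e ff))
    (hsf : (pst p ff c m a d e ff).DestructorFree) (hy : Ded b E y) (hyf : y.DestructorFree)
    (hprog : Ded b E (prog Tinit))
    (hc : ∀ N' E' R', N'.Finite → E ⊆ E' → R ≤ R' →
      Ded b E' (pst (h (tup ![h (tup ![pd, tup ![h (prog Tinit), h m]]), h y])) ff c m a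
        (prog Tinit) y tt) → Can b Φ N' E' R') : Can b Φ N E R := by
  obtain ⟨j, hj⟩ := exists_fresh hN .nonce
  obtain ⟨j', hj'⟩ := exists_fresh (hN.insert ⟨.nonce, j⟩) .nonce1
  have hTf : Tinit.DestructorFree := destructorFree_constant (by simp [Sym.IsDestructor]) rfl _
  have hpd : pd.DestructorFree := destructorFree_constant (by simp [Sym.IsDestructor]) rfl _
  have hsf' := destructorFree_pst.1 hsf
  have h₁ : (pst (h (tup ![pd, tup ![h (prog Tinit), h m]])) ff c m a (prog Tinit) e
      tt).DestructorFree := by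
    simp only [destructorFree_pst, destructorFree_h, destructorFree_pair, destructorFree_prog]
    exact ⟨⟨hpd, hTf, hsf'.2.2.1.1⟩, hsf'.2.1, hsf'.2.2.1, hTf, hsf'.2.2.2.2.1, tt_destructorFree⟩
  have h₂ : (pst (h (tup ![h (tup ![pd, tup ![h (prog Tinit), h m]]), h y])) ff c m a
      (prog Tinit) y tt).DestructorFree := by
    simp only [destructorFree_pst, destructorFree_h, destructorFree_pair, destructorFree_prog]
    exact ⟨⟨⟨hpd, hTf, hsf'.2.2.1.1⟩, hyf⟩, hsf'.2.1, hsf'.2.2.1, hTf, hyf, tt_destructorFree⟩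
  refine .launch he hR j hj hprog hTf hy hyf.nf_eq hs hsf
    fun δ E₁ R₁ hE₁ hR₁ d₁ d₂ d₃ d₄ d₅ => ?_
  refine .spawn ((hR.mono hR₁).cons _ (.var, .repl INIT) (by simp [services]))
    (.send ded_subst_os (.send ded_subst_os ?_))
  rw [Multiset.cons_swap]
  refine .comm (Function.update (Function.update (Function.update (fun _ => .name ⟨.nonce, j⟩)
    .pfSt (pst (h (tup ![pd, tup ![h (prog Tinit), h m]])) ff c m a (prog Tinit) e tt))
    .tpmc (tpmCh (prog Tinit))) .pp y) ?_ ?_ ?_ ?_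
  · simp only [Term.subst, comp_vecEmpty, d₅]
  · simp only [Pat.subst, Pat.inst, Term.subst, comp_vecCons, comp_vecEmpty, Function.update_apply,
      reduceCtorEq, if_true, if_false, d₁, d₂, d₃, d₄]
  · simp only [mem_binders_cons, mem_binders_nil, mem_binders_var, mem_binders_eq, or_false,
      false_or, forall_eq_or_imp, forall_eq, Function.update_apply, reduceCtorEq, if_true, if_false,
      h₁.nf_eq, hyf.nf_eq, nf_tpmCh, nf_prog, nf_entry, nf_name, and_self]
  -- The grant by the CPU must precede the request of the `INIT` program, since only then does the
  -- module listen on its channel.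
  refine .extChannel ((hR.mono hR₁).cons _) (c := tpmCh (prog Tinit)) ?_ ?_ fun R₂ hR₂ hm => ?_
  · simp only [Term.subst, comp_vecCons, comp_vecEmpty, d₃, nf_tpmCh, nf_prog, nf_entry]
  · simp only [nf_tpmCh, nf_prog, nf_entry]
  obtain ⟨R₃, rfl, hR₃⟩ := exists_cons_of_cons_le hR₂
  have hm' : (Function.update .var .ch (tpmCh (prog Tinit)), .repl ext) ∈ R₃ := by
    rcases Multiset.mem_cons.1 hm with hm | hm
    · have := congrArg Prod.snd hm
      simp at this
    · exact hm
  rw [Multiset.cons_swap]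
  refine .letIn (h y) ?_ (destructorFree_h.2 hyf) (.new j' (by simp [platformNames]) hj' ?_)
  · simp only [Term.subst, comp_vecCons, comp_vecEmpty, mem_binders_cons, mem_binders_nil,
      mem_binders_var, mem_binders_eq, or_false, false_or, Function.update_apply, reduceCtorEq,
      if_true, if_false, true_or, or_true, nf_h, hyf.nf_eq]
  refine .spawn (Multiset.mem_cons_of_mem (Multiset.mem_cons_of_mem hm'))
    (.extendComm he (m := ⟨.nonce1, j'⟩) ?_ ?_ ?_ ?_ (isChain_pd.extend _) h₁
      (destructorFree_h.2 hyf) fun E₂ R₄ hE₂ hR₄ => ?_)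
  · simp only [Term.subst, comp_vecCons, comp_vecEmpty, mem_binders_cons, mem_binders_nil,
      mem_binders_var, mem_binders_eq, or_false, false_or, Function.update_apply, reduceCtorEq,
      if_true, if_false, true_or, or_true]
  · simp only [Function.update_self]
  · simp only [Term.subst, comp_vecCons, comp_vecEmpty, mem_binders_cons, mem_binders_nil,
      mem_binders_var, mem_binders_eq, or_false, false_or, Function.update_apply, reduceCtorEq,
      if_true, if_false, true_or, or_true]
  · simp only [Term.subst, comp_vecCons, comp_vecEmpty, mem_binders_cons, mem_binders_nil,
      mem_binders_var, mem_binders_eq, or_false, false_or, Function.update_apply, reduceCtorEq,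
      if_true, if_false, true_or, or_true]
  obtain ⟨R₅, rfl, hR₅⟩ := exists_cons_of_cons_le hR₄
  refine .letIn (pst (h (tup ![h (tup ![pd, tup ![h (prog Tinit), h m]]), h y])) ff c m a
    (prog Tinit) y tt) ?_ h₂ (.comm (fun _ => pst (h (tup ![h (tup ![pd, tup ![h (prog Tinit),
      h m]]), h y])) ff c m a (prog Tinit) y tt) ?_ ?_ (fun _ _ => h₂.nf_eq)
      (.send ded_subst_os (hc _ _ _ ((hN.insert _).insert _) ?_ ?_ ?_)))
  · simp only [Term.subst, comp_vecCons, comp_vecEmpty, mem_binders_cons, mem_binders_nil,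
      mem_binders_var, mem_binders_eq, or_false, false_or, Function.update_apply, reduceCtorEq,
      if_true, if_false, true_or, or_true]
    rw [(Rule.setPpInit _ _ _ _ _ _ _).nf_eq, h₂.nf_eq]
  · simp only [Term.subst, comp_vecEmpty, d₅]
  · simp only [Pat.subst, Pat.inst, Term.subst, comp_vecCons, comp_vecEmpty, mem_binders_cons,
      mem_binders_nil, mem_binders_var, mem_binders_eq, or_false, false_or, Function.update_apply,
      reduceCtorEq, if_true, if_false, true_or, or_true, d₁]
  · exact ((hE₁.trans ((Set.subset_insert _ _).trans (Set.subset_insert _ _))).trans hE₂).trans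
      (Set.subset_insert _ _)
  · exact ((hR₁.trans hR₃).trans hR₅).trans (le_cons₂ _ _)
  · refine ded_of_mem (Or.inl ?_)
    simp only [Term.subst, Function.update_self, h₂.nf_eq]

end Services

/-! ### The terms that the environment can obtain -/

section Yields

variable {b : ℕ} {Φ : Set Name → Set Term → Multiset Thread → Prop} {N : Set Name} {E : Set Term}
  {R : Multiset Thread} {ext : Proc} {B : Set Term} {T : Term}

/-- The platform offers its services, and the environment can deduce the terms `B`. -/
structure Ready (b : ℕ) (ext : Proc) (B : Set Term) (N : Set Name) (E : Set Term)
    (R : Multiset Thread) : Prop where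
  finite : N.Finite
  base : ∀ S ∈ B, Ded b E S
  serves : Serves ext R

theorem Ready.mono (hr : Ready b ext B N E R) {N' : Set Name} {E' : Set Term}
    {R' : Multiset Thread} (hN : N'.Finite) (hE : E ⊆ E') (hR : R ≤ R') :
    Ready b ext B N' E' R' :=
  ⟨hN, fun S hS => (hr.base S hS).mono hE, hr.serves.mono hR⟩

/-- Whenever the platform is ready, the environment can obtain the term `T`. -/
def Yields (b : ℕ) (ext : Proc) (B : Set Term) (T : Term) : Prop :=
  ∀ N E R, Ready b ext B N E R →
    Can b (fun N' E' R' => Ready b ext B N' E' R' ∧ E ⊆ E' ∧ Ded b E' T) N E R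

/-- A term that can always be obtained may be acquired in the middle of a run, with the services
intact. -/
theorem Yields.bind (hT : Yields b ext B T) (hr : Ready b ext B N E R)
    (hc : ∀ N' E' R', Ready b ext B N' E' R' → E ⊆ E' → Ded b E' T → Can b Φ N' E' R') :
    Can b Φ N E R :=
  (hT N E R hr).trans fun N' E' R' h₁ => hc N' E' R' h₁.1 h₁.2.1 h₁.2.2

theorem Yields.bindList {l : List Term} (hl : ∀ T ∈ l, Yields b ext B T)
    (hr : Ready b ext B N E R)
    (hc : ∀ N' E' R', Ready b ext B N' E' R' → E ⊆ E' → (∀ T ∈ l, Ded b E' T) → Can b Φ N' E' R') :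
    Can b Φ N E R := by
  induction l generalizing N E R with
  | nil => exact hc N E R hr subset_rfl (by simp)
  | cons T l ih =>
    simp only [List.mem_cons, forall_eq_or_imp] at hl hc
    refine hl.1.bind hr fun N₁ E₁ R₁ hr₁ hE₁ h₁ => ih hl.2 hr₁ fun N₂ E₂ R₂ hr₂ hE₂ h₂ => ?_
    exact hc N₂ E₂ R₂ hr₂ (hE₁.trans hE₂) ⟨h₁.mono hE₂, h₂⟩

theorem yields_of_ded (hT : ∀ E, (∀ S ∈ B, Ded b E S) → Ded b E T) : Yields b ext B T :=
  fun _ E _ hr => .done ⟨hr, subset_rfl, hT E hr.base⟩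

/-- Each new copy of `INIT` or `PP` starts by publishing its programs. -/
theorem yields_prog {k : ℕ} (hk : k < 3) : Yields b ext B (prog (entryPoint k)) := by
  intro N E R hr
  have key : ∀ (k : ℕ) (ρ : Ident → Term) (F : Set Term), Ded b
      (insert (nf b ((prog (.app (.entry k) ![])).subst ρ)) F) (prog (entryPoint k)) := by
    intro k ρ F
    refine ded_of_mem (Or.inl ?_)
    simp only [Term.subst, comp_vecCons, comp_vecEmpty, nf_prog, nf_entry]
  interval_cases k
  · exact .spawn (hr.serves (.var, .repl INIT) (by simp [services])) (.send ded_subst_os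
      (.done ⟨hr.mono hr.finite (Set.subset_insert _ _) (Multiset.le_cons_self _ _),
        Set.subset_insert _ _, key 0 _ _⟩))
  · exact .spawn (hr.serves (.var, .repl INIT) (by simp [services])) (.send ded_subst_os
      (.send ded_subst_os (.done ⟨hr.mono hr.finite
        ((Set.subset_insert _ _).trans (Set.subset_insert _ _)) (Multiset.le_cons_self _ _),
        (Set.subset_insert _ _).trans (Set.subset_insert _ _), key 1 _ _⟩)))
  · exact .spawn (hr.serves (.var, .repl PP) (by simp [services])) (.send ded_subst_os
      (.done ⟨hr.mono hr.finite (Set.subset_insert _ _) (Multiset.le_cons_self _ _),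
        Set.subset_insert _ _, key 2 _ _⟩))

theorem yields_app {f : Sym} {args : Fin f.arity → Term} (hf : ¬ f.IsPrivate)
    (ha : ∀ i, Yields b ext B (args i)) : Yields b ext B (.app f args) := by
  intro N E R hr
  refine Yields.bindList (l := List.ofFn args) (by simpa [List.mem_ofFn] using ha) hr
    fun N' E' R' hr' hE' h₁ => .done ⟨hr', hE', ded_app hf fun i => h₁ _ (by simp)⟩

theorem Yields.reset {p x₁ x₂ x₃ : Term} (hsf : (state (tpm ps) x₁ x₂ x₃).DestructorFree)
    (hs : Yields b ext B (state (tpm p) x₁ x₂ x₃)) :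
    Yields b ext B (state (tpm ps) x₁ x₂ x₃) := by
  intro N E R hr
  refine hs.bind hr fun N' E' R' hr' hE hd => ?_
  have hsf' := destructorFree_state.1 hsf
  -- The old register may contain destructors, so the state is submitted in normal form.
  have hn : nf b (state (tpm p) x₁ x₂ x₃) = state (tpm (nf b p)) x₁ x₂ x₃ := by
    simp only [nf_state, nf_tpm, hsf'.2.1.nf_eq, hsf'.2.2.1.nf_eq, hsf'.2.2.2.nf_eq]
  refine .spawn (hr'.serves (.var, .repl tpmReset) (by simp [services])) (.par ?_)
  rw [Multiset.cons_swap]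
  refine .letIn os (by simp only [Term.subst, comp_vecEmpty, nf_os])
    (destructorFree_constant (by simp [Sym.IsDestructor]) rfl _)
    (.letIn ps (by simp only [Term.subst, comp_vecEmpty, nf_ps]) ps_destructorFree (.bang ?_))
  refine .recv (Function.update (fun _ => bot) .pfState (state (tpm (nf b p)) x₁ x₂ x₃)) ?_ ?_ ?_
    (.letIn (state (tpm ps) x₁ x₂ x₃) ?_ hsf (.send ?_ (.done ⟨hr'.mono hr'.finite
      (Set.subset_insert _ _) ?_, hE.trans (Set.subset_insert _ _), ?_⟩)))
  · simp only [Term.subst, Function.update_apply, reduceCtorEq, if_true, if_false]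
    exact ded_os
  · simp only [Pat.subst, Pat.inst, Term.subst, comp_vecCons, comp_vecEmpty, Function.update_apply,
      reduceCtorEq, if_true, if_false]
    exact ded_vec₃.2 ⟨ded_constant (by simp [Sym.IsPrivate]) rfl _, ded_bot, hn ▸ ded_nf.2 hd⟩
  · simp only [mem_binders_cons, mem_binders_nil, mem_binders_var, mem_binders_eq, or_false,
      false_or, forall_eq_or_imp, forall_eq, Function.update_apply, reduceCtorEq, if_true, if_false,
      nf_bot, true_and]
    rw [← hn, nf_nf]
  · simp only [Term.subst, comp_vecCons, comp_vecEmpty, mem_binders_cons, mem_binders_nil,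
      mem_binders_var, mem_binders_eq, or_false, false_or, Function.update_apply, reduceCtorEq,
      if_true, if_false, true_or, or_true]
    rw [(Rule.resetPs _ _ _ _).nf_eq, hsf.nf_eq]
  · simp only [Term.subst, mem_binders_cons, mem_binders_nil,
      mem_binders_var, mem_binders_eq, or_false, false_or, Function.update_apply, reduceCtorEq,
      if_true, if_false, true_or, or_true]
    exact ded_os
  · exact (le_cons₂ _ _).trans (Multiset.le_cons_self _ _)
  · refine (ded_vec₃ (x := resetResp) (y := bot).1 (ded_of_mem (Or.inl ?_))).2.2
    simp only [Term.subst, comp_vecCons, comp_vecEmpty, mem_binders_cons, mem_binders_nil,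
      mem_binders_var, mem_binders_eq, or_false, false_or, Function.update_apply, reduceCtorEq,
      if_true, if_false, true_or, or_true, nf_tup, hsf.nf_eq]
    simp

theorem Yields.extend (he : ExtendRuns b ext) {p x₁ x₂ x₃ v : Term} (hp : IsChain p)
    (hsf : (state (tpm p) x₁ x₂ x₃).DestructorFree) (hvf : v.DestructorFree)
    (hs : Yields b ext B (state (tpm p) x₁ x₂ x₃)) (hv : Yields b ext B v) :
    Yields b ext B (state (tpm (h (tup ![p, v]))) x₁ x₂ x₃) := by
  intro N E R hr
  refine hs.bind hr fun N₁ E₁ R₁ hr₁ hE₁ h₁ => hv.bind hr₁ fun N₂ E₂ R₂ hr₂ hE₂ h₂ => ?_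
  refine .spawnExtend hr₂.serves os (Or.inr rfl) fun ρ R' hR' hρ => ?_
  exact .extendEnv he (hρ ▸ ded_os) (h₁.mono hE₂) h₂ hp hsf hvf fun E₃ R₃ hE₃ hR₃ hd =>
    .done ⟨hr₂.mono hr₂.finite hE₃ (hR'.trans hR₃), (hE₁.trans hE₂).trans hE₃, hd⟩

/-- One launch with a program of the environment delivers both the measured state and the channel
granted to the program. -/
theorem Yields.launch (he : ExtendRuns b ext) {p i c m a d e x : Term}
    (hsf : (pst p ff c m a d e ff).DestructorFree) (hxf : x.DestructorFree)
    (hx : Yields b ext B x) (hs : Yields b ext B (pst p i c m a d e ff)) :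
    Yields b ext B (pst (h (tup ![pd, tup ![h (prog x), h m]])) ff c m a (prog x) e tt) ∧
      Yields b ext B (tpmCh (prog x)) := by
  constructor
  all_goals
    intro N E R hr
    refine hs.bind hr fun N₁ E₁ R₁ hr₁ hE₁ h₁ => hx.bind hr₁ fun N₂ E₂ R₂ hr₂ hE₂ h₂ => ?_
    obtain ⟨j, hj⟩ := exists_fresh hr₂.finite .nonce
    refine .launchEnv he hr₂.serves j hj h₂ hxf (h₁.mono hE₂) hsf
      fun δ E₃ R₃ hE₃ hR₃ _ h₃ h₄ _ _ _ => .done ⟨hr₂.mono (hr₂.finite.insert _) hE₃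
        (hR₃.trans (Multiset.le_cons_self _ _)), (hE₁.trans hE₂).trans hE₃, ?_⟩
  · exact h₃
  · exact h₄

theorem Yields.init (he : ExtendRuns b ext) {p i c m a d e y : Term}
    (hsf : (pst p ff c m a d e ff).DestructorFree) (hyf : y.DestructorFree)
    (hy : Yields b ext B y) (hs : Yields b ext B (pst p i c m a d e ff)) :
    Yields b ext B (pst (h (tup ![h (tup ![pd, tup ![h (prog Tinit), h m]]), h y])) ff c m a
      (prog Tinit) y tt) := by
  intro N E R hr
  refine hs.bind hr fun N₁ E₁ R₁ hr₁ hE₁ h₁ => hy.bind hr₁ fun N₂ E₂ R₂ hr₂ hE₂ h₂ =>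
    (yields_prog (k := 0) (by norm_num)).bind hr₂ fun N₃ E₃ R₃ hr₃ hE₃ h₃ => ?_
  exact .runInit he hr₃.serves hr₃.finite ((h₁.mono hE₂).mono hE₃) hsf (h₂.mono hE₃) hyf h₃
    fun N₄ E₄ R₄ hN₄ hE₄ hR₄ hd => .done ⟨hr₃.mono hN₄ hE₄ hR₄,
      ((hE₁.trans hE₂).trans hE₃).trans hE₄, hd⟩

/-- The protected program publishes its state immediately after enabling the interrupts; the run is
abandoned there. -/
theorem Yields.ppInt (he : ExtendRuns b ext) (hst : startState ∈ B) {p i c m a d : Term}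
    (hsf : (pst p tt c m a d (prog Tpp) tt).DestructorFree)
    (hs : Yields b ext B (pst p i c m a d (prog Tpp) tt)) :
    Yields b ext B (pst p tt c m a d (prog Tpp) tt) := by
  intro N E R hr
  refine hs.bind hr fun N₁ E₁ R₁ hr₁ hE₁ h₁ => .runPp he hr₁.serves hr₁.finite
    (hr₁.base _ hst) h₁ hsf fun δ N₂ E₂ R₂ hN₂ hE₂ hR₂ h₂ _ _ => .send ded_subst_os
      (.done ⟨hr₁.mono hN₂ (hE₂.trans (Set.subset_insert _ _))
        (hR₂.trans (Multiset.le_cons_self _ _)),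
        hE₁.trans (hE₂.trans (Set.subset_insert _ _)), ded_of_mem (Or.inl ?_)⟩)
  rw [Term.subst, h₂, hsf.nf_eq]

/-- Two states are involved: one lets the module unseal the key on the channel of `Tpp`, the other
makes the protected program run. -/
theorem Yields.unsealPp (he : ExtendRuns b ext) (hst : startState ∈ B) {k w : Term}
    {q i c m a d p' i' c' m' a' d' : Term} (hq : q.DestructorFree)
    (hkf : k.DestructorFree) (hwf : w.DestructorFree)
    (hk : Yields b ext B (sealD k q)) (hw : Yields b ext B (senc w k))
    (hsf : (pst p' tt c' m' a' d' (prog Tpp) tt).DestructorFree)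
    (hs : Yields b ext B (pst q i c m a d (prog Tpp) tt))
    (hs' : Yields b ext B (pst p' i' c' m' a' d' (prog Tpp) tt)) : Yields b ext B w := by
  intro N E R hr
  refine hs.bind hr fun N₁ E₁ R₁ hr₁ hE₁ h₁ => hs'.bind hr₁ fun N₂ E₂ R₂ hr₂ hE₂ h₂ =>
    hk.bind hr₂ fun N₃ E₃ R₃ hr₃ hE₃ h₃ => hw.bind hr₃ fun N₄ E₄ R₄ hr₄ hE₄ h₄ =>
    .runPp he hr₄.serves hr₄.finite (hr₄.base _ hst) (h₂.mono (hE₃.trans hE₄)) hsf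
    fun δ N₅ E₅ R₅ hN₅ hE₅ hR₅ _ h₅ _ =>
    .ppUnseal (hr₄.serves.mono hR₅) h₅ (h₁.mono (hE₂.trans (hE₃.trans (hE₄.trans hE₅)))) hq
      (h₃.mono (hE₄.trans hE₅)) hkf (h₄.mono hE₅) hwf fun δ' E₆ R₆ hE₆ hR₆ _ _ hd =>
      .done ⟨hr₄.mono hN₅ (hE₅.trans hE₆) ((hR₅.trans hR₆).trans (Multiset.le_cons_self _ _)),
        hE₁.trans (hE₂.trans (hE₃.trans (hE₄.trans (hE₅.trans hE₆)))), hd⟩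

/-- To reach its end the protected program must unseal and decrypt something, so it is fed with
dummy data. -/
theorem Yields.ppEnd (he : ExtendRuns b ext) (hst : startState ∈ B) {p i c m a d : Term}
    (hp : IsChain p) (hsf : (pst p tt c m a d (prog Tpp) tt).DestructorFree)
    (hs : Yields b ext B (pst p i c m a d (prog Tpp) tt)) :
    Yields b ext B (pst (h (tup ![p, bot])) tt c m a d (prog Tpp) ff) := by
  intro N E R hr
  have hbf : bot.DestructorFree := destructorFree_constant (by simp [Sym.IsDestructor]) rfl _
  have hpf := (destructorFree_pst.1 hsf).1
  have hef := destructorFree_extend hsf hbf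
  have hlf : (pst (h (tup ![p, bot])) tt c m a d (prog Tpp) ff).DestructorFree := by
    rw [destructorFree_pst] at hef ⊢
    exact ⟨hef.1, hef.2.1, hef.2.2.1, hef.2.2.2.1, hef.2.2.2.2.1,
      destructorFree_constant (by simp [Sym.IsDestructor]) rfl _⟩
  refine hs.bind hr fun N₁ E₁ R₁ hr₁ hE₁ h₁ => .runPp he hr₁.serves hr₁.finite
    (hr₁.base _ hst) h₁ hsf fun δ N₂ E₂ R₂ hN₂ hE₂ hR₂ h₂ h₃ hm => ?_
  have hpd : Ded b E₂ p := ded_of_rule (f := .pcr) (by simp [Sym.IsPrivate])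
    (forall_vec₁ (h₁.mono hE₂)) (.pcr _ _ _ _)
  -- The constant `bot` is sealed under the register of the state itself, which can be read, and
  -- serves as key and as message.
  refine .ppUnseal (q := p) (k := bot) (w := bot) (hr₁.serves.mono hR₂) h₃ (h₁.mono hE₂) hpf
    (ded_app (by simp [Sym.IsPrivate]) (forall_vec₂ ded_bot hpd)) hbf
    (ded_app (by simp [Sym.IsPrivate]) (forall_vec₂ ded_bot ded_bot)) hbf
    fun δ' E₃ R₃ hE₃ hR₃ h₄ h₅ _ => ?_
  obtain ⟨j, hj⟩ := exists_fresh hN₂ .rand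
  refine .new j (by simp [platformNames]) hj (.spawn (Multiset.mem_cons_of_mem
    (Multiset.mem_of_le hR₃ hm)) (.extendComm he (m := ⟨.rand, j⟩) ?_ ?_ ?_ ?_ hp hsf hbf
      fun E₄ R₄ hE₄ hR₄ => .letIn (pst (h (tup ![p, bot])) tt c m a d (prog Tpp) ff) ?_ hlf
      (.send ded_subst_os (.done ⟨hr₁.mono (hN₂.insert _) ((hE₂.trans (hE₃.trans hE₄)).trans
        (Set.subset_insert _ _)) ((hR₂.trans (hR₃.trans hR₄)).trans (Multiset.le_cons_self _ _)),
        ((hE₁.trans (hE₂.trans (hE₃.trans hE₄))).trans (Set.subset_insert _ _)), ?_⟩))))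
  · simp only [Term.subst, Function.update_apply, reduceCtorEq, if_true, if_false, h₅]
  · simp only [Function.update_self]
  · simp only [Term.subst, Function.update_apply, reduceCtorEq, if_true, if_false, h₄, h₂]
  · simp only [Term.subst, comp_vecEmpty]
  · simp only [Term.subst, comp_vecCons, comp_vecEmpty, Function.update_self]
    rw [(Rule.setLockPp _ _ _ _ _ _ _).nf_eq, hlf.nf_eq]
  · refine ded_of_mem (Or.inl ?_)
    simp only [Term.subst, Function.update_self, hlf.nf_eq]

theorem Yields.unsealOs {q i c m a d e l k : Term} (hq : q.DestructorFree)
    (hkf : k.DestructorFree) (hk : Yields b ext B (sealD k q)) (hl : nf b l ≠ tt)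
    (hs : Yields b ext B (pst q i c m a d e l)) : Yields b ext B k := by
  intro N E R hr
  refine hs.bind hr fun N₁ E₁ R₁ hr₁ hE₁ h₁ => hk.bind hr₁ fun N₂ E₂ R₂ hr₂ hE₂ h₂ => ?_
  refine .spawn (hr₂.serves (.var, .repl tpmUnseal) (by simp [services]))
    (.recvVar (nf b (pst q i c m a d e l)) ded_subst_os (ded_nf.2 (h₁.mono hE₂)) (nf_nf _ _) ?_)
  simp only [nf_state, nf_tpm, nf_cpu, nf_smram, nf_drt, hq.nf_eq]
  refine .iteFalse ?_ (.letIn os (by simp only [Term.subst, comp_vecEmpty, nf_os])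
    (destructorFree_constant (by simp [Sym.IsDestructor]) rfl _)
    (.unsealEnv (q := q) ?_ ?_ hq h₂ hkf fun E₃ R₃ hE₃ hR₃ hd =>
      .done ⟨hr₂.mono hr₂.finite hE₃ hR₃, (hE₁.trans hE₂).trans hE₃, hd⟩))
  · simp only [Term.subst, comp_vecCons, comp_vecEmpty, Function.update_self]
    rwa [(Rule.lock _ _ _ _ _ _).nf_eq, nf_nf, nf_tt]
  · simp only [Function.update_self]
    exact ded_os
  · simp only [Function.update_apply, reduceCtorEq, if_true, if_false]
    rw [(Rule.pcr _ _ _ _).nf_eq, hq.nf_eq]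

/-- The environment owns the channel of the loaded program, so it can use the unsealing service of a
locked state. -/
theorem Yields.unsealCh {q i c m a d e k : Term} (hq : q.DestructorFree)
    (hkf : k.DestructorFree) (hk : Yields b ext B (sealD k q)) (hef : e.DestructorFree)
    (he : Yields b ext B (tpmCh (prog e)))
    (hs : Yields b ext B (pst q i c m a d (prog e) tt)) : Yields b ext B k := by
  intro N E R hr
  refine hs.bind hr fun N₁ E₁ R₁ hr₁ hE₁ h₁ => hk.bind hr₁ fun N₂ E₂ R₂ hr₂ hE₂ h₂ =>
    he.bind hr₂ fun N₃ E₃ R₃ hr₃ hE₃ h₃ => ?_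
  refine .spawn (hr₃.serves (.var, .repl tpmUnseal) (by simp [services]))
    (.recvVar (nf b (pst q i c m a d (prog e) tt)) ded_subst_os
      (ded_nf.2 ((h₁.mono hE₂).mono hE₃)) (nf_nf _ _) ?_)
  simp only [nf_state, nf_tpm, nf_cpu, nf_smram, nf_drt, nf_prog, nf_tt, hq.nf_eq, hef.nf_eq]
  refine .iteTrue ?_ (.letIn (tpmCh (prog e)) ?_ ?_
    (.unsealEnv (q := q) ?_ ?_ hq (h₂.mono hE₃) hkf fun E₄ R₄ hE₄ hR₄ hd =>
      .done ⟨hr₃.mono hr₃.finite hE₄ hR₄, ((hE₁.trans hE₂).trans hE₃).trans hE₄, hd⟩))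
  · simp only [Term.subst, comp_vecCons, comp_vecEmpty, Function.update_self]
    rw [(Rule.lock _ _ _ _ _ _).nf_eq]
  · simp only [Term.subst, comp_vecCons, comp_vecEmpty, Function.update_self, nf_tpmCh]
    rw [(Rule.pp _ _ _ _ _ _).nf_eq, nf_prog, hef.nf_eq]
  · simpa [destructorFree_app, Sym.IsDestructor] using hef
  · simpa only [Function.update_self] using h₃
  · simp only [Function.update_apply, reduceCtorEq, if_true, if_false]
    rw [(Rule.pcr _ _ _ _).nf_eq, hq.nf_eq]

/-- The closure properties of the terms that the environment can obtain. -/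
theorem obtainable_yields (he : ExtendRuns b ext) {k₀ m₀ : Name} (hst : startState ∈ B)
    (hse : senc (.name m₀) (.name k₀) ∈ B) (hsl : sealD (.name k₀) hchain ∈ B) :
    Obtainable b (Yields b ext B) k₀ m₀ := by
  have yB : ∀ {T}, T ∈ B → Yields b ext B T := fun hT => yields_of_ded fun E hE => hE _ hT
  have ytpm : ∀ {e}, e.DestructorFree → Yields b ext B e → Yields b ext B (tpmCh (prog e)) :=
    fun hef hy => (Yields.launch he startState_destructorFree hef hy (yB hst)).2
  exact
    { congr := fun e hT N E R hr => hT.bind hr fun N' E' R' hr' hE hd =>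
        .done ⟨hr', hE, hd.congr e⟩
      app := fun f args => yields_app
      name := fun n hn => yields_of_ded fun E _ => ded_name hn
      prog := fun k => yields_prog
      senc := yB hse
      sealD := yB hsl
      start := yB hst
      reset := Yields.reset
      extend := Yields.extend he
      tpmCh := ytpm
      launch := fun h₁ h₂ h₃ h₄ => (Yields.launch he h₁ h₂ h₃ h₄).1
      init := Yields.init he
      ppInt := Yields.ppInt he hst
      ppEnd := Yields.ppEnd he hst
      unsealOs := Yields.unsealOs hchain_destructorFree (destructorFree_name _) (yB hsl)
      unsealCh := fun hef hy => Yields.unsealCh hchain_destructorFree (destructorFree_name _) (yB hsl) hef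
        (ytpm hef hy)
      unsealPp := Yields.unsealPp he hst hchain_destructorFree (destructorFree_name _) (destructorFree_name _) (yB hsl) (yB hse) }

end Yields

/-! ### Initialization of the platform -/

section Start

variable {b : ℕ} {Φ : Set Name → Set Term → Multiset Thread → Prop} {N : Set Name} {E : Set Term}
  {R : Multiset Thread} {ext : Proc}

/-- The environment can choose the nonces that it learns. -/
theorem Can.nonces (he : ExtendRuns b ext) (I : Finset ℕ) (hR : Serves ext R)
    (hst : Ded b E startState) (hN : N.Finite) (hI : ∀ i ∈ I, (⟨.nonce, i⟩ : Name) ∉ N)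
    (hc : ∀ N' E' R', N'.Finite → E ⊆ E' → R ≤ R' →
      (∀ i ∈ I, Ded b E' (.name ⟨.nonce, i⟩)) → Can b Φ N' E' R') : Can b Φ N E R := by
  induction I using Finset.induction_on generalizing N E R with
  | empty => exact hc N E R hN subset_rfl le_rfl (by simp)
  | insert a I ha ih =>
    simp only [Finset.mem_insert, forall_eq_or_imp] at hI hc
    -- Every launch of a program of the environment discloses the nonce of the CPU, and its index
    -- can be any unused one.
    refine .launchEnv he hR a hI.1 ded_os (destructorFree_constant (by simp [Sym.IsDestructor])
      rfl _) hst startState_destructorFree fun δ E₁ R₁ hE₁ hR₁ h₁ _ _ _ _ _ => ?_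
    refine ih ((hR.mono hR₁).cons _) (hst.mono hE₁) (hN.insert _) ?_
      fun N₂ E₂ R₂ hN₂ hE₂ hR₂ h₂ => ?_
    · rintro i hi (e | hi')
      · cases e
        exact ha hi
      · exact hI.2 i hi hi'
    · exact hc N₂ E₂ R₂ hN₂ (hE₁.trans hE₂) ((hR₁.trans (Multiset.le_cons_self _ _)).trans hR₂)
        ⟨h₁.mono hE₂, h₂⟩

/-- The terms that the environment obtains in the beginning. -/
def baseTerms (k₀ m₀ : Name) (I : Finset ℕ) : Set Term :=
  {startState, senc (.name m₀) (.name k₀), sealD (.name k₀) hchain} ∪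
    {T | ∃ i ∈ I, T = .name ⟨.nonce, i⟩}

theorem subst_hchain (ρ : Ident → Term) : hchain.subst ρ = hchain := by
  simp only [hchain, Term.subst, comp_vecCons, comp_vecEmpty]

/-- The platform can be brought into a state in which it offers its services. -/
theorem Can.start (he : ExtendRuns b ext) (i j : ℕ) (I : Finset ℕ)
    (hc : ∀ N E R, Ready b ext (baseTerms ⟨.kpp, i⟩ ⟨.hipp, j⟩ I) N E R → Can b Φ N E R) :
    Can b Φ ∅ ∅ {(.var, .par (TPM ext) EXEC)} := by
  rw [← Multiset.cons_zero]
  refine .par (.par ?_)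
  rw [Multiset.cons_swap]
  refine .par ?_
  rw [cons_rotate₄]
  refine .par ?_
  rw [Multiset.cons_swap]
  refine .par ?_
  rw [Multiset.cons_swap]
  refine .par ?_
  refine .recvVar bot ded_subst_os ded_bot (nf_bot b)
    (.recvVar bot ded_subst_os ded_bot (nf_bot b) (.send ded_subst_os ?_))
  rw [Multiset.cons_swap]
  -- The copies of the key and of the message get the prescribed indices, so as to agree with the
  -- execution that is being imitated.
  refine .par (.new i (by simp [platformNames]) (by simp)
    (.new j (by simp [platformNames]) (by simp) (.send ded_subst_os
      (.letIn (sealD (.name ⟨.kpp, i⟩) hchain) ?_ ?_ (.send ded_subst_os ?_)))))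
  · simp only [Term.subst, comp_vecCons, comp_vecEmpty, subst_hchain, Function.update_apply,
      reduceCtorEq, if_true, if_false, nf_sealD, nf_name, hchain_destructorFree.nf_eq]
  · have := hchain_destructorFree
    simp [destructorFree_app, forall_vecCons, Sym.IsDestructor, this, destructorFree_name]
  generalize hE : insert _ (insert _ (insert _ (∅ : Set Term))) = E
  have h₁ : Ded b E startState := by
    refine ded_of_mem (hE ▸ Or.inr (Or.inr (Or.inl ?_)))
    simp only [Term.subst, comp_vecCons, comp_vecEmpty, Function.update_apply, reduceCtorEq,
      if_true, if_false, nf_state, nf_tpm, nf_cpu, nf_smram, nf_drt, nf_bot, nf_tt, nf_ff, nf_ps]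
  have h₂ : Ded b E (senc (.name ⟨.hipp, j⟩) (.name ⟨.kpp, i⟩)) := by
    refine ded_of_mem (hE ▸ Or.inr (Or.inl ?_))
    simp only [Term.subst, comp_vecCons, comp_vecEmpty, Function.update_apply, reduceCtorEq,
      if_true, if_false, nf_senc, nf_name]
  have h₃ : Ded b E (sealD (.name ⟨.kpp, i⟩) hchain) := by
    refine ded_of_mem (hE ▸ Or.inl ?_)
    simp only [Term.subst, Function.update_self, nf_sealD, nf_name, hchain_destructorFree.nf_eq]
  have hS : ∀ t₁ t₂, Serves ext (t₁ ::ₘ (.var, .repl PP) ::ₘ t₂ ::ₘ (.var, .repl INIT) ::ₘ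
      (.var, CPU) ::ₘ (.var, .repl (tpmExtend ext)) ::ₘ (.var, .repl tpmUnseal) ::ₘ
      (.var, .repl tpmReset) ::ₘ (0 : Multiset Thread)) := by
    intro t₁ t₂ t ht
    simp only [services, Set.mem_insert_iff, Set.mem_singleton_iff] at ht
    simp only [Multiset.mem_cons]
    tauto
  refine .nonces he I (hS _ _) h₁ (((Set.finite_empty).insert _).insert _) (by simp)
    fun N' E' R' hN hE' hR' h₄ => hc N' E' R' ⟨hN, ?_, (hS _ _).mono hR'⟩
  rintro S ((rfl | rfl | rfl) | ⟨l, hl, rfl⟩)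
  · exact h₁.mono hE'
  · exact h₂.mono hE'
  · exact h₃.mono hE'
  · exact h₄ l hl

end Start

/-! ### The platform is closed -/

theorem iUnion_vecCons {α β : Type*} {n : ℕ} (f : β → Set α) (x : β) (v : Fin n → β) :
    ⋃ i : Fin n.succ, f (Matrix.vecCons x v i) = f x ∪ ⋃ i, f (v i) := by
  ext a
  simp only [Set.mem_iUnion, Fin.exists_fin_succ, Matrix.cons_val_zero, Matrix.cons_val_succ,
    Set.mem_union]

theorem iUnion_fin_zero {α β : Type*} (f : β → Set α) (v : Fin 0 → β) :
    ⋃ i, f (v i) = ∅ := by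
  simp

theorem freeVars_TPM {ext : Proc} (he : ext.freeVars ⊆ {.ch}) : (TPM ext).freeVars = ∅ := by
  rw [Set.eq_empty_iff_forall_notMem]
  intro x
  have h₂ : x ∈ ext.freeVars → x = .ch := fun hx => he hx
  simp only [TPM, tpmReset, pcrReset, tpmUnseal, unsealProc, tpmExtend, Proc.freeVars, Term.vars,
    iUnion_vecCons, iUnion_fin_zero, Pat.terms, mem_binders_cons, mem_binders_nil, mem_binders_var,
    mem_binders_eq, Set.mem_union, Set.mem_sdiff, Set.mem_empty_iff_false, Set.mem_singleton_iff,
    Set.mem_iUnion, exists_prop, Finset.mem_coe, or_false, false_or, exists_eq_left,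
    exists_eq_or_imp, or_imp]
  grind

theorem freeVars_EXEC : EXEC.freeVars = ∅ := by
  rw [Set.eq_empty_iff_forall_notMem]
  intro x
  simp only [EXEC, CPU, INIT, SETUP, DATA, PP, hchain, Proc.freeVars, Term.vars, iUnion_vecCons,
    iUnion_fin_zero, Pat.terms, mem_binders_cons, mem_binders_nil, mem_binders_var, mem_binders_eq,
    Set.mem_union, Set.mem_sdiff, Set.mem_empty_iff_false, Set.mem_singleton_iff, Set.mem_iUnion,
    exists_prop, Finset.mem_coe, or_false, false_or, exists_eq_left, exists_eq_or_imp, or_imp]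
  grind

theorem freeVars_pcrExtend : pcrExtend.freeVars ⊆ {.ch} := by
  intro x
  simp only [pcrExtend, Proc.freeVars, Term.vars, iUnion_vecCons,
    iUnion_fin_zero, Pat.terms, mem_binders_cons, mem_binders_nil, mem_binders_var, mem_binders_eq,
    Set.mem_union, Set.mem_sdiff, Set.mem_empty_iff_false, Set.mem_singleton_iff, Set.mem_iUnion,
    exists_prop, Finset.mem_coe, or_false, false_or, exists_eq_left, exists_eq_or_imp, or_imp]
  grind

theorem freeVars_pcrExtendBounded : pcrExtendBounded.freeVars ⊆ {.ch} := by
  intro x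
  simp only [pcrExtendBounded, pcrExtendSmall, pcrExtendBig, bigReply, Proc.freeVars, Term.vars,
    iUnion_vecCons, iUnion_fin_zero, Pat.terms, mem_binders_cons, mem_binders_nil, mem_binders_var,
    mem_binders_eq, Set.mem_union, Set.mem_sdiff, Set.mem_empty_iff_false, Set.mem_singleton_iff,
    Set.mem_iUnion, exists_prop, Finset.mem_coe, or_false, false_or, exists_eq_left,
    exists_eq_or_imp, or_imp]
  grind

theorem names_TPM {ext : Proc} (he : ext.names = ∅) : (TPM ext).names = ∅ := by
  simp only [Proc.names, Set.iUnion_eq_empty] at he ⊢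
  simp only [TPM, tpmReset, pcrReset, tpmUnseal, unsealProc, tpmExtend, Proc.terms, Pat.terms,
    iUnion_vecCons, iUnion_fin_zero, Set.mem_union, Set.mem_insert_iff, Set.mem_singleton_iff,
    Set.mem_empty_iff_false, or_false, false_or, forall_eq_or_imp, or_imp, forall_and, forall_eq,
    Term.names, Set.union_empty, and_true, true_and]
  exact ⟨he, he, he⟩

theorem names_EXEC : EXEC.names = ∅ := by
  simp only [Proc.names, Set.iUnion_eq_empty]
  simp only [EXEC, CPU, INIT, SETUP, DATA, PP, hchain, Proc.terms, Pat.terms,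
    iUnion_vecCons, iUnion_fin_zero, Set.mem_union, Set.mem_insert_iff, Set.mem_singleton_iff,
    Set.mem_empty_iff_false, or_false, false_or, forall_eq_or_imp, or_imp, forall_and, forall_eq,
    Term.names, Set.union_empty, and_true, true_and, false_imp_iff, implies_true]

theorem names_pcrExtend : pcrExtend.names = ∅ := by
  simp only [Proc.names, Set.iUnion_eq_empty]
  simp only [pcrExtend, Proc.terms, Pat.terms,
    iUnion_vecCons, iUnion_fin_zero, Set.mem_union, Set.mem_insert_iff, Set.mem_singleton_iff,
    Set.mem_empty_iff_false, or_false, false_or, forall_eq_or_imp, or_imp, forall_and, forall_eq,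
    Term.names, Set.union_empty, and_true, true_and, false_imp_iff, implies_true]

theorem names_pcrExtendBounded : pcrExtendBounded.names = ∅ := by
  simp only [Proc.names, Set.iUnion_eq_empty]
  simp only [pcrExtendBounded, pcrExtendSmall, pcrExtendBig, bigReply, Proc.terms, Pat.terms,
    iUnion_vecCons, iUnion_fin_zero, Set.mem_union, Set.mem_insert_iff, Set.mem_singleton_iff,
    Set.mem_empty_iff_false, or_false, false_or, forall_eq_or_imp, or_imp, forall_and, forall_eq,
    Term.names, Set.union_empty, and_true, true_and, false_imp_iff, implies_true]

theorem restricted_platform {ext : Proc} (he : ext.restricted = ∅) :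
    (Proc.par (TPM ext) EXEC).restricted = platformNames := by
  ext x
  simp only [TPM, tpmReset, pcrReset, tpmUnseal, unsealProc, tpmExtend, EXEC, CPU, INIT, SETUP,
    DATA, PP, Proc.restricted, he, platformNames, Set.mem_union, Set.mem_insert_iff,
    Set.mem_singleton_iff, Set.mem_empty_iff_false, or_false, false_or]
  tauto

/-- A process for an extension of the register that closes the platform, has no names of its own,
and serves requests. -/
structure IsExtend (b : ℕ) (ext : Proc) : Prop where
  freeVars : ext.freeVars ⊆ {.ch}
  names : ext.names = ∅
  restricted : ext.restricted = ∅
  runs : ExtendRuns b ext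

theorem isExtend_pcrExtend {b : ℕ} : IsExtend b pcrExtend :=
  ⟨freeVars_pcrExtend, names_pcrExtend, rfl, extendRuns_pcrExtend⟩

theorem isExtend_pcrExtendBounded {b : ℕ} : IsExtend b pcrExtendBounded :=
  ⟨freeVars_pcrExtendBounded, names_pcrExtendBounded, by
    simp [pcrExtendBounded, pcrExtendSmall, pcrExtendBig, bigReply, Proc.restricted],
    extendRuns_pcrExtendBounded⟩

theorem IsExtend.freeVars_platform {b : ℕ} {ext : Proc} (he : IsExtend b ext) :
    (Proc.par (TPM ext) EXEC).freeVars = ∅ := by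
  simp [Proc.freeVars, freeVars_TPM he.freeVars, freeVars_EXEC]

theorem IsExtend.names_platform {b : ℕ} {ext : Proc} (he : IsExtend b ext) :
    (Proc.par (TPM ext) EXEC).names = ∅ := by
  have h₁ := names_TPM he.names
  have h₂ := names_EXEC
  rw [Proc.names] at h₁ h₂ ⊢
  rw [Proc.terms, Set.biUnion_union, h₁, h₂, Set.union_empty]

theorem IsExtend.mem_att {b : ℕ} {ext : Proc} (he : IsExtend b ext) (i j : ℕ) (I : Finset ℕ)
    {T : Term} (hT : Yields b ext (baseTerms ⟨.kpp, i⟩ ⟨.hipp, j⟩ I) T) :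
    T ∈ Att b (.par (TPM ext) EXEC) :=
  att_of_can he.freeVars_platform he.names_platform (restricted_platform he.restricted).le
    (.start he.runs i j I fun _ _ _ hr => hT.bind hr fun _ _ _ _ _ hd => .done hd)

/-! ### The number of names generated by a process -/

/-- A bound for the number of copies of a name that a process can generate. -/
noncomputable def Proc.generated (n : Ident) : Proc → ℕ∞
  | .nil => 0
  | .par P Q => P.generated n + Q.generated n
  | .repl P => ⊤ * P.generated n
  | .new m P => (if m = n then 1 else 0) + P.generated n
  | .inp _ _ P => P.generated n
  | .out _ _ P => P.generated n
  | .ite _ _ P Q => P.generated n + Q.generated n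
  | .letIn _ _ P => P.generated n

theorem Proc.generated_subst (n : Ident) (P : Proc) (σ : Ident → Term) :
    (P.subst σ).generated n = P.generated n := by
  induction P generalizing σ <;> simp_all [Proc.subst, Proc.generated]

theorem Proc.generated_eq_zero {n : Ident} {P : Proc} (hn : n ∉ P.restricted) :
    P.generated n = 0 := by
  induction P with
  | new m P ih =>
    simp only [Proc.restricted, Set.singleton_union, Set.mem_insert_iff, not_or] at hn
    rw [Proc.generated, if_neg (Ne.symm hn.1), ih hn.2, add_zero]
  | _ => simp_all [Proc.restricted, Proc.generated]

/-- A bound for the number of copies of a name in the configurations to come. -/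
noncomputable def Config.generated (n : Ident) (c : Config) : ℕ∞ :=
  {i | (⟨n, i⟩ : Name) ∈ c.names}.encard + (c.procs.map (Proc.generated n)).sum

theorem Step.generated_le {b : ℕ} {n : Ident} {c c' : Config} (hs : Step b c c') :
    c'.generated n ≤ c.generated n := by
  cases hs
  case bang N M R P =>
    simp only [Config.generated, Multiset.map_cons, Multiset.sum_cons, Proc.generated, ← add_assoc]
    -- Replication counts with factor `⊤`, which absorbs the copy split off unless the process
    -- generates nothing.
    by_cases h₀ : P.generated n = 0
    · simp [h₀]
    · simp [ENat.top_mul h₀]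
  case new N M R m P i hi =>
    simp only [Config.generated, Multiset.map_cons, Multiset.sum_cons, Proc.generated,
      Proc.generated_subst]
    by_cases hm : m = n
    · subst hm
      have : {j | (⟨m, j⟩ : Name) ∈ insert ⟨m, i⟩ N} = insert i {j | (⟨m, j⟩ : Name) ∈ N} := by
        ext j
        simp
      rw [this, Set.encard_insert_of_notMem (by simpa using hi), if_pos rfl]
      simp only [add_assoc, le_refl]
    · have : {j | (⟨n, j⟩ : Name) ∈ insert ⟨m, i⟩ N} = {j | (⟨n, j⟩ : Name) ∈ N} := by
        ext j
        simp [Ne.symm hm]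
      rw [this, if_neg hm, zero_add]
  all_goals
    simp only [Config.generated, Multiset.map_cons, Multiset.sum_cons, Proc.generated,
      Proc.generated_subst]
  case iteTrue =>
    gcongr
    exact le_self_add
  case iteFalse =>
    gcongr
    exact le_add_self
  all_goals simp only [zero_add, add_assoc, le_refl]

theorem Reaches.generated_le {b : ℕ} {n : Ident} {P Q : Proc} {c : Config}
    (hr : Reaches b P Q c) : c.generated n ≤ (initConfig P Q).generated n := by
  induction hr with
  | refl => exact le_rfl
  | tail _ hs ih => exact hs.generated_le.trans ih

/-- The names of the platform are not among the free names of the platform and its attacker. -/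
theorem notMem_initConfig {P Q : Proc} (hP : P.names = ∅) (hQ : IsAttacker P Q) {m : Name}
    (hn : m.base ∈ P.restricted) : m ∉ (initConfig P Q).names := by
  intro hm
  obtain ⟨S, hS, hm⟩ := Set.mem_iUnion₂.1 hm
  rcases hS with hS | hS
  · exact absurd (Set.mem_biUnion hS hm) (by rw [← Proc.names, hP]; simp)
  · exact hQ.names_fresh m (Set.mem_biUnion hS hm) hn

/-- The attacker neither uses nor restricts the names of the platform, so only the platform
contributes. -/
theorem encard_names_le {b : ℕ} {n : Ident} {P Q : Proc} (hP : P.names = ∅)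
    (hQ : IsAttacker P Q) (hn : n ∈ P.restricted) {c : Config} (hr : Reaches b P Q c) :
    {i | (⟨n, i⟩ : Name) ∈ c.names}.encard ≤ P.generated n := by
  have h₁ := (le_self_add.trans hr.generated_le : {i | (⟨n, i⟩ : Name) ∈ c.names}.encard ≤ _)
  rw [Config.generated] at h₁
  have h₂ : {i | (⟨n, i⟩ : Name) ∈ (initConfig P Q).names} = ∅ :=
    Set.eq_empty_of_forall_notMem fun i => notMem_initConfig hP hQ (m := ⟨n, i⟩) hn
  rw [h₂] at h₁
  simpa [initConfig, Proc.generated,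
    Proc.generated_eq_zero fun hn' => hQ.restricted_fresh n hn' hn] using h₁

theorem exists_index {b : ℕ} {n : Ident} {P Q : Proc} (hP : P.names = ∅) (hQ : IsAttacker P Q)
    (hn : n ∈ P.restricted) (hg : P.generated n ≤ 1) {c : Config} (hr : Reaches b P Q c) :
    ∃ i₀, ∀ i, (⟨n, i⟩ : Name) ∈ c.names → i = i₀ := by
  have h₁ := Set.encard_le_one_iff.1 ((encard_names_le hP hQ hn hr).trans hg)
  by_cases hi : ∃ i, (⟨n, i⟩ : Name) ∈ c.names
  · obtain ⟨i, hi⟩ := hi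
    exact ⟨i, fun j hj => h₁ j i hj hi⟩
  -- If the name has not been generated, any index will do.
  · exact ⟨0, fun i h₂ => absurd ⟨i, h₂⟩ hi⟩

/-- Nonces are generated under replication without a uniform bound, but a single execution has only
finitely many steps. -/
theorem finite_names {b : ℕ} {n : Ident} {P Q : Proc} (hP : P.names = ∅) (hQ : IsAttacker P Q)
    (hn : n ∈ P.restricted) {c : Config} (hr : Reaches b P Q c) :
    {i | (⟨n, i⟩ : Name) ∈ c.names}.Finite := by
  induction hr with
  | refl =>
    convert Set.finite_empty
    exact Set.eq_empty_of_forall_notMem fun i => notMem_initConfig hP hQ (m := ⟨n, i⟩) hn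
  | tail _ hs ih =>
    cases hs
    case new n P i hi _ =>
      refine (ih.insert i).subset ?_
      rintro j (hj | hj)
      · cases hj
        exact Or.inl rfl
      · exact Or.inr hj
    all_goals exact ih

/-- The process `DATA` is not replicated. -/
theorem IsExtend.generated_kpp {b : ℕ} {ext : Proc} (he : IsExtend b ext) :
    (Proc.par (TPM ext) EXEC).generated .kpp ≤ 1 := by
  have h₁ : (TPM ext).generated .kpp = 0 := Proc.generated_eq_zero (by
    simp [TPM, tpmReset, pcrReset, tpmUnseal, unsealProc, tpmExtend, Proc.restricted, he.restricted])
  simp [Proc.generated, h₁, EXEC, CPU, INIT, SETUP, DATA, PP]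

theorem IsExtend.generated_hipp {b : ℕ} {ext : Proc} (he : IsExtend b ext) :
    (Proc.par (TPM ext) EXEC).generated .hipp ≤ 1 := by
  have h₁ : (TPM ext).generated .hipp = 0 := Proc.generated_eq_zero (by
    simp [TPM, tpmReset, pcrReset, tpmUnseal, unsealProc, tpmExtend, Proc.restricted, he.restricted])
  simp [Proc.generated, h₁, EXEC, CPU, INIT, SETUP, DATA, PP]

/-! ### The length of register values -/

theorem HasLength.succ_inv {n : ℕ} {T : Term} (hT : HasLength (n + 1) T) :
    ∃ p v, T = h (tup ![p, v]) ∧ HasLength n p := by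
  obtain ⟨T₀, l, hl, rfl⟩ := hT
  rcases l.eq_nil_or_concat' with rfl | ⟨l', v, rfl⟩
  · simp at hl
  · exact ⟨_, v, chain_append_singleton _ _ _, T₀, l', by simpa using hl, rfl⟩

theorem HasLength.bounded (T : Term) : ∃ N, ∀ n, HasLength n T → n ≤ N := by
  have zero : ∀ T : Term, (∀ p v, T ≠ h (tup ![p, v])) → ∃ N, ∀ n, HasLength n T → n ≤ N := by
    refine fun T hT => ⟨0, fun n hn => ?_⟩
    cases n with
    | zero => rfl
    | succ n =>
      obtain ⟨p, v, e, -⟩ := hn.succ_inv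
      exact absurd e (hT p v)
  -- One extension consists of two symbols, the hash and the pair; the induction therefore also
  -- bounds the first component of a pair.
  suffices hT : (∃ N, ∀ n, HasLength n T → n ≤ N) ∧
      ∀ p v, T = tup ![p, v] → ∃ N, ∀ n, HasLength n p → n ≤ N from hT.1
  induction T with
  | var x => exact ⟨zero _ (by simp), by simp⟩
  | name m => exact ⟨zero _ (by simp), by simp⟩
  | app f args ih =>
    refine ⟨?_, fun p v e => ?_⟩
    · by_cases hf : ∃ p v, Term.app f args = h (tup ![p, v])
      · obtain ⟨p, v, e⟩ := hf
        cases e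
        obtain ⟨N, hN⟩ := (ih 0).2 p v rfl
        refine ⟨N + 1, fun n hn => ?_⟩
        cases n with
        | zero => omega
        | succ n =>
          obtain ⟨p', v', e, hp⟩ := hn.succ_inv
          simp [Term.app.injEq] at e
          exact Nat.succ_le_succ (hN n (e.1 ▸ hp))
      · exact zero _ fun p v e => hf ⟨p, v, e⟩
    · cases e
      exact (ih 0).1

/-- Boundedness is essential, since the supremum of an unbounded set of natural numbers is `0` by
convention. -/
theorem lt_length_iff {b : ℕ} {T : Term} : b < length T ↔ HasLength (b + 1) T := by
  have hbd : BddAbove {n | HasLength n T} := by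
    obtain ⟨N, hN⟩ := HasLength.bounded T
    exact ⟨N, hN⟩
  constructor
  · intro hlt
    obtain ⟨T₀, l, hl, e⟩ := Nat.sSup_mem (s := {n | HasLength n T}) ⟨0, T, [], rfl, rfl⟩ hbd
    rw [e]
    exact .of_chain (by rw [hl]; exact hlt)
  · exact fun hT => le_csSup hbd hT

theorem HasLength.of_le {m n : ℕ} {T : Term} (hT : HasLength n T) (hm : m ≤ n) :
    HasLength m T := by
  obtain ⟨T₀, l, rfl, rfl⟩ := hT
  exact .of_chain hm

/-- A third extension would have to come from the constant `pd`. -/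
theorem not_hasLength_hchain {b : ℕ} (hb : 2 ≤ b) : ¬ HasLength (b + 1) hchain := by
  intro hl
  obtain ⟨T₀, l, hl, e⟩ := hl.of_le (show 3 ≤ b + 1 by omega)
  match l, hl with
  | [x, y, z], _ => simp [chain, hchain, Term.app.injEq] at e

/-! ### Terms that the translation does not change -/

/-- Without big registers only `fixLock` could act, and it leaves normal forms alone: a normal lock
value equal to `tt` modulo the theory is `tt`. -/
theorem trans_eq_self {b : ℕ} {Big : Term → Prop} {T : Term} (hn : nf b T = T)
    (hs : ∀ p x y z, (state (tpm p) x y z).IsSubterm T → nf b p = p → ¬ Big p) :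
    trans b Big T = T := by
  induction T with
  | var x => rfl
  | name n => rfl
  | app f args ih =>
    have hn' : ∀ i, nf b (args i) = args i := fun i =>
      irreducible_iff_nf_eq.1 ((irreducible_app.1 (irreducible_iff_nf_eq.2 hn)).1 i)
    have he : ∀ i, trans b Big (args i) = args i := fun i =>
      ih i (hn' i) fun p x y z hS => hs p x y z (.arg f args i hS)
    rw [trans]
    simp only [he]
    unfold fixState
    split
    · rename_i args' e
      cases e
      have eta : args = ![args 0, args 1, args 2, args 3] := by
        funext i
        fin_cases i <;> rfl
      have h₀ : fixTpm Big (args 0) = args 0 := by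
        unfold fixTpm
        split
        · rename_i t h₀
          have ht : t = ![t 0] := by
            funext i
            fin_cases i
            rfl
          have hsub : (state (tpm (t 0)) (args 1) (args 2) (args 3)).IsSubterm
              (.app .state args) := by
            convert Term.IsSubterm.refl using 2
            rw [eta, h₀, ht]
            rfl
          have hp := hn' 0
          rw [h₀, ht, nf_tpm] at hp
          simp only [Term.app.injEq, heq_eq_eq, true_and, Matrix.vecCons_inj, and_true] at hp
          rw [fixPcr_not_big (hs _ _ _ _ hsub hp), h₀]
          exact congrArg (Term.app .tpm) ht.symm
        · rfl
      have h₃ : fixDrt b (args 3) = args 3 := by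
        unfold fixDrt
        split
        · rename_i t h₃
          have ht : t = ![t 0, t 1, t 2] := by
            funext i
            fin_cases i <;> rfl
          have hl := hn' 3
          rw [h₃, ht, nf_drt] at hl
          simp only [Term.app.injEq, heq_eq_eq, true_and, Matrix.vecCons_inj, and_true] at hl
          rw [fixLock, if_neg (by rw [hl.2.2]; tauto), h₃]
          exact congrArg (Term.app .drt) ht.symm
        · rfl
      rw [h₀, h₃]
      exact congrArg (Term.app .state) eta.symm
    · rfl

/-! ### Comparison of two platforms -/

section Comparison

variable {b : ℕ} {Big : Term → Prop} {ext ext' : Proc}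

/-- In an execution of one platform, everything is well typed with respect to the terms that can be
obtained from another one. -/
theorem exists_okConfig (he : IsExtend b ext) (he' : IsExtend b ext') (hB : BigSpec b Big)
    (hB' : ¬ Big hchain)
    (hok : ∀ {K k₀ m₀}, Obtainable b K k₀ m₀ → ExtendOk b Big K k₀ m₀ ext) {Q : Proc} {c : Config}
    (hQ : IsAttacker (.par (TPM ext) EXEC) Q) (hr : Reaches b (.par (TPM ext) EXEC) Q c) :
    ∃ K k₀ m₀ W, Obtainable b K k₀ m₀ ∧ (platformTyping b Big K k₀ m₀).OkConfig b W c ∧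
      ∀ T, K T → T ∈ Att b (.par (TPM ext') EXEC) := by
  have hn := he.names_platform
  have hres := restricted_platform he.restricted
  obtain ⟨i, hi⟩ := exists_index hn hQ (n := .kpp) (by simp [hres, platformNames])
    he.generated_kpp hr
  obtain ⟨j, hj⟩ := exists_index hn hQ (n := .hipp) (by simp [hres, platformNames])
    he.generated_hipp hr
  -- Finiteness allows the environment of the other platform to collect all nonces of this execution
  -- beforehand.
  have hI := finite_names hn hQ (n := .nonce) (by simp [hres, platformNames]) hr
  let B := baseTerms ⟨.kpp, i⟩ ⟨.hipp, j⟩ hI.toFinset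
  have hK : Obtainable b (Yields b ext' B) ⟨.kpp, i⟩ ⟨.hipp, j⟩ :=
    obtainable_yields he'.runs (Or.inl (Or.inl rfl)) (Or.inl (Or.inr (Or.inl rfl)))
      (Or.inl (Or.inr (Or.inr rfl)))
  obtain ⟨W, hW⟩ := Typing.okConfig_of_reaches (platformTyping_sound hK (Big := Big))
    (ok_platform hK hB hB' (hok hK) _ _) he.freeVars_platform
    (ok_of_public hK hQ.publicSig (by simpa [hres] using hQ.names_fresh)
      (by simpa [hres] using hQ.restricted_fresh) (by simp [hQ.closed])) hQ.closed hr (by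
    rintro ⟨n, l⟩ hl
    refine ⟨?_, ?_, ?_⟩
    · rintro rfl
      rw [hi l hl]
    · rintro rfl
      rw [hj l hl]
    · rintro rfl
      exact yields_of_ded fun E hE => hE _ (Or.inr ⟨l, by simpa using hl, rfl⟩))
  exact ⟨_, _, _, W, hK, hW, fun T => he'.mem_att i j _⟩

/-- What an attacker obtains from one platform can be obtained from another one, provided that the
translation does not change it. -/
theorem mem_att_of_trans_eq (he : IsExtend b ext) (he' : IsExtend b ext') (hB : BigSpec b Big)
    (hB' : ¬ Big hchain)
    (hok : ∀ {K k₀ m₀}, Obtainable b K k₀ m₀ → ExtendOk b Big K k₀ m₀ ext) {T : Term}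
    (hT : T ∈ Att b (.par (TPM ext) EXEC)) (ht : trans b Big (nf b T) = nf b T) :
    T ∈ Att b (.par (TPM ext') EXEC) := by
  obtain ⟨Q, hQ, c, hr, hd⟩ := hT
  obtain ⟨K, k₀, m₀, W, hK, hW, hA⟩ := exists_okConfig he he' hB hB' hok hQ hr
  have h₁ := ((platformTyping_sound hK).deduce _ _ hW.known hd : Known b Big K k₀ m₀ (nf b T))
  have h₂ := h₁.obtainable hK
  rw [ht] at h₂
  exact hA T (hK.congr (nf_nf b T) h₂)

theorem bigSpec_false : BigSpec b fun _ => False := ⟨False.elim, False.elim⟩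

theorem bigSpec_hasLength : BigSpec b (HasLength (b + 1)) :=
  ⟨fun hp => hp.trans, fun hp => hp.extend _⟩

/-- With no big values the translation fixes every normal form. -/
theorem att_DRT_subset : Att b DRT ⊆ Att b DRTb := fun _ hT =>
  mem_att_of_trans_eq isExtend_pcrExtend isExtend_pcrExtendBounded bigSpec_false id
    (fun hK => extendOk_pcrExtend hK bigSpec_false) hT
    (trans_eq_self (nf_nf _ _) fun _ _ _ _ _ _ => id)

theorem containsBigState_of_subterm {T p x y z : Term}
    (hS : (state (tpm p) x y z).IsSubterm (nf b T)) (hp : nf b p = p) (hl : HasLength (b + 1) p) :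
    ContainsBigState b T := by
  refine ⟨_, normalForm_iff.2 rfl, _, hS, ⟨_, rfl⟩, p, normalForm_iff.2 ?_, lt_length_iff.2 hl⟩
  rw [(Rule.pcr _ _ _ _).nf_eq, hp]

/-- Every register value changed by the translation would exhibit a big state inside the normal
form. -/
theorem mem_att_DRT (hb : 2 ≤ b) {T : Term} (hT : T ∈ Att b DRTb) (hn : ¬ ContainsBigState b T) :
    T ∈ Att b DRT :=
  mem_att_of_trans_eq isExtend_pcrExtendBounded isExtend_pcrExtend bigSpec_hasLength
    (not_hasLength_hchain hb)
    (fun hK => extendOk_pcrExtendBounded hb hK bigSpec_hasLength fun _ => id) hT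
    (trans_eq_self (nf_nf _ _) fun _ _ _ _ hS hp hl => hn (containsBigState_of_subterm hS hp hl))

/-- The states returned by the bounded module have a big register value. -/
theorem isBigState_of_mem_Mb (hb : 2 ≤ b) {T : Term} (hT : T ∈ Mb b) :
    ∃ S, NormalForm b T S ∧ IsBigState b S := by
  obtain ⟨Q, hQ, N, M, R, ρ, S, hr, hS, hSf, -, hTS⟩ := hT
  obtain ⟨K, k₀, m₀, W, hK, hW, -⟩ := exists_okConfig isExtend_pcrExtendBounded
    isExtend_pcrExtend bigSpec_hasLength (not_hasLength_hchain hb)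
    (fun hK => extendOk_pcrExtendBounded hb hK bigSpec_hasLength fun _ => id) hQ hr
  -- The reply of the bounded module is a running process, hence well typed; the condition on
  -- evaluated terms in its `let` is the desired length.
  obtain ⟨δ, P₀, e, -, hok⟩ := hW.procs _ (Multiset.mem_cons_self _ _)
  rw [normalForm_iff] at hS
  have hl : HasLength (b + 1) (nf b (ρ .newPcr)) := by
    cases P₀ <;> simp only [bigReply, Proc.subst, reduceCtorEq, Proc.letIn.injEq] at e
    refine hok.1 (ρ .pfState) (ρ .newPcr) ?_
    rw [← e.2.1]
    simp only [Term.subst, comp_vecCons, comp_vecEmpty]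
  have hrule := Rule.of_nf_app hS hSf (by simp [Sym.IsDestructor])
  simp only [comp_vecCons, comp_vecEmpty, nf_tpmAcc] at hrule
  obtain ⟨p, x, y, z, -, rfl⟩ := hrule.setPcr_inv
  refine ⟨state (tpm (nf b (ρ .newPcr))) x y z, normalForm_iff.2 ?_, ⟨_, rfl⟩, nf b (ρ .newPcr), normalForm_iff.2 ?_,
    lt_length_iff.2 hl⟩
  · rw [eqE_iff.1 hTS, hSf.nf_eq]
  · rw [(Rule.pcr _ _ _ _).nf_eq, nf_nf]

end Comparison

end TrustedPlatform

theorem mainTheorem3 (b : ℕ) (hb : 2 ≤ b) :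
    TrustedPlatform.Att b TrustedPlatform.DRT ⊆ TrustedPlatform.Att b TrustedPlatform.DRTb ∧
    (∀ T ∈ TrustedPlatform.Mb b,
      ∃ S, TrustedPlatform.NormalForm b T S ∧ TrustedPlatform.IsBigState b S) ∧
    ∃ Mf : Set TrustedPlatform.Term,
      (∀ T ∈ Mf, TrustedPlatform.ContainsBigState b T) ∧
      TrustedPlatform.Att b TrustedPlatform.DRTb ⊆
        TrustedPlatform.Att b TrustedPlatform.DRT ∪ TrustedPlatform.Mb b ∪ Mf := by
  -- The exceptional set `Mf` is taken as large as the theorem permits: all terms whose normal form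
  -- contains a big state.
  refine ⟨TrustedPlatform.att_DRT_subset, fun T => TrustedPlatform.isBigState_of_mem_Mb hb,
    {T | TrustedPlatform.ContainsBigState b T}, fun T hT => hT, fun T hT => ?_⟩
  by_cases hc : TrustedPlatform.ContainsBigState b T
  · exact Or.inr hc
  · exact Or.inl (Or.inl (TrustedPlatform.mem_att_DRT hb hT hc))
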